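/- Let $P\colon E\to B$ be a homomorphism (pseudofunctor) of bicategories. A 1-cell $f\colon x\to y$ of $E$ is *cartesian* if 1. for all $g\colon z\to y$, $h\colon Pz\to Px$ and every isomorphism $\alpha\colon Pf\cdot h\cong Pg$ there is a *lift* of $(h,\alpha)$: a 1-cell $\hat h\colon z\to x$ and isomorphisms $\hat\alpha\colon f\hat h\cong g$, $\hat\beta\colon P\hat h\cong h$ with $\alpha\circ(Pf\cdot\hat\beta)=P\hat\alpha\circ\phi$, where $\phi\colon Pf\cdot P\hat h\cong P(f\hat h)$ is the constraint of $P$; 2. if $(\hat h,\hat\alpha,\hat\beta)$ and $(\hat h',\hat\alpha',\hat\beta')$ are lifts of $(h,\alpha)$ for $g$ and of $(h',\alpha')$ for $g'$, then for all 2-cells $\sigma\colon g\Rightarrow g'$ and $\delta\colon h\Rightarrow h'$ with $\alpha'\circ(Pf\cdot\delta)=P\sigma\circ\alpha$ there is a unique $\hat\delta\colon\hat h\Rightarrow\hat h'$ with $\hat\alpha'\circ(f\hat\delta)=\sigma\circ\hat\alpha$ and $\delta\circ\hat\beta=\hat\beta'\circ P\hat\delta$. A 2-cell is *cartesian* if it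 is cartesian for the functor $P\colon E(x,y)\to B(Px,Py)$. $P$ is a *fibration* if every $f\colon b\to Pe$ equals $Ph$ for a cartesian 1-cell $h$ with target $e$, every functor $E(x,y)\to B(Px,Py)$ is a fibration of categories, and cartesian 2-cells are closed under horizontal composition. Let $P$ be a fibration, with any choice of cartesian lifts $c_f(e)\colon f^*e\to e$ of 1-cells $f$ and of cartesian lifts of 2-cells. The *fibre* $E_b$ is the bicategory whose 0-, 1- and 2-cells are those of $E$ over $b$, $1_b$ and $1_{1_b}$ (for 2-cells, modulo the equality of the images of their source and target with $1_b$). The composite of $u$ and $v$ in $E_b$ is the domain of the chosen cartesian lift, at the composite $vu$ in $E$, of the canonical isomorphism $1_b\cong 1_b1_b\cong P(vu)$; the identity of $x$ is the domain of the chosen lift at $1_x$ of $1_b\cong P(1_x)$; and the remaining structure is transported from $E$ along these (invertible) cartesian 2-cells. **Proposition.** There is a trihomomorphism $F_P\colon B^{\mathrm{coop}}\to\mathbf{Bicat}$ (homomorphisms, strong transformations and modifications; $B^{\mathrm{coop}}$ is $B$ with 1-cells and 2-cells reversed) with the following properties. * $F_P b=E_b$ for every object $b$. * For $f\colon a\to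 b$, $F_P f=f^*\colon E_b\to E_a$ is a homomorphism with the chosen objects $f^*e$, and there are isomorphisms $c_f(e')\cdot f^*u\cong u\cdot c_f(e)$ in $E$, for $u\colon e\to e'$ in $E_b$, over the canonical isomorphism $f\cdot 1_a\cong 1_b\cdot f$, which make the 1-cells $c_f(e)$ the components of a strong transformation from $f^*$ (followed by the inclusion $E_a\to E$) to the inclusion $E_b\to E$. * For $\sigma\colon f\Rightarrow g$, $F_P\sigma=\sigma^*\colon g^*\Rightarrow f^*$ is a strong transformation, and there is a modification whose components are cartesian 2-cells $\psi_\sigma\colon c_f(e)\cdot\sigma^*_e\Rightarrow c_g(e)$ over $f\cdot 1_a\cong f\overset{\sigma}{\Rightarrow}g$; that is, $\sigma^*_e$ factors through $c_f(e)$ the domain of a cartesian lift of $\sigma$ at $c_g(e)$. The constraints of the local homomorphisms $B(a,b)^{\mathrm{op}}\to\mathbf{Bicat}(E_b,E_a)$ are compatible with the $\psi_\sigma$. * The adjoint equivalences $\chi_{f,g}\colon f^*g^*\simeq(gf)^*$ and $\iota_a\colon 1_{E_a}\simeq(1_a)^*$ come with invertible modifications with components $c_{gf}(e)\cdot\chi_{f,g,e}\cong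 c_g(e)\cdot c_f(g^*e)$ and $c_{1_a}(e)\cdot\iota_{a,e}\cong 1_e$ over the canonical isomorphisms $(gf)\cdot 1_a\cong gf$ and $1_a\cdot 1_a\cong 1_a$. * The invertible modifications $\chi_{\alpha,\beta}$ (2-cell components of $\chi$), $\omega$ (associativity) and $\gamma$, $\delta$ (units) are those induced by uniqueness of lifts: each of their components is a 2-cell $\theta\colon s\Rightarrow t$ of a fibre between 1-cells into some $h^*e$, and pasting the 2-cells of the three preceding items gives 2-cells of $E$ from $c_h(e)\cdot s$ and from $c_h(e)\cdot t$ to one and the same composite of cartesian 1-cells $c$ (the identity contributing nothing); $\theta$ satisfies the equation that the former 2-cell is $c_h(e)\cdot\theta$ followed by the latter (modulo the comparisons between composition in the fibre and in $E$), which determines it. -/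

import Mathlib

open CategoryTheory Bicategory
open scoped Pseudofunctor.StrongTrans
universe w₁ w₂ w₃ w₄ v₁ v₂ v₃ v₄ u₁ u₂ u₃ u₄

namespace FibredBicat

section
variable {X : Type u₁} [Bicategory.{w₁, v₁} X] {Y : Type u₂} [Bicategory.{w₂, v₂} Y]
  {Z : Type u₃} [Bicategory.{w₃, v₃} Z] {W : Type u₄} [Bicategory.{w₄, v₄} W]

lemma map₂_associator_inv (G : X ⥤ᵖ Y) {a b c d : X} (f : a ⟶ b) (g : b ⟶ c) (h : c ⟶ d) :
    G.map₂ (α_ f g h).inv = (G.mapComp f (g ≫ h)).hom ≫ G.map f ◁ (G.mapComp g h).hom ≫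
      (α_ (G.map f) (G.map g) (G.map h)).inv ≫ (G.mapComp f g).inv ▷ G.map h ≫
        (G.mapComp (f ≫ g) h).inv := by
  rw [← cancel_mono (G.map₂ (α_ f g h).hom), ← G.map₂_comp, Iso.inv_hom_id, G.map₂_id,
    G.map₂_associator]
  simp

lemma map₂_rightUnitor_inv (G : X ⥤ᵖ Y) {a b : X} (f : a ⟶ b) :
    G.map₂ (ρ_ f).inv = (ρ_ (G.map f)).inv ≫ G.map f ◁ (G.mapId b).inv ≫
      (G.mapComp f (𝟙 b)).inv := by
  rw [← cancel_mono (G.map₂ (ρ_ f).hom), ← G.map₂_comp, Iso.inv_hom_id, G.map₂_id,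
    G.map₂_right_unitor]
  simp

/-- The whiskering of a transformation between homomorphisms out of `Y` by `F : X ⥤ᵖ Y`. -/
def preWhisker (F : X ⥤ᵖ Y) {G G' : Y ⥤ᵖ Z} (η : G ⟶ G') : F.comp G ⟶ F.comp G' where
  app x := η.app (F.obj x)
  naturality f := η.naturality (F.map f)
  naturality_naturality θ := η.naturality_naturality (F.map₂ θ)
  naturality_id x := by
    change (η.naturality (F.map (𝟙 x))).hom ≫
        η.app (F.obj x) ◁ (G'.map₂ (F.mapId x).hom ≫ (G'.mapId (F.obj x)).hom) =
      (G.map₂ (F.mapId x).hom ≫ (G.mapId (F.obj x)).hom) ▷ η.app (F.obj x) ≫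
        (λ_ (η.app (F.obj x))).hom ≫ (ρ_ (η.app (F.obj x))).inv
    rw [Bicategory.whiskerLeft_comp, ← Category.assoc, ← η.naturality_naturality, Category.assoc,
      η.naturality_id, Bicategory.comp_whiskerRight, Category.assoc]
  naturality_comp {a b c} f g := by
    change (η.naturality (F.map (f ≫ g))).hom ≫
        η.app (F.obj a) ◁ (G'.map₂ (F.mapComp f g).hom ≫ (G'.mapComp (F.map f) (F.map g)).hom) =
      (G.map₂ (F.mapComp f g).hom ≫ (G.mapComp (F.map f) (F.map g)).hom) ▷ η.app (F.obj c) ≫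
        (α_ _ _ _).hom ≫ G.map (F.map f) ◁ (η.naturality (F.map g)).hom ≫ (α_ _ _ _).inv ≫
          (η.naturality (F.map f)).hom ▷ G'.map (F.map g) ≫ (α_ _ _ _).hom
    rw [Bicategory.whiskerLeft_comp, ← Category.assoc, ← η.naturality_naturality, Category.assoc,
      η.naturality_comp, Bicategory.comp_whiskerRight, Category.assoc]

/-- The whiskering of a transformation between homomorphisms into `Y` by `G : Y ⥤ᵖ Z`. -/
def postWhisker {F F' : X ⥤ᵖ Y} (η : F ⟶ F') (G : Y ⥤ᵖ Z) : F.comp G ⟶ F'.comp G where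
  app x := G.map (η.app x)
  naturality {x y} f :=
    (G.mapComp (F.map f) (η.app y)).symm ≪≫ G.map₂Iso (η.naturality f) ≪≫
      G.mapComp (η.app x) (F'.map f)
  naturality_naturality {a b f g} θ := by
    change G.map₂ (F.map₂ θ) ▷ G.map (η.app b) ≫ (G.mapComp (F.map g) (η.app b)).inv ≫
        G.map₂ (η.naturality g).hom ≫ (G.mapComp (η.app a) (F'.map g)).hom =
      ((G.mapComp (F.map f) (η.app b)).inv ≫ G.map₂ (η.naturality f).hom ≫
        (G.mapComp (η.app a) (F'.map f)).hom) ≫ G.map (η.app a) ◁ G.map₂ (F'.map₂ θ)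
    have h := congrArg G.map₂ (η.naturality_naturality θ)
    rw [G.map₂_comp, G.map₂_comp, G.map₂_whisker_left, G.map₂_whisker_right] at h
    rw [← cancel_epi (G.mapComp (F.map f) (η.app b)).hom,
      ← cancel_mono (G.mapComp (η.app a) (F'.map g)).inv]
    simpa using h
  naturality_id x := by
    change ((G.mapComp (F.map (𝟙 x)) (η.app x)).inv ≫ G.map₂ (η.naturality (𝟙 x)).hom ≫
        (G.mapComp (η.app x) (F'.map (𝟙 x))).hom) ≫
        G.map (η.app x) ◁ (G.map₂ (F'.mapId x).hom ≫ (G.mapId (F'.obj x)).hom) =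
      (G.map₂ (F.mapId x).hom ≫ (G.mapId (F.obj x)).hom) ▷ G.map (η.app x) ≫
        (λ_ (G.map (η.app x))).hom ≫ (ρ_ (G.map (η.app x))).inv
    have h := congrArg (fun t => (G.mapComp (F.map (𝟙 x)) (η.app x)).inv ≫ G.map₂ t ≫
      (G.mapComp (η.app x) (𝟙 (F'.obj x))).hom ≫ G.map (η.app x) ◁ (G.mapId (F'.obj x)).hom)
      (η.naturality_id x)
    simp only [G.map₂_comp, G.map₂_whisker_left, G.map₂_whisker_right, G.map₂_left_unitor,
      map₂_rightUnitor_inv, Category.assoc, Iso.inv_hom_id_assoc] at h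
    simpa only [Bicategory.whiskerLeft_comp, Bicategory.comp_whiskerRight, Category.assoc,
      Iso.inv_hom_id_assoc, whiskerLeft_inv_hom, Category.comp_id] using h
  naturality_comp {a b c} f g := by
    change ((G.mapComp (F.map (f ≫ g)) (η.app c)).inv ≫ G.map₂ (η.naturality (f ≫ g)).hom ≫
        (G.mapComp (η.app a) (F'.map (f ≫ g))).hom) ≫
        G.map (η.app a) ◁ (G.map₂ (F'.mapComp f g).hom ≫ (G.mapComp (F'.map f) (F'.map g)).hom) =
      (G.map₂ (F.mapComp f g).hom ≫ (G.mapComp (F.map f) (F.map g)).hom) ▷ G.map (η.app c) ≫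
        (α_ _ _ _).hom ≫
        G.map (F.map f) ◁ ((G.mapComp (F.map g) (η.app c)).inv ≫ G.map₂ (η.naturality g).hom ≫
          (G.mapComp (η.app b) (F'.map g)).hom) ≫ (α_ _ _ _).inv ≫
        ((G.mapComp (F.map f) (η.app b)).inv ≫ G.map₂ (η.naturality f).hom ≫
          (G.mapComp (η.app a) (F'.map f)).hom) ▷ G.map (F'.map g) ≫ (α_ _ _ _).hom
    have h := congrArg (fun t => (G.mapComp (F.map (f ≫ g)) (η.app c)).inv ≫ G.map₂ t ≫
      (G.mapComp (η.app a) (F'.map f ≫ F'.map g)).hom ≫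
        G.map (η.app a) ◁ (G.mapComp (F'.map f) (F'.map g)).hom) (η.naturality_comp f g)
    simp only [G.map₂_comp, G.map₂_whisker_left, G.map₂_whisker_right, G.map₂_associator,
      map₂_associator_inv, Category.assoc, Iso.inv_hom_id_assoc] at h
    simpa only [Bicategory.whiskerLeft_comp, Bicategory.comp_whiskerRight, Category.assoc,
      Iso.inv_hom_id_assoc, whiskerLeft_inv_hom, whiskerLeft_inv_hom_assoc, Category.comp_id,
      inv_hom_whiskerRight_assoc] using h

/-- The transformation with identity components relating the two iterated composites. -/
def assocTrans (F : X ⥤ᵖ Y) (G : Y ⥤ᵖ Z) (H : Z ⥤ᵖ W) :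
    (F.comp G).comp H ⟶ F.comp (G.comp H) where
  app x := 𝟙 (H.obj (G.obj (F.obj x)))
  naturality f := ρ_ (H.map (G.map (F.map f))) ≪≫ (λ_ (H.map (G.map (F.map f)))).symm
  naturality_naturality {a b f g} θ := by
    change H.map₂ (G.map₂ (F.map₂ θ)) ▷ 𝟙 (H.obj (G.obj (F.obj b))) ≫
        (ρ_ (H.map (G.map (F.map g)))).hom ≫ (λ_ (H.map (G.map (F.map g)))).inv =
      ((ρ_ (H.map (G.map (F.map f)))).hom ≫ (λ_ (H.map (G.map (F.map f)))).inv) ≫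
        𝟙 (H.obj (G.obj (F.obj a))) ◁ H.map₂ (G.map₂ (F.map₂ θ))
    simp
  naturality_id x := by
    change ((ρ_ (H.map (G.map (F.map (𝟙 x))))).hom ≫ (λ_ (H.map (G.map (F.map (𝟙 x))))).inv) ≫
        𝟙 (H.obj (G.obj (F.obj x))) ◁ (H.map₂ (G.map₂ (F.mapId x).hom) ≫
          H.map₂ (G.mapId (F.obj x)).hom ≫ (H.mapId (G.obj (F.obj x))).hom) =
      (H.map₂ (G.map₂ (F.mapId x).hom ≫ (G.mapId (F.obj x)).hom) ≫
        (H.mapId (G.obj (F.obj x))).hom) ▷ 𝟙 (H.obj (G.obj (F.obj x))) ≫ (λ_ _).hom ≫ (ρ_ _).inv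
    simp [unitors_equal, unitors_inv_equal]
  naturality_comp {a b c} f g := by
    change ((ρ_ (H.map (G.map (F.map (f ≫ g))))).hom ≫
          (λ_ (H.map (G.map (F.map (f ≫ g))))).inv) ≫
        𝟙 (H.obj (G.obj (F.obj a))) ◁ (H.map₂ (G.map₂ (F.mapComp f g).hom) ≫
          H.map₂ (G.mapComp (F.map f) (F.map g)).hom ≫
          (H.mapComp (G.map (F.map f)) (G.map (F.map g))).hom) =
      (H.map₂ (G.map₂ (F.mapComp f g).hom ≫ (G.mapComp (F.map f) (F.map g)).hom) ≫
        (H.mapComp (G.map (F.map f)) (G.map (F.map g))).hom) ▷ 𝟙 (H.obj (G.obj (F.obj c))) ≫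
        (α_ _ _ _).hom ≫ H.map (G.map (F.map f)) ◁ ((ρ_ _).hom ≫ (λ_ _).inv) ≫ (α_ _ _ _).inv ≫
        ((ρ_ _).hom ≫ (λ_ _).inv) ▷ H.map (G.map (F.map g)) ≫ (α_ _ _ _).hom
    simp

/-- The transformation with identity components from the composite of the identity and `F` to `F`. -/
def leftUnitTrans (F : X ⥤ᵖ Y) : (Pseudofunctor.id X).comp F ⟶ F where
  app x := 𝟙 (F.obj x)
  naturality f := ρ_ (F.map f) ≪≫ (λ_ (F.map f)).symm
  naturality_naturality {a b f g} θ := by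
    change F.map₂ θ ▷ 𝟙 (F.obj b) ≫ (ρ_ (F.map g)).hom ≫ (λ_ (F.map g)).inv =
      ((ρ_ (F.map f)).hom ≫ (λ_ (F.map f)).inv) ≫ 𝟙 (F.obj a) ◁ F.map₂ θ
    simp
  naturality_id x := by
    change ((ρ_ (F.map (𝟙 x))).hom ≫ (λ_ (F.map (𝟙 x))).inv) ≫
        𝟙 (F.obj x) ◁ (F.mapId x).hom =
      (F.map₂ (𝟙 (𝟙 x)) ≫ (F.mapId x).hom) ▷ 𝟙 (F.obj x) ≫ (λ_ _).hom ≫ (ρ_ _).inv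
    simp [unitors_equal, unitors_inv_equal]
  naturality_comp {a b c} f g := by
    change ((ρ_ (F.map (f ≫ g))).hom ≫ (λ_ (F.map (f ≫ g))).inv) ≫
        𝟙 (F.obj a) ◁ (F.mapComp f g).hom =
      (F.map₂ (𝟙 (f ≫ g)) ≫ (F.mapComp f g).hom) ▷ 𝟙 (F.obj c) ≫
        (α_ _ _ _).hom ≫ F.map f ◁ ((ρ_ _).hom ≫ (λ_ _).inv) ≫ (α_ _ _ _).inv ≫
        ((ρ_ _).hom ≫ (λ_ _).inv) ▷ F.map g ≫ (α_ _ _ _).hom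
    simp

/-- The transformation with identity components from `F` to the composite of `F` and the identity. -/
def rightUnitTrans (F : X ⥤ᵖ Y) : F ⟶ F.comp (Pseudofunctor.id Y) where
  app x := 𝟙 (F.obj x)
  naturality f := ρ_ (F.map f) ≪≫ (λ_ (F.map f)).symm
  naturality_naturality {a b f g} θ := by
    change F.map₂ θ ▷ 𝟙 (F.obj b) ≫ (ρ_ (F.map g)).hom ≫ (λ_ (F.map g)).inv =
      ((ρ_ (F.map f)).hom ≫ (λ_ (F.map f)).inv) ≫ 𝟙 (F.obj a) ◁ F.map₂ θ
    simp
  naturality_id x := by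
    change ((ρ_ (F.map (𝟙 x))).hom ≫ (λ_ (F.map (𝟙 x))).inv) ≫
        𝟙 (F.obj x) ◁ ((F.mapId x).hom ≫ 𝟙 _) =
      (F.mapId x).hom ▷ 𝟙 (F.obj x) ≫ (λ_ _).hom ≫ (ρ_ _).inv
    simp [unitors_equal, unitors_inv_equal]
  naturality_comp {a b c} f g := by
    change ((ρ_ (F.map (f ≫ g))).hom ≫ (λ_ (F.map (f ≫ g))).inv) ≫
        𝟙 (F.obj a) ◁ ((F.mapComp f g).hom ≫ 𝟙 _) =
      (F.mapComp f g).hom ▷ 𝟙 (F.obj c) ≫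
        (α_ _ _ _).hom ≫ F.map f ◁ ((ρ_ _).hom ≫ (λ_ _).inv) ≫ (α_ _ _ _).inv ≫
        ((ρ_ _).hom ≫ (λ_ _).inv) ▷ F.map g ≫ (α_ _ _ _).hom
    simp

/-- The horizontal composite of two transformations. -/
def hcompTrans {G G' : X ⥤ᵖ Y} {H H' : Y ⥤ᵖ Z} (η : G ⟶ G') (θ : H ⟶ H') :
    G.comp H ⟶ G'.comp H' :=
  preWhisker G θ ≫ postWhisker η H'

/-- The component at `x` of an invertible modification. -/
def appIso {G G' : X ⥤ᵖ Y} {η θ : G ⟶ G'} (Γ : η ≅ θ) (x : X) : η.app x ≅ θ.app x where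
  hom := Γ.hom.as.app x
  inv := Γ.inv.as.app x
  hom_inv_id := congrArg (fun m => m.as.app x) Γ.hom_inv_id
  inv_hom_id := congrArg (fun m => m.as.app x) Γ.inv_hom_id

/-- The horizontal composite of two 2-cells. -/
def hor {a b c : X} {f f' : a ⟶ b} {g g' : b ⟶ c} (α : f ⟶ f') (β : g ⟶ g') :
    f ≫ g ⟶ f' ≫ g' :=
  α ▷ g ≫ f' ◁ β

lemma hor_id {a b c : X} (f : a ⟶ b) (g : b ⟶ c) : hor (𝟙 f) (𝟙 g) = 𝟙 (f ≫ g) := by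
  simp [hor]

lemma hor_comp {a b c : X} {f f' f'' : a ⟶ b} {g g' g'' : b ⟶ c} (α : f ⟶ f') (α' : f' ⟶ f'')
    (β : g ⟶ g') (β' : g' ⟶ g'') : hor α β ≫ hor α' β' = hor (α ≫ α') (β ≫ β') := by
  simp [hor, whisker_exchange_assoc]

lemma hor_assoc {a b c d : X} {f f' : a ⟶ b} {g g' : b ⟶ c} {h h' : c ⟶ d}
    (α : f ⟶ f') (β : g ⟶ g') (γ : h ⟶ h') :
    (α_ f g h).hom ≫ hor α (hor β γ) = hor (hor α β) γ ≫ (α_ f' g' h').hom := by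
  simp [hor]

lemma hor_rightUnitor {a b : X} {f f' : a ⟶ b} (σ : f ⟶ f') :
    (ρ_ f).inv ≫ hor σ (𝟙 (𝟙 b)) = σ ≫ (ρ_ f').inv := by
  simp [hor]

lemma hor_leftUnitor {a b : X} {f f' : a ⟶ b} (σ : f ⟶ f') :
    (λ_ f).hom ≫ σ = hor (𝟙 (𝟙 a)) σ ≫ (λ_ f').hom := by
  simp [hor]

lemma hor_pentagon {a b c d e : X} (f : a ⟶ b) (g : b ⟶ c) (h : c ⟶ d) (k : d ⟶ e) :
    hor (α_ f g h).hom (𝟙 k) ≫ (α_ f (g ≫ h) k).hom ≫ hor (𝟙 f) (α_ g h k).hom =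
      (α_ (f ≫ g) h k).hom ≫ (α_ f g (h ≫ k)).hom := by
  simp [hor]

lemma hor_triangle {a b c : X} (f : a ⟶ b) (g : b ⟶ c) :
    (hor (ρ_ f).inv (𝟙 g) ≫ (α_ f (𝟙 b) g).hom) ≫ hor (𝟙 f) (λ_ g).hom = 𝟙 (f ≫ g) := by
  simp [hor]

end

/-- The action on hom-bicategories of a trihomomorphism `B^coop → Bicat` whose action on objects is
`F`. Both 1-cells and 2-cells are reversed: the hom-category `(a ⟶ b)ᵒᵖ`, regarded as a locally
discrete bicategory, is mapped by a homomorphism to the bicategory `Bicat (F b, F a)` of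
homomorphisms, strong transformations and modifications. -/
structure LocalHoms (B : Type u₁) [Bicategory.{w₁, v₁} B] (F : B → Type u₂)
    [∀ b, Bicategory.{w₂, v₂} (F b)] where
  loc (a b : B) : Pseudofunctor (LocallyDiscrete (a ⟶ b)ᵒᵖ) (F b ⥤ᵖ F a)

namespace LocalHoms

variable {B : Type u₁} [Bicategory.{w₁, v₁} B] {F : B → Type u₂}
  [∀ b, Bicategory.{w₂, v₂} (F b)] (T : LocalHoms B F)

/-- The homomorphism `F f : F b ⥤ᵖ F a` assigned to a 1-cell `f : a ⟶ b`. -/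
def map₁ {a b : B} (f : a ⟶ b) : F b ⥤ᵖ F a := (T.loc a b).obj ⟨Opposite.op f⟩

/-- The transformation `F σ : F g ⟶ F f` assigned to a 2-cell `σ : f ⟶ g`. -/
def map₂ {a b : B} {f g : a ⟶ b} (σ : f ⟶ g) : T.map₁ g ⟶ T.map₁ f :=
  (T.loc a b).map σ.op.toLoc

/-- The component `(F σ)ₓ`. -/
def tw {a b : B} {f g : a ⟶ b} (σ : f ⟶ g) (x : F b) : (T.map₁ g).obj x ⟶ (T.map₁ f).obj x :=
  (T.map₂ σ).app x

/-- The naturality 2-cell `(F σ)ᵤ`. -/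
def twNat {a b : B} {f g : a ⟶ b} (σ : f ⟶ g) {x y : F b} (u : x ⟶ y) :
    (T.map₁ g).map u ≫ T.tw σ y ≅ T.tw σ x ≫ (T.map₁ f).map u :=
  (T.map₂ σ).naturality u

/-- The component at `x` of the constraint `F υ ≅ F τ ≫ F σ`, where `υ = σ ≫ τ`. -/
def twComp {a b : B} {f g h : a ⟶ b} (σ : f ⟶ g) (τ : g ⟶ h) (υ : f ⟶ h) (w : σ ≫ τ = υ)
    (x : F b) : T.tw υ x ≅ T.tw τ x ≫ T.tw σ x :=
  appIso ((T.loc a b).mapComp' τ.op.toLoc σ.op.toLoc υ.op.toLoc (by subst w; rfl)) x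

/-- The component at `x` of the constraint `F σ ≅ 𝟙`, where `σ = 𝟙 f`. -/
def twId {a b : B} {f : a ⟶ b} (σ : f ⟶ f) (w : σ = 𝟙 f) (x : F b) :
    T.tw σ x ≅ 𝟙 ((T.map₁ f).obj x) :=
  appIso ((T.loc a b).mapId' σ.op.toLoc (by subst w; rfl)) x

end LocalHoms

/-- The data of a trihomomorphism `B^coop → Bicat` whose action on objects is `F`: the local
homomorphisms, the equivalences `χ` and `ι`, and the invertible modifications `χ₂`, `ω`, `γ`, `δ`.
`χ` and `χ₂` constitute the pseudo-natural equivalence comparing horizontal composition in `Bicat`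
and in `B`; its adjoint inverse is determined by the adjoint inverses of the 1-cell components, so
only the latter are recorded. `ι a` is a pseudo-natural equivalence of homomorphisms out of the unit
bicategory, so it is an equivalence together with a 2-cell component which is forced by the unit
axiom for transformations. -/
structure TrihomData (B : Type u₁) [Bicategory.{w₁, v₁} B] (F : B → Type u₂)
    [∀ b, Bicategory.{w₂, v₂} (F b)] extends LocalHoms B F where
  /-- The adjoint equivalence from the composite of `F g` and `F f` to `F (f ≫ g)`. -/
  χ {a b c : B} (f : a ⟶ b) (g : b ⟶ c) :
    Bicategory.Equivalence ((toLocalHoms.map₁ g).comp (toLocalHoms.map₁ f))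
      (toLocalHoms.map₁ (f ≫ g))
  /-- The 2-cell component of `χ` at a pair of 2-cells. -/
  χ₂ {a b c : B} {f f' : a ⟶ b} {g g' : b ⟶ c} (α : f ⟶ f') (β : g ⟶ g') :
    hcompTrans (toLocalHoms.map₂ β) (toLocalHoms.map₂ α) ≫ (χ f g).hom ≅
      (χ f' g').hom ≫ toLocalHoms.map₂ (hor α β)
  /-- The adjoint equivalence from the identity to `F (𝟙 a)`. -/
  ι (a : B) : Bicategory.Equivalence (Pseudofunctor.id (F a)) (toLocalHoms.map₁ (𝟙 a))
  /-- The associativity constraint. -/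
  ω {a b c d : B} (f : a ⟶ b) (g : b ⟶ c) (h : c ⟶ d) :
    postWhisker (χ g h).hom (toLocalHoms.map₁ f) ≫ (χ f (g ≫ h)).hom ≫
        toLocalHoms.map₂ (α_ f g h).hom ≅
      assocTrans (toLocalHoms.map₁ h) (toLocalHoms.map₁ g) (toLocalHoms.map₁ f) ≫
        preWhisker (toLocalHoms.map₁ h) (χ f g).hom ≫ (χ (f ≫ g) h).hom
  /-- The unit constraint for composition with `𝟙 b`. -/
  γ {a b : B} (f : a ⟶ b) :
    postWhisker (ι b).hom (toLocalHoms.map₁ f) ≫ (χ f (𝟙 b)).hom ≫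
      toLocalHoms.map₂ (ρ_ f).inv ≅ leftUnitTrans (toLocalHoms.map₁ f)
  /-- The unit constraint for composition with `𝟙 a`. -/
  δ {a b : B} (f : a ⟶ b) :
    toLocalHoms.map₂ (λ_ f).hom ≅ rightUnitTrans (toLocalHoms.map₁ f) ≫
      preWhisker (toLocalHoms.map₁ f) (ι a).hom ≫ (χ (𝟙 a) f).hom

namespace TrihomData

variable {B : Type u₁} [Bicategory.{w₁, v₁} B] {F : B → Type u₂}
  [∀ b, Bicategory.{w₂, v₂} (F b)] (T : TrihomData B F)

/-- The component `(χ f g)ₓ`. -/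
def chi {a b c : B} (f : a ⟶ b) (g : b ⟶ c) (x : F c) :
    (T.map₁ f).obj ((T.map₁ g).obj x) ⟶ (T.map₁ (f ≫ g)).obj x :=
  (T.χ f g).hom.app x

/-- The naturality 2-cell `(χ f g)ᵤ`. -/
def chiNat {a b c : B} (f : a ⟶ b) (g : b ⟶ c) {x y : F c} (u : x ⟶ y) :
    (T.map₁ f).map ((T.map₁ g).map u) ≫ T.chi f g y ≅ T.chi f g x ≫ (T.map₁ (f ≫ g)).map u :=
  (T.χ f g).hom.naturality u

/-- The component at `x` of the modification `χ₂ α β`. -/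
def chi₂ {a b c : B} {f f' : a ⟶ b} {g g' : b ⟶ c} (α : f ⟶ f') (β : g ⟶ g') (x : F c) :
    (T.tw α ((T.map₁ g').obj x) ≫ (T.map₁ f).map (T.tw β x)) ≫ T.chi f g x ≅
      T.chi f' g' x ≫ T.tw (hor α β) x :=
  appIso (T.χ₂ α β) x

/-- The component `(ι a)ₓ`. -/
def iota (a : B) (x : F a) : x ⟶ (T.map₁ (𝟙 a)).obj x :=
  (T.ι a).hom.app x

/-- The naturality 2-cell `(ι a)ᵤ`. -/
def iotaNat (a : B) {x y : F a} (u : x ⟶ y) :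
    u ≫ T.iota a y ≅ T.iota a x ≫ (T.map₁ (𝟙 a)).map u :=
  (T.ι a).hom.naturality u

/-- The component at `x` of the modification `ω f g h`. -/
def omega {a b c d : B} (f : a ⟶ b) (g : b ⟶ c) (h : c ⟶ d) (x : F d) :
    (T.map₁ f).map (T.chi g h x) ≫ T.chi f (g ≫ h) x ≫ T.tw (α_ f g h).hom x ≅
      T.chi f g ((T.map₁ h).obj x) ≫ T.chi (f ≫ g) h x :=
  appIso (T.ω f g h) x ≪≫ λ_ (T.chi f g ((T.map₁ h).obj x) ≫ T.chi (f ≫ g) h x)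

/-- The component at `x` of the modification `γ f`. -/
def gamma {a b : B} (f : a ⟶ b) (x : F b) :
    (T.map₁ f).map (T.iota b x) ≫ T.chi f (𝟙 b) x ≫ T.tw (ρ_ f).inv x ≅
      𝟙 ((T.map₁ f).obj x) :=
  appIso (T.γ f) x

/-- The component at `x` of the modification `δ f`. -/
def delta {a b : B} (f : a ⟶ b) (x : F b) :
    T.tw (λ_ f).hom x ≅ T.iota a ((T.map₁ f).obj x) ≫ T.chi (𝟙 a) f x :=
  appIso (T.δ f) x ≪≫ λ_ (T.iota a ((T.map₁ f).obj x) ≫ T.chi (𝟙 a) f x)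

end TrihomData

/-- The axioms of a trihomomorphism: `χ` is a transformation (`χ₂_id`, `χ₂_comp`), `ω`, `γ` and `δ`
are modifications, and the associativity and unit axioms hold. Equations between modifications are
stated componentwise; `⊗≫` inserts the coherence isomorphisms of the bicategory `F a`. -/
structure TrihomData.IsTrihomomorphism {B : Type u₁} [Bicategory.{w₁, v₁} B] {F : B → Type u₂}
    [∀ b, Bicategory.{w₂, v₂} (F b)] (T : TrihomData B F) : Prop where
  /-- `χ` respects identity 2-cells. -/
  χ₂_id {a b c : B} (f : a ⟶ b) (g : b ⟶ c) (x : F c) :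
    (T.chi₂ (𝟙 f) (𝟙 g) x).hom ⊗≫
        T.chi f g x ◁ (T.twId (hor (𝟙 f) (𝟙 g)) (hor_id f g) x).hom ⊗≫
        𝟙 (T.chi f g x) =
      (T.twId (𝟙 f) rfl ((T.map₁ g).obj x)).hom ▷ (T.map₁ f).map (T.tw (𝟙 g) x) ▷
          T.chi f g x ⊗≫
        (T.map₁ f).map₂ (T.twId (𝟙 g) rfl x).hom ▷ T.chi f g x ⊗≫
        ((T.map₁ f).mapId ((T.map₁ g).obj x)).hom ▷ T.chi f g x ⊗≫
        𝟙 (T.chi f g x)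
  /-- `χ` respects vertical composition. -/
  χ₂_comp {a b c : B} {f f' f'' : a ⟶ b} {g g' g'' : b ⟶ c} (α : f ⟶ f') (α' : f' ⟶ f'')
      (β : g ⟶ g') (β' : g' ⟶ g'') (x : F c) :
    (T.chi₂ (α ≫ α') (β ≫ β') x).hom ⊗≫
        T.chi f'' g'' x ◁
          (T.twComp (hor α β) (hor α' β') (hor (α ≫ α') (β ≫ β')) (hor_comp α α' β β') x).hom =
      (T.twComp α α' (α ≫ α') rfl ((T.map₁ g'').obj x)).hom ▷
          (T.map₁ f).map (T.tw (β ≫ β') x) ▷ T.chi f g x ⊗≫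
        T.tw α' ((T.map₁ g'').obj x) ◁ T.tw α ((T.map₁ g'').obj x) ◁
          (T.map₁ f).map₂ (T.twComp β β' (β ≫ β') rfl x).hom ▷ T.chi f g x ⊗≫
        T.tw α' ((T.map₁ g'').obj x) ◁ T.tw α ((T.map₁ g'').obj x) ◁
          ((T.map₁ f).mapComp (T.tw β' x) (T.tw β x)).hom ▷ T.chi f g x ⊗≫
        T.tw α' ((T.map₁ g'').obj x) ◁ (T.twNat α (T.tw β' x)).inv ▷
          (T.map₁ f).map (T.tw β x) ▷ T.chi f g x ⊗≫
        T.tw α' ((T.map₁ g'').obj x) ◁ (T.map₁ f').map (T.tw β' x) ◁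
          (T.chi₂ α β x).hom ⊗≫
        (T.chi₂ α' β' x).hom ▷ T.tw (hor α β) x ⊗≫
        𝟙 (T.chi f'' g'' x ≫ T.tw (hor α' β') x ≫ T.tw (hor α β) x)
  /-- `ω` is a modification. -/
  ω_naturality {a b c d : B} {f f' : a ⟶ b} {g g' : b ⟶ c} {h h' : c ⟶ d}
      (α : f ⟶ f') (β : g ⟶ g') (γ : h ⟶ h') (x : F d) :
    𝟙 ((T.map₁ f').map (T.chi g' h' x) ≫ T.chi f' (g' ≫ h') x ≫ T.tw (α_ f' g' h').hom x ≫
          T.tw (hor (hor α β) γ) x) ⊗≫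
        (T.omega f' g' h' x).hom ▷ T.tw (hor (hor α β) γ) x ⊗≫
        T.chi f' g' ((T.map₁ h').obj x) ◁ (T.chi₂ (hor α β) γ x).inv ⊗≫
        (T.chi₂ α β ((T.map₁ h').obj x)).inv ▷ (T.map₁ (f ≫ g)).map (T.tw γ x) ▷
          T.chi (f ≫ g) h x ⊗≫
        T.tw α ((T.map₁ g').obj ((T.map₁ h').obj x)) ◁
          (T.map₁ f).map (T.tw β ((T.map₁ h').obj x)) ◁
            (T.chiNat f g (T.tw γ x)).inv ▷ T.chi (f ≫ g) h x ⊗≫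
        𝟙 (T.tw α ((T.map₁ g').obj ((T.map₁ h').obj x)) ≫
          (T.map₁ f).map (T.tw β ((T.map₁ h').obj x)) ≫
          (T.map₁ f).map ((T.map₁ g).map (T.tw γ x)) ≫
          T.chi f g ((T.map₁ h).obj x) ≫ T.chi (f ≫ g) h x) =
      𝟙 ((T.map₁ f').map (T.chi g' h' x) ≫ T.chi f' (g' ≫ h') x ≫ T.tw (α_ f' g' h').hom x ≫
          T.tw (hor (hor α β) γ) x) ⊗≫
        (T.map₁ f').map (T.chi g' h' x) ◁ T.chi f' (g' ≫ h') x ◁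
          (T.twComp (hor (hor α β) γ) (α_ f' g' h').hom _ rfl x).inv ⊗≫
        (T.map₁ f').map (T.chi g' h' x) ◁ T.chi f' (g' ≫ h') x ◁
          (T.twComp (α_ f g h).hom (hor α (hor β γ)) _ (hor_assoc α β γ) x).hom ⊗≫
        (T.map₁ f').map (T.chi g' h' x) ◁ (T.chi₂ α (hor β γ) x).inv ▷
          T.tw (α_ f g h).hom x ⊗≫
        (T.twNat α (T.chi g' h' x)).hom ▷ (T.map₁ f).map (T.tw (hor β γ) x) ▷
          T.chi f (g ≫ h) x ▷ T.tw (α_ f g h).hom x ⊗≫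
        T.tw α ((T.map₁ g').obj ((T.map₁ h').obj x)) ◁
          (((T.map₁ f).mapComp (T.chi g' h' x) (T.tw (hor β γ) x)).inv ≫
            (T.map₁ f).map₂ (T.chi₂ β γ x).inv ≫
            ((T.map₁ f).mapComp (T.tw β ((T.map₁ h').obj x) ≫ (T.map₁ g).map (T.tw γ x))
              (T.chi g h x)).hom ≫
            ((T.map₁ f).mapComp (T.tw β ((T.map₁ h').obj x))
              ((T.map₁ g).map (T.tw γ x))).hom ▷ (T.map₁ f).map (T.chi g h x)) ▷
          (T.chi f (g ≫ h) x ≫ T.tw (α_ f g h).hom x) ⊗≫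
        T.tw α ((T.map₁ g').obj ((T.map₁ h').obj x)) ◁
          (T.map₁ f).map (T.tw β ((T.map₁ h').obj x)) ◁
            (T.map₁ f).map ((T.map₁ g).map (T.tw γ x)) ◁ (T.omega f g h x).hom ⊗≫
        𝟙 (T.tw α ((T.map₁ g').obj ((T.map₁ h').obj x)) ≫
          (T.map₁ f).map (T.tw β ((T.map₁ h').obj x)) ≫
          (T.map₁ f).map ((T.map₁ g).map (T.tw γ x)) ≫
          T.chi f g ((T.map₁ h).obj x) ≫ T.chi (f ≫ g) h x)
  /-- `γ` is a modification. -/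
  γ_naturality {a b : B} {f f' : a ⟶ b} (σ : f ⟶ f') (x : F b) :
    𝟙 ((T.map₁ f').map (T.iota b x) ≫ T.chi f' (𝟙 b) x ≫ T.tw (ρ_ f').inv x ≫ T.tw σ x) ⊗≫
        (T.gamma f' x).hom ▷ T.tw σ x ⊗≫
        𝟙 (T.tw σ x) =
      𝟙 ((T.map₁ f').map (T.iota b x) ≫ T.chi f' (𝟙 b) x ≫ T.tw (ρ_ f').inv x ≫ T.tw σ x) ⊗≫
        (T.map₁ f').map (T.iota b x) ◁ T.chi f' (𝟙 b) x ◁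
          (T.twComp σ (ρ_ f').inv _ rfl x).inv ⊗≫
        (T.map₁ f').map (T.iota b x) ◁ T.chi f' (𝟙 b) x ◁
          (T.twComp (ρ_ f).inv (hor σ (𝟙 (𝟙 b))) _ (hor_rightUnitor σ) x).hom ⊗≫
        (T.map₁ f').map (T.iota b x) ◁ (T.chi₂ σ (𝟙 (𝟙 b)) x).inv ▷ T.tw (ρ_ f).inv x ⊗≫
        (T.map₁ f').map (T.iota b x) ◁ T.tw σ ((T.map₁ (𝟙 b)).obj x) ◁
          ((T.map₁ f).map₂ (T.twId (𝟙 (𝟙 b)) rfl x).hom ≫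
            ((T.map₁ f).mapId ((T.map₁ (𝟙 b)).obj x)).hom) ▷
              (T.chi f (𝟙 b) x ≫ T.tw (ρ_ f).inv x) ⊗≫
        (T.twNat σ (T.iota b x)).hom ▷ (T.chi f (𝟙 b) x ≫ T.tw (ρ_ f).inv x) ⊗≫
        T.tw σ x ◁ (T.gamma f x).hom ⊗≫
        𝟙 (T.tw σ x)
  /-- `δ` is a modification. -/
  δ_naturality {a b : B} {f f' : a ⟶ b} (σ : f ⟶ f') (x : F b) :
    𝟙 (T.tw (λ_ f').hom x ≫ T.tw (hor (𝟙 (𝟙 a)) σ) x) ⊗≫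
        (T.delta f' x).hom ▷ T.tw (hor (𝟙 (𝟙 a)) σ) x ⊗≫
        T.iota a ((T.map₁ f').obj x) ◁ (T.chi₂ (𝟙 (𝟙 a)) σ x).inv ⊗≫
        T.iota a ((T.map₁ f').obj x) ◁
          (T.twId (𝟙 (𝟙 a)) rfl ((T.map₁ f').obj x)).hom ▷
            ((T.map₁ (𝟙 a)).map (T.tw σ x) ≫ T.chi (𝟙 a) f x) ⊗≫
        (T.iotaNat a (T.tw σ x)).inv ▷ T.chi (𝟙 a) f x ⊗≫
        𝟙 (T.tw σ x ≫ T.iota a ((T.map₁ f).obj x) ≫ T.chi (𝟙 a) f x) =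
      𝟙 (T.tw (λ_ f').hom x ≫ T.tw (hor (𝟙 (𝟙 a)) σ) x) ⊗≫
        (T.twComp (hor (𝟙 (𝟙 a)) σ) (λ_ f').hom _ rfl x).inv ⊗≫
        (T.twComp (λ_ f).hom σ _ (hor_leftUnitor σ) x).hom ⊗≫
        T.tw σ x ◁ (T.delta f x).hom ⊗≫
        𝟙 (T.tw σ x ≫ T.iota a ((T.map₁ f).obj x) ≫ T.chi (𝟙 a) f x)
  /-- The associativity axiom. -/
  assoc {a b c d e : B} (f : a ⟶ b) (g : b ⟶ c) (h : c ⟶ d) (k : d ⟶ e) (x : F e) :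
    𝟙 ((T.map₁ f).map ((T.map₁ g).map (T.chi h k x)) ≫ (T.map₁ f).map (T.chi g (h ≫ k) x) ≫
          T.chi f (g ≫ h ≫ k) x ≫ T.tw (α_ f g (h ≫ k)).hom x ≫
          T.tw (α_ (f ≫ g) h k).hom x) ⊗≫
        (T.map₁ f).map ((T.map₁ g).map (T.chi h k x)) ◁
          (T.omega f g (h ≫ k) x).hom ▷ T.tw (α_ (f ≫ g) h k).hom x ⊗≫
        (T.chiNat f g (T.chi h k x)).hom ▷ T.chi (f ≫ g) (h ≫ k) x ▷
          T.tw (α_ (f ≫ g) h k).hom x ⊗≫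
        T.chi f g ((T.map₁ h).obj ((T.map₁ k).obj x)) ◁ (T.omega (f ≫ g) h k x).hom ⊗≫
        𝟙 (T.chi f g ((T.map₁ h).obj ((T.map₁ k).obj x)) ≫
          T.chi (f ≫ g) h ((T.map₁ k).obj x) ≫ T.chi ((f ≫ g) ≫ h) k x) =
      𝟙 ((T.map₁ f).map ((T.map₁ g).map (T.chi h k x)) ≫ (T.map₁ f).map (T.chi g (h ≫ k) x) ≫
          T.chi f (g ≫ h ≫ k) x ≫ T.tw (α_ f g (h ≫ k)).hom x ≫
          T.tw (α_ (f ≫ g) h k).hom x) ⊗≫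
        (T.map₁ f).map ((T.map₁ g).map (T.chi h k x)) ◁ (T.map₁ f).map (T.chi g (h ≫ k) x) ◁
          T.chi f (g ≫ h ≫ k) x ◁
            ((T.twComp (α_ (f ≫ g) h k).hom (α_ f g (h ≫ k)).hom _ rfl x).inv ≫
              (T.twComp (hor (α_ f g h).hom (𝟙 k))
                ((α_ f (g ≫ h) k).hom ≫ hor (𝟙 f) (α_ g h k).hom) _
                (hor_pentagon f g h k) x).hom ≫
              (T.twComp (α_ f (g ≫ h) k).hom (hor (𝟙 f) (α_ g h k).hom) _ rfl x).hom ▷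
                T.tw (hor (α_ f g h).hom (𝟙 k)) x) ⊗≫
        (T.map₁ f).map ((T.map₁ g).map (T.chi h k x)) ◁ (T.map₁ f).map (T.chi g (h ≫ k) x) ◁
          ((T.chi₂ (𝟙 f) (α_ g h k).hom x).inv ≫
            (T.twId (𝟙 f) rfl ((T.map₁ (g ≫ h ≫ k)).obj x)).hom ▷
              (T.map₁ f).map (T.tw (α_ g h k).hom x) ▷ T.chi f ((g ≫ h) ≫ k) x) ▷
            (T.tw (α_ f (g ≫ h) k).hom x ≫ T.tw (hor (α_ f g h).hom (𝟙 k)) x) ⊗≫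
        ((T.map₁ f).map ((T.map₁ g).map (T.chi h k x)) ◁
            ((T.map₁ f).mapComp (T.chi g (h ≫ k) x) (T.tw (α_ g h k).hom x)).inv ≫
          ((T.map₁ f).mapComp ((T.map₁ g).map (T.chi h k x))
            (T.chi g (h ≫ k) x ≫ T.tw (α_ g h k).hom x)).inv ≫
          (T.map₁ f).map₂ (T.omega g h k x).hom ≫
          ((T.map₁ f).mapComp (T.chi g h ((T.map₁ k).obj x)) (T.chi (g ≫ h) k x)).hom) ▷
            (T.chi f ((g ≫ h) ≫ k) x ≫ T.tw (α_ f (g ≫ h) k).hom x ≫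
              T.tw (hor (α_ f g h).hom (𝟙 k)) x) ⊗≫
        (T.map₁ f).map (T.chi g h ((T.map₁ k).obj x)) ◁
          (T.omega f (g ≫ h) k x).hom ▷ T.tw (hor (α_ f g h).hom (𝟙 k)) x ⊗≫
        (T.map₁ f).map (T.chi g h ((T.map₁ k).obj x)) ◁ T.chi f (g ≫ h) ((T.map₁ k).obj x) ◁
          ((T.chi₂ (α_ f g h).hom (𝟙 k) x).inv ≫
            (T.tw (α_ f g h).hom ((T.map₁ k).obj x) ◁
              ((T.map₁ ((f ≫ g) ≫ h)).map₂ (T.twId (𝟙 k) rfl x).hom ≫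
                ((T.map₁ ((f ≫ g) ≫ h)).mapId ((T.map₁ k).obj x)).hom)) ▷
              T.chi ((f ≫ g) ≫ h) k x) ⊗≫
        (T.omega f g h ((T.map₁ k).obj x)).hom ▷ T.chi ((f ≫ g) ≫ h) k x ⊗≫
        𝟙 (T.chi f g ((T.map₁ h).obj ((T.map₁ k).obj x)) ≫
          T.chi (f ≫ g) h ((T.map₁ k).obj x) ≫ T.chi ((f ≫ g) ≫ h) k x)
  /-- The unit axiom. -/
  unit {a b c : B} (f : a ⟶ b) (g : b ⟶ c) (x : F c) :
    𝟙 ((T.map₁ f).map (T.tw (λ_ g).hom x) ≫ T.chi f (𝟙 b ≫ g) x ≫ T.tw (α_ f (𝟙 b) g).hom x ≫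
          T.tw (hor (ρ_ f).inv (𝟙 g)) x) ⊗≫
        ((T.map₁ f).map₂ (T.delta g x).hom ≫
          ((T.map₁ f).mapComp (T.iota b ((T.map₁ g).obj x)) (T.chi (𝟙 b) g x)).hom) ▷
            (T.chi f (𝟙 b ≫ g) x ≫ T.tw (α_ f (𝟙 b) g).hom x ≫
              T.tw (hor (ρ_ f).inv (𝟙 g)) x) ⊗≫
        (T.map₁ f).map (T.iota b ((T.map₁ g).obj x)) ◁
          (T.omega f (𝟙 b) g x).hom ▷ T.tw (hor (ρ_ f).inv (𝟙 g)) x ⊗≫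
        (T.map₁ f).map (T.iota b ((T.map₁ g).obj x)) ◁ T.chi f (𝟙 b) ((T.map₁ g).obj x) ◁
          ((T.chi₂ (ρ_ f).inv (𝟙 g) x).inv ≫
            (T.tw (ρ_ f).inv ((T.map₁ g).obj x) ◁
              ((T.map₁ f).map₂ (T.twId (𝟙 g) rfl x).hom ≫
                ((T.map₁ f).mapId ((T.map₁ g).obj x)).hom)) ▷ T.chi f g x) ⊗≫
        (T.gamma f ((T.map₁ g).obj x)).hom ▷ T.chi f g x ⊗≫
        𝟙 (T.chi f g x) =
      𝟙 ((T.map₁ f).map (T.tw (λ_ g).hom x) ≫ T.chi f (𝟙 b ≫ g) x ≫ T.tw (α_ f (𝟙 b) g).hom x ≫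
          T.tw (hor (ρ_ f).inv (𝟙 g)) x) ⊗≫
        ((T.twId (𝟙 f) rfl ((T.map₁ g).obj x)).inv ▷ (T.map₁ f).map (T.tw (λ_ g).hom x) ▷
            T.chi f (𝟙 b ≫ g) x ≫
          (T.chi₂ (𝟙 f) (λ_ g).hom x).hom) ▷
            (T.tw (α_ f (𝟙 b) g).hom x ≫ T.tw (hor (ρ_ f).inv (𝟙 g)) x) ⊗≫
        T.chi f g x ◁
          (T.tw (hor (𝟙 f) (λ_ g).hom) x ◁
              (T.twComp (hor (ρ_ f).inv (𝟙 g)) (α_ f (𝟙 b) g).hom _ rfl x).inv ≫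
            (T.twComp (hor (ρ_ f).inv (𝟙 g) ≫ (α_ f (𝟙 b) g).hom) (hor (𝟙 f) (λ_ g).hom) _
              rfl x).inv ≫
            (T.twId _ (hor_triangle f g) x).hom) ⊗≫
        𝟙 (T.chi f g x)

/-- A trihomomorphism `B^coop → Bicat` whose action on objects is `F`. -/
structure Trihomomorphism (B : Type u₁) [Bicategory.{w₁, v₁} B] (F : B → Type u₂)
    [∀ b, Bicategory.{w₂, v₂} (F b)] extends TrihomData B F where
  isTrihomomorphism : toTrihomData.IsTrihomomorphism

section Fibration

variable {E : Type u₁} [Bicategory.{w₁, v₁} E] {B : Type u₂} [Bicategory.{w₂, v₂} B]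
  (P : E ⥤ᵖ B)

/-- A lift `(ĥ, α̂, β̂)` of `(h, α)` along the 1-cell `f`, as in the first clause of the definition
of a cartesian 1-cell: `α ∘ (Pf · β̂) = P α̂ ∘ φ`. -/
structure CartLift {x y z : E} (f : x ⟶ y) (g : z ⟶ y) (h : P.obj z ⟶ P.obj x)
    (α : h ≫ P.map f ≅ P.map g) where
  hat : z ⟶ x
  top : hat ≫ f ≅ g
  base : P.map hat ≅ h
  comm : base.hom ▷ P.map f ≫ α.hom = (P.mapComp hat f).inv ≫ P.map₂ top.hom

/-- Cartesian 1-cells of a homomorphism of bicategories. -/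
structure IsCartesian₁ {x y : E} (f : x ⟶ y) : Prop where
  exists_lift {z : E} (g : z ⟶ y) (h : P.obj z ⟶ P.obj x) (α : h ≫ P.map f ≅ P.map g) :
    Nonempty (CartLift P f g h α)
  existsUnique_lift {z : E} {g g' : z ⟶ y} (σ : g ⟶ g') {h h' : P.obj z ⟶ P.obj x}
    {α : h ≫ P.map f ≅ P.map g} {α' : h' ≫ P.map f ≅ P.map g'}
    (L : CartLift P f g h α) (L' : CartLift P f g' h' α') (δ : h ⟶ h')
    (_ : δ ▷ P.map f ≫ α'.hom = α.hom ≫ P.map₂ σ) :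
    ∃! δ' : L.hat ⟶ L'.hat,
      δ' ▷ f ≫ L'.top.hom = L.top.hom ≫ σ ∧ L.base.hom ≫ δ = P.map₂ δ' ≫ L'.base.hom

/-- A 2-cell is cartesian if it is cartesian, as an arrow, for the functor
`P : E(x, y) ⥤ B(Px, Py)`. -/
def IsCartesian₂ {x y : E} {f g : x ⟶ y} (α : f ⟶ g) : Prop :=
  (P.mapFunctor x y).IsStronglyCartesian (P.map₂ α) α

/-- The objects of `E` lying over `b`. -/
structure FibreObj (b : B) where
  obj : E
  isOver : P.obj obj = b

/-- The action of `P` on hom-categories, for objects lying over `b` and `b'`. -/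
def proj : ∀ {b b' : B} (x : FibreObj P b) (y : FibreObj P b'), (x.obj ⟶ y.obj) ⥤ (b ⟶ b')
  | _, _, ⟨x, rfl⟩, ⟨y, rfl⟩ => P.mapFunctor x y

/-- The constraint of `P` on composites, for objects lying over `b`, `b'` and `b''`. -/
def projComp : ∀ {b b' b'' : B} (x : FibreObj P b) (y : FibreObj P b') (z : FibreObj P b'')
    (f : x.obj ⟶ y.obj) (g : y.obj ⟶ z.obj),
    (proj P x z).obj (f ≫ g) ≅ (proj P x y).obj f ≫ (proj P y z).obj g
  | _, _, _, ⟨_, rfl⟩, ⟨_, rfl⟩, ⟨_, rfl⟩, f, g => P.mapComp f g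

/-- The constraint of `P` on identities, for an object lying over `b`. -/
def projId : ∀ {b : B} (x : FibreObj P b), (proj P x x).obj (𝟙 x.obj) ≅ 𝟙 b
  | _, ⟨x, rfl⟩ => P.mapId x

/-- A homomorphism `P : E ⥤ᵖ B` is a fibration if it has cartesian lifts of 1-cells, is locally
fibred, and its cartesian 2-cells are closed under horizontal composition. -/
structure IsFibration : Prop where
  exists_cartesian₁ (e : E) {b : B} (f : b ⟶ P.obj e) :
    ∃ (a : FibreObj P b) (h : a.obj ⟶ e),
      (proj P a ⟨e, rfl⟩).obj h = f ∧ IsCartesian₁ P h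
  locally_fibred (x y : E) : (P.mapFunctor x y).IsFibered
  hor_cartesian {x y z : E} {f f' : x ⟶ y} {g g' : y ⟶ z} (α : f ⟶ f') (β : g ⟶ g') :
    IsCartesian₂ P α → IsCartesian₂ P β → IsCartesian₂ P (hor α β)

/-- A choice of cartesian lifts of 1-cells and of 2-cells. -/
structure Cleavage where
  /-- The object `f^* e`. -/
  pull {b b' : B} (f : b ⟶ b') (e : FibreObj P b') : FibreObj P b
  /-- The chosen cartesian 1-cell `f^* e ⟶ e` over `f`. -/
  cart {b b' : B} (f : b ⟶ b') (e : FibreObj P b') : (pull f e).obj ⟶ e.obj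
  cart_over {b b' : B} (f : b ⟶ b') (e : FibreObj P b') :
    (proj P (pull f e) e).obj (cart f e) = f
  cart_cartesian {b b' : B} (f : b ⟶ b') (e : FibreObj P b') : IsCartesian₁ P (cart f e)
  /-- The domain `σ^* v` of the chosen cartesian lift of `σ` at `v`. -/
  pull₂ {b b' : B} (x : FibreObj P b) (y : FibreObj P b') (v : x.obj ⟶ y.obj) {k : b ⟶ b'}
    (σ : k ⟶ (proj P x y).obj v) : x.obj ⟶ y.obj
  pull₂_over {b b' : B} (x : FibreObj P b) (y : FibreObj P b') (v : x.obj ⟶ y.obj)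
    {k : b ⟶ b'} (σ : k ⟶ (proj P x y).obj v) : (proj P x y).obj (pull₂ x y v σ) = k
  /-- The chosen cartesian 2-cell `σ^* v ⟶ v` over `σ`. -/
  cart₂ {b b' : B} (x : FibreObj P b) (y : FibreObj P b') (v : x.obj ⟶ y.obj) {k : b ⟶ b'}
    (σ : k ⟶ (proj P x y).obj v) : pull₂ x y v σ ⟶ v
  cart₂_over {b b' : B} (x : FibreObj P b) (y : FibreObj P b') (v : x.obj ⟶ y.obj)
    {k : b ⟶ b'} (σ : k ⟶ (proj P x y).obj v) :
    (proj P x y).map (cart₂ x y v σ) = eqToHom (pull₂_over x y v σ) ≫ σ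
  cart₂_cartesian {b b' : B} (x : FibreObj P b) (y : FibreObj P b') (v : x.obj ⟶ y.obj)
    {k : b ⟶ b'} (σ : k ⟶ (proj P x y).obj v) : IsCartesian₂ P (cart₂ x y v σ)

lemma IsFibration.exists_cart₂ {P : E ⥤ᵖ B} (hP : IsFibration P) {b b' : B} (x : FibreObj P b)
    (y : FibreObj P b') (v : x.obj ⟶ y.obj) {k : b ⟶ b'} (σ : k ⟶ (proj P x y).obj v) :
    ∃ (u : x.obj ⟶ y.obj) (w : (proj P x y).obj u = k) (α : u ⟶ v),
      (proj P x y).map α = eqToHom w ≫ σ ∧ IsCartesian₂ P α := by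
  obtain ⟨x, rfl⟩ := x
  obtain ⟨y, rfl⟩ := y
  have := hP.locally_fibred x y
  obtain ⟨u, α, hα⟩ := IsPreFibered.exists_isCartesian (P.mapFunctor x y) (a := v) rfl σ
  have hl : (P.mapFunctor x y).IsHomLift σ α := hα.toIsHomLift
  have hw : P.map u = k := IsHomLift.domain_eq (P.mapFunctor x y) σ α
  subst hw
  have hσ : σ = P.map₂ α := @IsHomLift.eq_of_isHomLift _ _ _ _ (P.mapFunctor x y) _ _ σ α hl
  subst hσ
  exact ⟨u, rfl, α, (Category.id_comp _).symm,
    @Functor.IsFibered.isStronglyCartesian_of_isCartesian _ _ _ _ (P.mapFunctor x y) _ _ _ _ _ _ α hα⟩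

/-- A fibration has a cleavage. -/
lemma IsFibration.nonempty_cleavage {P : E ⥤ᵖ B} (hP : IsFibration P) :
    Nonempty (Cleavage P) := by
  have h1 : ∀ {b b' : B} (f : b ⟶ b') (e : FibreObj P b'),
      ∃ (a : FibreObj P b) (h : a.obj ⟶ e.obj), (proj P a e).obj h = f ∧ IsCartesian₁ P h := by
    rintro b _ f ⟨e, rfl⟩
    exact hP.exists_cartesian₁ e f
  choose p c hc hc' using @h1
  choose q w d hd hd' using @hP.exists_cart₂
  exact ⟨⟨p, c, hc, hc', q, w, d, hd, hd'⟩⟩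

lemma proj_whiskerLeft {b b' b'' : B} (x : FibreObj P b) (y : FibreObj P b')
    (z : FibreObj P b'') (f : x.obj ⟶ y.obj) {g g' : y.obj ⟶ z.obj} (η : g ⟶ g') :
    (proj P x z).map (f ◁ η) =
      (projComp P x y z f g).hom ≫ (proj P x y).obj f ◁ (proj P y z).map η ≫
        (projComp P x y z f g').inv := by
  obtain ⟨x, rfl⟩ := x
  obtain ⟨y, rfl⟩ := y
  obtain ⟨z, rfl⟩ := z
  exact P.map₂_whisker_left f η

lemma proj_whiskerRight {b b' b'' : B} (x : FibreObj P b) (y : FibreObj P b')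
    (z : FibreObj P b'') {f f' : x.obj ⟶ y.obj} (η : f ⟶ f') (g : y.obj ⟶ z.obj) :
    (proj P x z).map (η ▷ g) =
      (projComp P x y z f g).hom ≫ (proj P x y).map η ▷ (proj P y z).obj g ≫
        (projComp P x y z f' g).inv := by
  obtain ⟨x, rfl⟩ := x
  obtain ⟨y, rfl⟩ := y
  obtain ⟨z, rfl⟩ := z
  exact P.map₂_whisker_right η g

lemma proj_associator {b b' b'' b''' : B} (x : FibreObj P b) (y : FibreObj P b')
    (z : FibreObj P b'') (t : FibreObj P b''') (f : x.obj ⟶ y.obj) (g : y.obj ⟶ z.obj)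
    (h : z.obj ⟶ t.obj) :
    (proj P x t).map (α_ f g h).hom =
      (projComp P x z t (f ≫ g) h).hom ≫ (projComp P x y z f g).hom ▷ (proj P z t).obj h ≫
        (α_ _ _ _).hom ≫ (proj P x y).obj f ◁ (projComp P y z t g h).inv ≫
          (projComp P x y t f (g ≫ h)).inv := by
  obtain ⟨x, rfl⟩ := x
  obtain ⟨y, rfl⟩ := y
  obtain ⟨z, rfl⟩ := z
  obtain ⟨t, rfl⟩ := t
  exact P.map₂_associator f g h

lemma proj_leftUnitor {b b' : B} (x : FibreObj P b) (y : FibreObj P b') (f : x.obj ⟶ y.obj) :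
    (proj P x y).map (λ_ f).hom =
      (projComp P x x y (𝟙 x.obj) f).hom ≫ (projId P x).hom ▷ (proj P x y).obj f ≫
        (λ_ _).hom := by
  obtain ⟨x, rfl⟩ := x
  obtain ⟨y, rfl⟩ := y
  exact P.map₂_left_unitor f

lemma proj_rightUnitor {b b' : B} (x : FibreObj P b) (y : FibreObj P b') (f : x.obj ⟶ y.obj) :
    (proj P x y).map (ρ_ f).hom =
      (projComp P x y y f (𝟙 y.obj)).hom ≫ (proj P x y).obj f ◁ (projId P y).hom ≫
        (ρ_ _).hom := by
  obtain ⟨x, rfl⟩ := x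
  obtain ⟨y, rfl⟩ := y
  exact P.map₂_right_unitor f

variable {P}

/-- A 1-cell of `E` together with an identification of its image with `f`. -/
structure Cell {b b' : B} (x : FibreObj P b) (y : FibreObj P b') (f : b ⟶ b') where
  hom : x.obj ⟶ y.obj
  iso : (proj P x y).obj hom ≅ f

namespace Cell

variable {b b' b'' b''' : B} {x : FibreObj P b} {y : FibreObj P b'} {z : FibreObj P b''}
  {t : FibreObj P b'''}

/-- The composite of two such 1-cells, with the identification given by the constraint of `P`. -/
def comp {f : b ⟶ b'} {g : b' ⟶ b''} (u : Cell x y f) (v : Cell y z g) : Cell x z (f ≫ g) where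
  hom := u.hom ≫ v.hom
  iso := projComp P x y z u.hom v.hom ≪≫ whiskerRightIso u.iso ((proj P y z).obj v.hom) ≪≫
    whiskerLeftIso f v.iso

variable (x) in
def id : Cell x x (𝟙 b) where
  hom := 𝟙 x.obj
  iso := projId P x

/-- The 2-cell `η` lies over `σ`, modulo the given identifications. -/
def Lies {f g : b ⟶ b'} (u : Cell x y f) (v : Cell x y g) (η : u.hom ⟶ v.hom) (σ : f ⟶ g) :
    Prop :=
  (proj P x y).map η ≫ v.iso.hom = u.iso.hom ≫ σ

lemma Lies.refl {f : b ⟶ b'} (u : Cell x y f) : Lies u u (𝟙 u.hom) (𝟙 f) := by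
  simp [Lies]

lemma Lies.trans {f g h : b ⟶ b'} {u : Cell x y f} {v : Cell x y g} {w : Cell x y h}
    {η : u.hom ⟶ v.hom} {θ : v.hom ⟶ w.hom} {σ : f ⟶ g} {τ : g ⟶ h}
    (h₁ : Lies u v η σ) (h₂ : Lies v w θ τ) : Lies u w (η ≫ θ) (σ ≫ τ) := by
  simp only [Lies] at *
  rw [Functor.map_comp, Category.assoc, h₂, reassoc_of% h₁]

lemma Lies.symm {f g : b ⟶ b'} {u : Cell x y f} {v : Cell x y g} {η : u.hom ≅ v.hom} {σ : f ≅ g}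
    (h : Lies u v η.hom σ.hom) : Lies v u η.inv σ.inv := by
  simp only [Lies] at *
  rw [Iso.eq_comp_inv, Category.assoc, ← h, ← Category.assoc, ← Functor.map_comp,
    Iso.inv_hom_id, CategoryTheory.Functor.map_id, Category.id_comp]

lemma Lies.congr {f g : b ⟶ b'} {u : Cell x y f} {v : Cell x y g} {η η' : u.hom ⟶ v.hom}
    {σ σ' : f ⟶ g} (h : Lies u v η σ) (h₁ : η = η') (h₂ : σ = σ') : Lies u v η' σ' := by
  subst h₁ h₂; exact h

lemma Lies.whiskerLeft {f : b ⟶ b'} {g g' : b' ⟶ b''} (u : Cell x y f) {v : Cell y z g}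
    {v' : Cell y z g'} {η : v.hom ⟶ v'.hom} {σ : g ⟶ g'} (h : Lies v v' η σ) :
    Lies (u.comp v) (u.comp v') (u.hom ◁ η) (f ◁ σ) := by
  simp only [Lies, comp, Iso.trans_hom, whiskerRightIso_hom, whiskerLeftIso_hom] at *
  rw [proj_whiskerLeft]
  simp only [Category.assoc, Iso.inv_hom_id_assoc, whisker_exchange_assoc,
    ← Bicategory.whiskerLeft_comp, h]

lemma Lies.whiskerRight {f f' : b ⟶ b'} {g : b' ⟶ b''} {u : Cell x y f} {u' : Cell x y f'}
    {η : u.hom ⟶ u'.hom} {σ : f ⟶ f'} (h : Lies u u' η σ) (v : Cell y z g) :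
    Lies (u.comp v) (u'.comp v) (η ▷ v.hom) (σ ▷ g) := by
  simp only [Lies, comp, Iso.trans_hom, whiskerRightIso_hom, whiskerLeftIso_hom] at *
  rw [proj_whiskerRight]
  simp only [Category.assoc, Iso.inv_hom_id_assoc, whisker_exchange,
    ← Bicategory.comp_whiskerRight_assoc, h]

lemma Lies.associator {f : b ⟶ b'} {g : b' ⟶ b''} {h : b'' ⟶ b'''} (u : Cell x y f)
    (v : Cell y z g) (w : Cell z t h) :
    Lies ((u.comp v).comp w) (u.comp (v.comp w)) (α_ u.hom v.hom w.hom).hom (α_ f g h).hom := by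
  simp only [Lies, comp, Iso.trans_hom, whiskerRightIso_hom, whiskerLeftIso_hom]
  rw [proj_associator]
  simp [whisker_exchange_assoc]

lemma Lies.leftUnitor {f : b ⟶ b'} (u : Cell x y f) :
    Lies ((Cell.id x).comp u) u (λ_ u.hom).hom (λ_ f).hom := by
  simp only [Lies, comp, Cell.id, Iso.trans_hom, whiskerRightIso_hom, whiskerLeftIso_hom]
  rw [proj_leftUnitor]
  simp

lemma Lies.rightUnitor {f : b ⟶ b'} (u : Cell x y f) :
    Lies (u.comp (Cell.id y)) u (ρ_ u.hom).hom (ρ_ f).hom := by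
  simp only [Lies, comp, Cell.id, Iso.trans_hom, whiskerRightIso_hom, whiskerLeftIso_hom]
  rw [proj_rightUnitor]
  simp only [Category.assoc, ← whisker_exchange_assoc, Bicategory.whiskerRight_id,
    Iso.inv_hom_id, Category.comp_id]

end Cell

end Fibration

section

variable {X : Type u₁} [Bicategory.{w₁, v₁} X] {a b c d e : X}

lemma aux_id_whiskerLeft {i : a ⟶ a} (j : i ≅ 𝟙 a) {u v cu cv : a ⟶ b} (η : u ⟶ v)
    (φ : cu ≅ i ≫ u) (φ' : cv ≅ i ≫ v) :
    φ.hom ≫ i ◁ η ≫ φ'.inv = (φ.hom ≫ j.hom ▷ u ≫ (λ_ u).hom) ≫ η ≫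
      (((λ_ v).inv ≫ j.inv ▷ v) ≫ φ'.inv) := by
  have h : j.hom ▷ u ≫ (λ_ u).hom ≫ η ≫ (λ_ v).inv ≫ j.inv ▷ v = i ◁ η := by
    rw [← leftUnitor_naturality_assoc, Iso.hom_inv_id_assoc, ← whisker_exchange_assoc,
      hom_inv_whiskerRight, Category.comp_id]
  simp only [Category.assoc, ← h]

lemma aux_whiskerRight_id {i : b ⟶ b} (j : i ≅ 𝟙 b) {u v cu cv : a ⟶ b} (η : u ⟶ v)
    (φ : cu ≅ u ≫ i) (φ' : cv ≅ v ≫ i) :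
    φ.hom ≫ η ▷ i ≫ φ'.inv = (φ.hom ≫ u ◁ j.hom ≫ (ρ_ u).hom) ≫ η ≫
      (((ρ_ v).inv ≫ v ◁ j.inv) ≫ φ'.inv) := by
  have h : u ◁ j.hom ≫ (ρ_ u).hom ≫ η ≫ (ρ_ v).inv ≫ v ◁ j.inv = η ▷ i := by
    rw [← rightUnitor_naturality_assoc, Iso.hom_inv_id_assoc, whisker_exchange_assoc,
      whiskerLeft_hom_inv, Category.comp_id]
  simp only [Category.assoc, ← h]

lemma aux_comp_whiskerLeft {u : a ⟶ b} {v : b ⟶ c} {w w' : c ⟶ d} (η : w ⟶ w')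
    {uv : a ⟶ c} {vw vw' : b ⟶ d} {l l' r r' : a ⟶ d} (φ : uv ≅ u ≫ v) (ψ : vw ≅ v ≫ w)
    (ψ' : vw' ≅ v ≫ w') (p : l ≅ uv ≫ w) (p' : l' ≅ uv ≫ w') (q : r ≅ u ≫ vw)
    (q' : r' ≅ u ≫ vw') :
    p.hom ≫ uv ◁ η ≫ p'.inv =
      (p.hom ≫ φ.hom ▷ w ≫ (α_ u v w).hom ≫ u ◁ ψ.inv ≫ q.inv) ≫
      (q.hom ≫ u ◁ (ψ.hom ≫ v ◁ η ≫ ψ'.inv) ≫ q'.inv) ≫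
      ((((q'.hom ≫ u ◁ ψ'.hom) ≫ (α_ u v w').inv) ≫ φ.inv ▷ w') ≫ p'.inv) := by
  have h : φ.hom ▷ w ≫ (α_ u v w).hom ≫ u ◁ v ◁ η ≫ (α_ u v w').inv ≫ φ.inv ▷ w' = uv ◁ η := by
    rw [← associator_naturality_right_assoc, Iso.hom_inv_id_assoc, ← whisker_exchange_assoc,
      hom_inv_whiskerRight, Category.comp_id]
  simp [← h]

lemma aux_whiskerRight_comp {u u' : a ⟶ b} {v : b ⟶ c} {w : c ⟶ d} (η : u ⟶ u')
    {uv uv' : a ⟶ c} {vw : b ⟶ d} {l l' r r' : a ⟶ d} (φ : uv ≅ u ≫ v) (φ' : uv' ≅ u' ≫ v)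
    (ψ : vw ≅ v ≫ w) (p : l ≅ uv ≫ w) (p' : l' ≅ uv' ≫ w) (q : r ≅ u ≫ vw)
    (q' : r' ≅ u' ≫ vw) :
    q.hom ≫ η ▷ vw ≫ q'.inv =
      ((((q.hom ≫ u ◁ ψ.hom) ≫ (α_ u v w).inv) ≫ φ.inv ▷ w) ≫ p.inv) ≫
      (p.hom ≫ (φ.hom ≫ η ▷ v ≫ φ'.inv) ▷ w ≫ p'.inv) ≫
      (p'.hom ≫ φ'.hom ▷ w ≫ (α_ u' v w).hom ≫ u' ◁ ψ.inv ≫ q'.inv) := by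
  have h : u ◁ ψ.hom ≫ (α_ u v w).inv ≫ η ▷ v ▷ w ≫ (α_ u' v w).hom ≫ u' ◁ ψ.inv = η ▷ vw := by
    rw [associator_naturality_left_assoc, Iso.inv_hom_id_assoc, whisker_exchange_assoc,
      whiskerLeft_hom_inv, Category.comp_id]
  simp [← h]

lemma aux_pentagon {u : a ⟶ b} {v : b ⟶ c} {w : c ⟶ d} {p : d ⟶ e} {uv : a ⟶ c} {vw : b ⟶ d}
    {wp : c ⟶ e} {l r : a ⟶ d} {m n : b ⟶ e} {s₁ s₂ s₃ s₄ s₅ : a ⟶ e} (φuv : uv ≅ u ≫ v)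
    (φvw : vw ≅ v ≫ w) (φwp : wp ≅ w ≫ p) (φl : l ≅ uv ≫ w) (φr : r ≅ u ≫ vw)
    (φm : m ≅ vw ≫ p) (φn : n ≅ v ≫ wp) (φ₁ : s₁ ≅ l ≫ p) (φ₂ : s₂ ≅ r ≫ p) (φ₃ : s₃ ≅ u ≫ m)
    (φ₄ : s₄ ≅ u ≫ n) (φ₅ : s₅ ≅ uv ≫ wp) :
    (φ₁.hom ≫ (φl.hom ≫ φuv.hom ▷ w ≫ (α_ u v w).hom ≫ u ◁ φvw.inv ≫ φr.inv) ▷ p ≫ φ₂.inv) ≫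
      (φ₂.hom ≫ φr.hom ▷ p ≫ (α_ u vw p).hom ≫ u ◁ φm.inv ≫ φ₃.inv) ≫
      (φ₃.hom ≫ u ◁ (φm.hom ≫ φvw.hom ▷ p ≫ (α_ v w p).hom ≫ v ◁ φwp.inv ≫ φn.inv) ≫ φ₄.inv) =
    (φ₁.hom ≫ φl.hom ▷ p ≫ (α_ uv w p).hom ≫ uv ◁ φwp.inv ≫ φ₅.inv) ≫
      (φ₅.hom ≫ φuv.hom ▷ wp ≫ (α_ u v wp).hom ≫ u ◁ φn.inv ≫ φ₄.inv) := by
  simp [whisker_exchange_assoc]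

end

section Fibre

variable {E : Type u₁} [Bicategory.{w₁, v₁} E] {B : Type u₂} [Bicategory.{w₂, v₂} B]
  {P : E ⥤ᵖ B}

lemma IsCartesian₂.isIso {b b' : B} {x : FibreObj P b} {y : FibreObj P b'}
    {f g : x.obj ⟶ y.obj} {α : f ⟶ g} (h : IsCartesian₂ P α)
    (h' : IsIso ((proj P x y).map α)) : IsIso α := by
  obtain ⟨x, rfl⟩ := x
  obtain ⟨y, rfl⟩ := y
  exact @Functor.IsStronglyCartesian.isIso_of_base_isIso _ _ _ _ (P.mapFunctor x y) _ _ _ _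
    (P.map₂ α) α h h'

/-- The fibre `E_b`: its objects are the objects of `E` over `b`. -/
def Fibre (_ : Cleavage P) (b : B) : Type u₁ := FibreObj P b

variable {κ : Cleavage P} {b : B}

/-- The underlying object of `E`. -/
def Fibre.pt (x : Fibre κ b) : FibreObj P b := x

/-- The 1-cells of the fibre are the 1-cells of `E` over `𝟙 b`. -/
structure FibreHom (x y : Fibre κ b) where
  hom : x.pt.obj ⟶ y.pt.obj
  isOver : (proj P x.pt y.pt).obj hom = 𝟙 b

/-- A 1-cell of the fibre, regarded as a 1-cell of `E` over `𝟙 b`. -/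
def FibreHom.cell {x y : Fibre κ b} (u : FibreHom x y) : Cell x.pt y.pt (𝟙 b) where
  hom := u.hom
  iso := eqToIso u.isOver

/-- The 2-cells of the fibre are the 2-cells of `E` over `𝟙 (𝟙 b)`. -/
@[ext]
structure FibreHom₂ {x y : Fibre κ b} (u v : FibreHom x y) where
  hom : u.hom ⟶ v.hom
  isOver : u.cell.Lies v.cell hom (𝟙 (𝟙 b))

/-- The composite of `u` and `v` in the fibre is the domain `(u ≫ v)'` of the chosen cartesian lift
of `𝟙 b ≅ 𝟙 b ≫ 𝟙 b ≅ P (u ≫ v)` at `u ≫ v`. -/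
def FibreHom.comp {x y z : Fibre κ b} (u : FibreHom x y) (v : FibreHom y z) : FibreHom x z where
  hom := κ.pull₂ x.pt z.pt (u.hom ≫ v.hom) ((λ_ (𝟙 b)).inv ≫ (u.cell.comp v.cell).iso.inv)
  isOver := κ.pull₂_over _ _ _ _

/-- The identity of `x` in the fibre is the domain of the chosen cartesian lift
of `𝟙 b ≅ P (𝟙 x)` at `𝟙 x`. -/
def FibreHom.id (x : Fibre κ b) : FibreHom x x where
  hom := κ.pull₂ x.pt x.pt (𝟙 x.pt.obj) (projId P x.pt).inv
  isOver := κ.pull₂_over _ _ _ _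

lemma isIso_cart₂_comp {x y z : Fibre κ b} (u : FibreHom x y) (v : FibreHom y z) :
    IsIso (κ.cart₂ x.pt z.pt (u.hom ≫ v.hom)
      ((λ_ (𝟙 b)).inv ≫ (u.cell.comp v.cell).iso.inv)) := by
  refine (κ.cart₂_cartesian _ _ _ _).isIso ?_
  rw [κ.cart₂_over]
  exact IsIso.comp_isIso' inferInstance
    (IsIso.comp_isIso' inferInstance (Iso.isIso_inv (u.cell.comp v.cell).iso))

lemma isIso_cart₂_id (x : Fibre κ b) :
    IsIso (κ.cart₂ x.pt x.pt (𝟙 x.pt.obj) (projId P x.pt).inv) := by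
  refine (κ.cart₂_cartesian _ _ _ _).isIso ?_
  rw [κ.cart₂_over]
  infer_instance

/-- The invertible cartesian 2-cell from the composite in the fibre to the composite in `E`. -/
noncomputable def FibreHom.compIso {x y z : Fibre κ b} (u : FibreHom x y) (v : FibreHom y z) :
    (u.comp v).hom ≅ u.hom ≫ v.hom :=
  @asIso _ _ _ _ (κ.cart₂ x.pt z.pt (u.hom ≫ v.hom)
    ((λ_ (𝟙 b)).inv ≫ (u.cell.comp v.cell).iso.inv)) (isIso_cart₂_comp u v)

/-- The invertible cartesian 2-cell from the identity in the fibre to the identity in `E`. -/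
noncomputable def FibreHom.idIso (x : Fibre κ b) : (FibreHom.id x).hom ≅ 𝟙 x.pt.obj :=
  @asIso _ _ _ _ (κ.cart₂ x.pt x.pt (𝟙 x.pt.obj) (projId P x.pt).inv) (isIso_cart₂_id x)

lemma FibreHom.lies_compIso {x y z : Fibre κ b} (u : FibreHom x y) (v : FibreHom y z) :
    (u.comp v).cell.Lies (u.cell.comp v.cell) (u.compIso v).hom (λ_ (𝟙 b)).symm.hom := by
  have h := κ.cart₂_over x.pt z.pt (u.hom ≫ v.hom)
    ((λ_ (𝟙 b)).inv ≫ (u.cell.comp v.cell).iso.inv)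
  refine (congrArg (· ≫ (u.cell.comp v.cell).iso.hom) h).trans ?_
  exact (Category.assoc _ _ _).trans (congrArg _ ((Category.assoc _ _ _).trans
    ((congrArg _ (Iso.inv_hom_id (u.cell.comp v.cell).iso)).trans (Category.comp_id _))))

lemma FibreHom.lies_idIso (x : Fibre κ b) :
    (FibreHom.id x).cell.Lies (Cell.id x.pt) (FibreHom.idIso x).hom (Iso.refl (𝟙 b)).hom := by
  have h := κ.cart₂_over x.pt x.pt (𝟙 x.pt.obj) (projId P x.pt).inv
  refine (congrArg (· ≫ (projId P x.pt).hom) h).trans ?_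
  simp only [Category.assoc]
  exact congrArg _ (Iso.inv_hom_id _)

instance fibreHomCategory (x y : Fibre κ b) : Category (FibreHom x y) where
  Hom u v := FibreHom₂ u v
  id u := ⟨𝟙 u.hom, Cell.Lies.refl u.cell⟩
  comp η θ := ⟨η.hom ≫ θ.hom, (η.isOver.trans θ.isOver).congr rfl (Category.comp_id _)⟩
  id_comp _ := FibreHom₂.ext (Category.id_comp _)
  comp_id _ := FibreHom₂.ext (Category.comp_id _)
  assoc _ _ _ := FibreHom₂.ext (Category.assoc _ _ _)

lemma FibreHom.hom₂_ext {x y : Fibre κ b} {u v : FibreHom x y} {η θ : u ⟶ v}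
    (h : η.hom = θ.hom) : η = θ :=
  FibreHom₂.ext h

/-- An invertible 2-cell of `E` over `𝟙 (𝟙 b)` is invertible in the fibre. -/
def FibreHom.mkIso {x y : Fibre κ b} {u v : FibreHom x y} (η : u.hom ≅ v.hom)
    (h : u.cell.Lies v.cell η.hom (𝟙 (𝟙 b))) : u ≅ v where
  hom := ⟨η.hom, h⟩
  inv := ⟨η.inv, Cell.Lies.symm (u := u.cell) (v := v.cell) (σ := Iso.refl (𝟙 b)) h⟩
  hom_inv_id := FibreHom₂.ext η.hom_inv_id
  inv_hom_id := FibreHom₂.ext η.inv_hom_id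

instance fibreCategoryStruct : CategoryStruct (Fibre κ b) where
  Hom x y := FibreHom x y
  id x := FibreHom.id x
  comp u v := FibreHom.comp u v

/-- Whiskering in the fibre is the unique 2-cell compatible, through the comparison 2-cells, with
whiskering in `E`. -/
noncomputable def FibreHom.whiskerLeft {x y z : Fibre κ b} (u : FibreHom x y)
    {v v' : FibreHom y z} (η : v ⟶ v') : u.comp v ⟶ u.comp v' where
  hom := (u.compIso v).hom ≫ u.hom ◁ η.hom ≫ (u.compIso v').inv
  isOver := ((u.lies_compIso v).trans ((Cell.Lies.whiskerLeft u.cell η.isOver).trans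
    (u.lies_compIso v').symm)).congr rfl (by simp)

/-- Whiskering on the other side. -/
noncomputable def FibreHom.whiskerRight {x y z : Fibre κ b} {u u' : FibreHom x y} (η : u ⟶ u')
    (v : FibreHom y z) : u.comp v ⟶ u'.comp v where
  hom := (u.compIso v).hom ≫ η.hom ▷ v.hom ≫ (u'.compIso v).inv
  isOver := ((u.lies_compIso v).trans ((Cell.Lies.whiskerRight η.isOver v.cell).trans
    (u'.lies_compIso v).symm)).congr rfl (by simp)

/-- The associator of the fibre, induced by that of `E`. -/
noncomputable def FibreHom.associator {x y z t : Fibre κ b} (u : FibreHom x y)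
    (v : FibreHom y z) (w : FibreHom z t) : (u.comp v).comp w ≅ u.comp (v.comp w) :=
  FibreHom.mkIso ((u.comp v).compIso w ≪≫ whiskerRightIso (u.compIso v) w.hom ≪≫
    α_ u.hom v.hom w.hom ≪≫ whiskerLeftIso u.hom (v.compIso w).symm ≪≫
      (u.compIso (v.comp w)).symm)
    ((((u.comp v).lies_compIso w).trans ((Cell.Lies.whiskerRight (u.lies_compIso v) w.cell).trans
      ((Cell.Lies.associator u.cell v.cell w.cell).trans
        ((Cell.Lies.whiskerLeft u.cell (v.lies_compIso w).symm).trans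
          (u.lies_compIso (v.comp w)).symm)))).congr rfl (by simp [unitors_equal]))

/-- The left unitor of the fibre, induced by that of `E`. -/
noncomputable def FibreHom.leftUnitor {x y : Fibre κ b} (u : FibreHom x y) :
    (FibreHom.id x).comp u ≅ u :=
  FibreHom.mkIso ((FibreHom.id x).compIso u ≪≫ whiskerRightIso (FibreHom.idIso x) u.hom ≪≫
    λ_ u.hom)
    ((((FibreHom.id x).lies_compIso u).trans
      ((Cell.Lies.whiskerRight (FibreHom.lies_idIso x) u.cell).trans
        (Cell.Lies.leftUnitor u.cell))).congr rfl (by simp))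

/-- The right unitor of the fibre, induced by that of `E`. -/
noncomputable def FibreHom.rightUnitor {x y : Fibre κ b} (u : FibreHom x y) :
    u.comp (FibreHom.id y) ≅ u :=
  FibreHom.mkIso (u.compIso (FibreHom.id y) ≪≫ whiskerLeftIso u.hom (FibreHom.idIso y) ≪≫
    ρ_ u.hom)
    (((u.lies_compIso (FibreHom.id y)).trans
      ((Cell.Lies.whiskerLeft u.cell (FibreHom.lies_idIso y)).trans
        (Cell.Lies.rightUnitor u.cell))).congr rfl (by simp))

/-- The fibre bicategory `E_b`. -/
noncomputable instance fibreBicategory : Bicategory (Fibre κ b) where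
  homCategory x y := fibreHomCategory x y
  whiskerLeft u _ _ η := FibreHom.whiskerLeft u η
  whiskerRight η v := FibreHom.whiskerRight η v
  associator u v w := FibreHom.associator u v w
  leftUnitor u := FibreHom.leftUnitor u
  rightUnitor u := FibreHom.rightUnitor u
  whiskerLeft_id u v := FibreHom₂.ext (by
    change (u.compIso v).hom ≫ u.hom ◁ 𝟙 v.hom ≫ (u.compIso v).inv = 𝟙 (u.comp v).hom
    simp)
  whiskerLeft_comp {x y z} u {v v' v''} η θ := FibreHom₂.ext (by
    change (u.compIso v).hom ≫ u.hom ◁ (η.hom ≫ θ.hom) ≫ (u.compIso v'').inv =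
      ((u.compIso v).hom ≫ u.hom ◁ η.hom ≫ (u.compIso v').inv) ≫
        (u.compIso v').hom ≫ u.hom ◁ θ.hom ≫ (u.compIso v'').inv
    simp)
  id_whiskerLeft {x y} {u v} η := FibreHom₂.ext
    (aux_id_whiskerLeft (FibreHom.idIso x) η.hom ((FibreHom.id x).compIso u)
      ((FibreHom.id x).compIso v))
  comp_whiskerLeft {x y z t} u v {w w'} η := FibreHom₂.ext
    (aux_comp_whiskerLeft η.hom (u.compIso v) (v.compIso w) (v.compIso w')
      ((u.comp v).compIso w) ((u.comp v).compIso w') (u.compIso (v.comp w))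
      (u.compIso (v.comp w')))
  id_whiskerRight u v := FibreHom₂.ext (by
    change (u.compIso v).hom ≫ 𝟙 u.hom ▷ v.hom ≫ (u.compIso v).inv = 𝟙 (u.comp v).hom
    simp)
  comp_whiskerRight {x y z} {u u' u''} η θ v := FibreHom₂.ext (by
    change (u.compIso v).hom ≫ (η.hom ≫ θ.hom) ▷ v.hom ≫ (u''.compIso v).inv =
      ((u.compIso v).hom ≫ η.hom ▷ v.hom ≫ (u'.compIso v).inv) ≫
        (u'.compIso v).hom ≫ θ.hom ▷ v.hom ≫ (u''.compIso v).inv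
    simp)
  whiskerRight_id {x y} {u v} η := FibreHom₂.ext
    (aux_whiskerRight_id (FibreHom.idIso y) η.hom (u.compIso (FibreHom.id y))
      (v.compIso (FibreHom.id y)))
  whiskerRight_comp {x y z t} {u u'} η v w := FibreHom₂.ext
    (aux_whiskerRight_comp η.hom (u.compIso v) (u'.compIso v) (v.compIso w)
      ((u.comp v).compIso w) ((u'.comp v).compIso w) (u.compIso (v.comp w))
      (u'.compIso (v.comp w)))
  whisker_assoc {x y z t} u {v v'} η w := FibreHom₂.ext (by
    change ((u.comp v).compIso w).hom ≫ ((u.compIso v).hom ≫ u.hom ◁ η.hom ≫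
        (u.compIso v').inv) ▷ w.hom ≫ ((u.comp v').compIso w).inv =
      (((u.comp v).compIso w).hom ≫ (u.compIso v).hom ▷ w.hom ≫ (α_ u.hom v.hom w.hom).hom ≫
        u.hom ◁ (v.compIso w).inv ≫ (u.compIso (v.comp w)).inv) ≫
      ((u.compIso (v.comp w)).hom ≫ u.hom ◁ ((v.compIso w).hom ≫ η.hom ▷ w.hom ≫
        (v'.compIso w).inv) ≫ (u.compIso (v'.comp w)).inv) ≫
      ((((u.compIso (v'.comp w)).hom ≫ u.hom ◁ (v'.compIso w).hom) ≫
        (α_ u.hom v'.hom w.hom).inv) ≫ (u.compIso v').inv ▷ w.hom) ≫ ((u.comp v').compIso w).inv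
    simp)
  whisker_exchange {x y z} {u u' v v'} η θ := FibreHom₂.ext (by
    change ((u.compIso v).hom ≫ u.hom ◁ θ.hom ≫ (u.compIso v').inv) ≫
        (u.compIso v').hom ≫ η.hom ▷ v'.hom ≫ (u'.compIso v').inv =
      ((u.compIso v).hom ≫ η.hom ▷ v.hom ≫ (u'.compIso v).inv) ≫
        (u'.compIso v).hom ≫ u'.hom ◁ θ.hom ≫ (u'.compIso v').inv
    simp [whisker_exchange_assoc])
  pentagon {x y z t s} u v w p := FibreHom₂.ext
    (aux_pentagon (u.compIso v) (v.compIso w) (w.compIso p) ((u.comp v).compIso w)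
      (u.compIso (v.comp w)) ((v.comp w).compIso p) (v.compIso (w.comp p))
      (((u.comp v).comp w).compIso p) ((u.comp (v.comp w)).compIso p)
      (u.compIso ((v.comp w).comp p)) (u.compIso (v.comp (w.comp p)))
      ((u.comp v).compIso (w.comp p)))
  triangle {x y z} u v := FibreHom₂.ext (by
    change (((u.comp (FibreHom.id y)).compIso v).hom ≫ (u.compIso (FibreHom.id y)).hom ▷ v.hom ≫
        (α_ u.hom (FibreHom.id y).hom v.hom).hom ≫ u.hom ◁ ((FibreHom.id y).compIso v).inv ≫
          (u.compIso ((FibreHom.id y).comp v)).inv) ≫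
        (u.compIso ((FibreHom.id y).comp v)).hom ≫ u.hom ◁ (((FibreHom.id y).compIso v).hom ≫
          (FibreHom.idIso y).hom ▷ v.hom ≫ (λ_ v.hom).hom) ≫ (u.compIso v).inv =
      ((u.comp (FibreHom.id y)).compIso v).hom ≫ ((u.compIso (FibreHom.id y)).hom ≫
        u.hom ◁ (FibreHom.idIso y).hom ≫ (ρ_ u.hom).hom) ▷ v.hom ≫ (u.compIso v).inv
    simp)

end Fibre

section Reindexing

variable {E : Type u₁} [Bicategory.{w₁, v₁} E] {B : Type u₂} [Bicategory.{w₂, v₂} B]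
  {P : E ⥤ᵖ B}

/-- The inclusion of the fibre `E_b` in `E`. -/
noncomputable def incl (κ : Cleavage P) (b : B) : Fibre κ b ⥤ᵖ E where
  obj x := x.pt.obj
  map u := u.hom
  map₂ η := η.hom
  map₂_id _ := rfl
  map₂_comp _ _ := rfl
  mapId x := FibreHom.idIso x
  mapComp u v := FibreHom.compIso u v
  map₂_whisker_left _ _ _ _ := rfl
  map₂_whisker_right _ _ := rfl
  map₂_associator _ _ _ := rfl
  map₂_left_unitor _ := rfl
  map₂_right_unitor _ := rfl

/-- The data exhibiting the homomorphisms `T.map₁ f` as the reindexing homomorphisms `f^*` along the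
chosen cartesian 1-cells, the transformations `T.map₂ σ` as the transformations `σ^*` obtained by
factoring cartesian lifts of `σ`, and `χ` and `ι` as the comparisons of cartesian 1-cells. -/
structure ReindexingData (κ : Cleavage P) (T : TrihomData B (fun b => Fibre κ b)) where
  /-- The cartesian 1-cells `f^* e ⟶ e`, with the squares relating `f^* u` to `u`. -/
  c {a b : B} (f : a ⟶ b) : (T.map₁ f).comp (incl κ a) ⟶ incl κ b
  /-- The 1-cell `f^* e ⟶ e` is the chosen cartesian lift of `f` at `e`. -/
  c_app {a b : B} (f : a ⟶ b) (e : Fibre κ b) :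
    (⟨((T.map₁ f).obj e).pt, (c f).app e⟩ : (x : FibreObj P a) × (x.obj ⟶ e.pt.obj)) =
      ⟨κ.pull f e.pt, κ.cart f e.pt⟩
  /-- The 2-cell from `g^* e ⟶ f^* e ⟶ e` to `g^* e ⟶ e`, for `σ : f ⟶ g`. -/
  ψ {a b : B} {f g : a ⟶ b} (σ : f ⟶ g) : postWhisker (T.map₂ σ) (incl κ a) ≫ c f ⟶ c g
  /-- The triangle relating `χ f g` to the cartesian 1-cells. -/
  X {a b d : B} (f : a ⟶ b) (g : b ⟶ d) :
    postWhisker (T.χ f g).hom (incl κ a) ≫ c (f ≫ g) ≅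
      assocTrans (T.map₁ g) (T.map₁ f) (incl κ a) ≫ preWhisker (T.map₁ g) (c f) ≫ c g
  /-- The triangle relating `ι a` to the cartesian 1-cells. -/
  I (a : B) : postWhisker (T.ι a).hom (incl κ a) ≫ c (𝟙 a) ≅ leftUnitTrans (incl κ a)

namespace ReindexingData

variable {κ : Cleavage P} {T : TrihomData B (fun b => Fibre κ b)} (R : ReindexingData κ T)

/-- The cartesian 1-cell `f^* e ⟶ e`. -/
noncomputable def cc {a b : B} (f : a ⟶ b) (e : Fibre κ b) :
    (incl κ a).obj ((T.map₁ f).obj e) ⟶ (incl κ b).obj e :=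
  (R.c f).app e

/-- The square relating `f^* u` to `u`. -/
noncomputable def ccNat {a b : B} (f : a ⟶ b) {x y : Fibre κ b} (u : x ⟶ y) :
    (incl κ a).map ((T.map₁ f).map u) ≫ R.cc f y ≅ R.cc f x ≫ (incl κ b).map u :=
  (R.c f).naturality u

/-- The component of `ψ σ` at `e`. -/
noncomputable def psi {a b : B} {f g : a ⟶ b} (σ : f ⟶ g) (e : Fibre κ b) :
    (incl κ a).map (T.tw σ e) ≫ R.cc f e ⟶ R.cc g e :=
  (R.ψ σ).as.app e

/-- The component of `X f g` at `e`. -/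
noncomputable def xi {a b d : B} (f : a ⟶ b) (g : b ⟶ d) (e : Fibre κ d) :
    (incl κ a).map (T.chi f g e) ≫ R.cc (f ≫ g) e ≅ R.cc f ((T.map₁ g).obj e) ≫ R.cc g e :=
  appIso (R.X f g) e ≪≫ λ_ (R.cc f ((T.map₁ g).obj e) ≫ R.cc g e)

/-- The component of `I a` at `e`. -/
noncomputable def ii (a : B) (e : Fibre κ a) :
    (incl κ a).map (T.iota a e) ≫ R.cc (𝟙 a) e ≅ 𝟙 ((incl κ a).obj e) :=
  appIso (R.I a) e

lemma cc_over {a b : B} (f : a ⟶ b) (e : Fibre κ b) :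
    (proj P ((T.map₁ f).obj e).pt e.pt).obj (R.cc f e) = f := by
  have h : ∀ s t : (x : FibreObj P a) × (x.obj ⟶ e.pt.obj), s = t →
      (proj P t.1 e.pt).obj t.2 = f → (proj P s.1 e.pt).obj s.2 = f := by
    rintro s _ rfl h
    exact h
  exact h _ _ (R.c_app f e) (κ.cart_over f e.pt)

/-- The cartesian 1-cell `f^* e ⟶ e`, as a 1-cell over `f`. -/
noncomputable def cell {a b : B} (f : a ⟶ b) (e : Fibre κ b) : Cell ((T.map₁ f).obj e).pt e.pt f where
  hom := R.cc f e
  iso := eqToIso (R.cc_over f e)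

/-- The squares and triangles lie over the canonical 2-cells of `B`, the 2-cells `ψ σ` are cartesian
over `σ`, and all the constraints of `T` are the 2-cells induced, through the cartesian 1-cells,
by these squares and triangles. -/
structure IsReindexing : Prop where
  ccNat_lies {a b : B} (f : a ⟶ b) {x y : Fibre κ b} (u : x ⟶ y) :
    Cell.Lies ((FibreHom.cell ((T.map₁ f).map u)).comp (R.cell f y))
      ((R.cell f x).comp (FibreHom.cell u)) (R.ccNat f u).hom ((λ_ f).hom ≫ (ρ_ f).inv)
  psi_lies {a b : B} {f g : a ⟶ b} (σ : f ⟶ g) (e : Fibre κ b) :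
    Cell.Lies ((FibreHom.cell (T.tw σ e)).comp (R.cell f e)) (R.cell g e) (R.psi σ e)
      ((λ_ f).hom ≫ σ)
  psi_cartesian {a b : B} {f g : a ⟶ b} (σ : f ⟶ g) (e : Fibre κ b) :
    IsCartesian₂ P (R.psi σ e)
  xi_lies {a b d : B} (f : a ⟶ b) (g : b ⟶ d) (e : Fibre κ d) :
    Cell.Lies ((FibreHom.cell (T.chi f g e)).comp (R.cell (f ≫ g) e))
      ((R.cell f ((T.map₁ g).obj e)).comp (R.cell g e)) (R.xi f g e).hom (λ_ (f ≫ g)).hom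
  ii_lies (a : B) (e : Fibre κ a) :
    Cell.Lies ((FibreHom.cell (T.iota a e)).comp (R.cell (𝟙 a) e)) (Cell.id e.pt) (R.ii a e).hom
      (λ_ (𝟙 a)).hom
  /-- The constraint of `T` on vertical composites. -/
  psi_comp {a b : B} {f g h : a ⟶ b} (σ : f ⟶ g) (τ : g ⟶ h) (e : Fibre κ b) :
    R.psi (σ ≫ τ) e =
      (incl κ a).map₂ (T.twComp σ τ _ rfl e).hom ▷ R.cc f e ⊗≫
        ((incl κ a).mapComp (T.tw τ e) (T.tw σ e)).hom ▷ R.cc f e ⊗≫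
        (incl κ a).map (T.tw τ e) ◁ R.psi σ e ⊗≫
        R.psi τ e
  /-- The constraint of `T` on identity 2-cells. -/
  psi_id {a b : B} (f : a ⟶ b) (e : Fibre κ b) :
    R.psi (𝟙 f) e =
      (incl κ a).map₂ (T.twId (𝟙 f) rfl e).hom ▷ R.cc f e ⊗≫
        ((incl κ a).mapId ((T.map₁ f).obj e)).hom ▷ R.cc f e ⊗≫
        𝟙 (R.cc f e)
  /-- The modifications `χ₂`. -/
  chi₂ {a b d : B} {f f' : a ⟶ b} {g g' : b ⟶ d} (α : f ⟶ f') (β : g ⟶ g') (e : Fibre κ d) :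
    (incl κ a).map₂ (T.chi₂ α β e).hom ▷ R.cc (f ≫ g) e ⊗≫
        ((incl κ a).mapComp (T.chi f' g' e) (T.tw (hor α β) e)).hom ▷ R.cc (f ≫ g) e ⊗≫
        (incl κ a).map (T.chi f' g' e) ◁ R.psi (hor α β) e ⊗≫
        (R.xi f' g' e).hom =
      ((incl κ a).mapComp (T.tw α ((T.map₁ g').obj e) ≫ (T.map₁ f).map (T.tw β e))
          (T.chi f g e)).hom ▷ R.cc (f ≫ g) e ⊗≫
        ((incl κ a).mapComp (T.tw α ((T.map₁ g').obj e)) ((T.map₁ f).map (T.tw β e))).hom ▷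
          (incl κ a).map (T.chi f g e) ▷ R.cc (f ≫ g) e ⊗≫
        (incl κ a).map (T.tw α ((T.map₁ g').obj e)) ◁
          (incl κ a).map ((T.map₁ f).map (T.tw β e)) ◁ (R.xi f g e).hom ⊗≫
        (incl κ a).map (T.tw α ((T.map₁ g').obj e)) ◁ (R.ccNat f (T.tw β e)).hom ▷ R.cc g e ⊗≫
        R.psi α ((T.map₁ g').obj e) ▷ (incl κ b).map (T.tw β e) ▷ R.cc g e ⊗≫
        R.cc f' ((T.map₁ g').obj e) ◁ R.psi β e
  /-- The modifications `ω`. -/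
  omega {a b d k : B} (f : a ⟶ b) (g : b ⟶ d) (h : d ⟶ k) (e : Fibre κ k) :
    (incl κ a).map₂ (T.omega f g h e).hom ▷ R.cc ((f ≫ g) ≫ h) e ⊗≫
        ((incl κ a).mapComp (T.chi f g ((T.map₁ h).obj e)) (T.chi (f ≫ g) h e)).hom ▷
          R.cc ((f ≫ g) ≫ h) e ⊗≫
        (incl κ a).map (T.chi f g ((T.map₁ h).obj e)) ◁ (R.xi (f ≫ g) h e).hom ⊗≫
        (R.xi f g ((T.map₁ h).obj e)).hom ▷ R.cc h e ⊗≫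
        𝟙 (R.cc f ((T.map₁ g).obj ((T.map₁ h).obj e)) ≫ R.cc g ((T.map₁ h).obj e) ≫ R.cc h e) =
      ((incl κ a).mapComp ((T.map₁ f).map (T.chi g h e))
          (T.chi f (g ≫ h) e ≫ T.tw (α_ f g h).hom e)).hom ▷ R.cc ((f ≫ g) ≫ h) e ⊗≫
        (incl κ a).map ((T.map₁ f).map (T.chi g h e)) ◁
          ((incl κ a).mapComp (T.chi f (g ≫ h) e) (T.tw (α_ f g h).hom e)).hom ▷
            R.cc ((f ≫ g) ≫ h) e ⊗≫
        (incl κ a).map ((T.map₁ f).map (T.chi g h e)) ◁ (incl κ a).map (T.chi f (g ≫ h) e) ◁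
          R.psi (α_ f g h).hom e ⊗≫
        (incl κ a).map ((T.map₁ f).map (T.chi g h e)) ◁ (R.xi f (g ≫ h) e).hom ⊗≫
        (R.ccNat f (T.chi g h e)).hom ▷ R.cc (g ≫ h) e ⊗≫
        R.cc f ((T.map₁ g).obj ((T.map₁ h).obj e)) ◁ (R.xi g h e).hom
  /-- The modifications `γ`. -/
  gamma {a b : B} (f : a ⟶ b) (e : Fibre κ b) :
    (incl κ a).map₂ (T.gamma f e).hom ▷ R.cc f e ⊗≫
        ((incl κ a).mapId ((T.map₁ f).obj e)).hom ▷ R.cc f e ⊗≫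
        𝟙 (R.cc f e) =
      ((incl κ a).mapComp ((T.map₁ f).map (T.iota b e))
          (T.chi f (𝟙 b) e ≫ T.tw (ρ_ f).inv e)).hom ▷ R.cc f e ⊗≫
        (incl κ a).map ((T.map₁ f).map (T.iota b e)) ◁
          ((incl κ a).mapComp (T.chi f (𝟙 b) e) (T.tw (ρ_ f).inv e)).hom ▷ R.cc f e ⊗≫
        (incl κ a).map ((T.map₁ f).map (T.iota b e)) ◁ (incl κ a).map (T.chi f (𝟙 b) e) ◁
          R.psi (ρ_ f).inv e ⊗≫
        (incl κ a).map ((T.map₁ f).map (T.iota b e)) ◁ (R.xi f (𝟙 b) e).hom ⊗≫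
        (R.ccNat f (T.iota b e)).hom ▷ R.cc (𝟙 b) e ⊗≫
        R.cc f e ◁ (R.ii b e).hom ⊗≫
        𝟙 (R.cc f e)
  /-- The modifications `δ`. -/
  delta {a b : B} (f : a ⟶ b) (e : Fibre κ b) :
    (incl κ a).map₂ (T.delta f e).hom ▷ R.cc (𝟙 a ≫ f) e ⊗≫
        ((incl κ a).mapComp (T.iota a ((T.map₁ f).obj e)) (T.chi (𝟙 a) f e)).hom ▷
          R.cc (𝟙 a ≫ f) e ⊗≫
        (incl κ a).map (T.iota a ((T.map₁ f).obj e)) ◁ (R.xi (𝟙 a) f e).hom ⊗≫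
        (R.ii a ((T.map₁ f).obj e)).hom ▷ R.cc f e ⊗≫
        𝟙 (R.cc f e) =
      R.psi (λ_ f).hom e

end ReindexingData

end Reindexing

end FibredBicat

open FibredBicat

-- A fibre 2-cell into a 1-cell with target `f^* e` is the same thing as a suitable 2-cell of `E`.
-- Let `C` be a cartesian 1-cell and let `p : t ≫ C ⟶ D` be a cartesian 2-cell over `σ`, where `t`
-- belongs to a fibre; such a `p` is called a triangle. Sending `θ : s ⟶ t` to `θ ▷ C ≫ p`, the
-- action of `θ` on `p`, is a bijection from fibre 2-cells to 2-cells `s ≫ C ⟶ D` over the same `σ`: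
-- cartesianness of `p` recovers `θ ▷ C`, and cartesianness of `C` then recovers `θ`. Injectivity is
-- `hom₂_ext_of_cartesian`, surjectivity is `exists_act_eq`, and two cartesian triangles over one
-- 2-cell differ by a unique invertible `θ` (`liftIso`). Cartesian triangles may be pasted and
-- whiskered freely, because cartesian 2-cells are closed under horizontal composition.
--
-- Surjectivity supplies the data. A `Cone` is a homomorphism between fibres with a pseudonatural
-- family of cartesian 1-cells over some `f`; a `ConeHom` is a transformation with cartesian
-- triangles over some 2-cell. Cones and their morphisms are closed under all the compositions and
-- whiskerings that occur in a trihomomorphism. A morphism between two given cones exists over every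
-- 2-cell (`ConeHom.mk'`), and two morphisms over the same 2-cell are isomorphic compatibly with
-- their triangles (`ConeHom.iso`), in only one way (`ConeHom.Compat.ext`). Hence `χ` and `ι` are
-- morphisms over identities, and `χ₂`, `ω`, `γ`, `δ` are the isomorphisms between pairs of
-- morphisms over equal 2-cells of `B`.
--
-- Injectivity supplies the axioms. Both sides are made to act on one cartesian triangle. Each
-- constraint acts by a known rule: structural 2-cells rebracket pastings, and an induced constraint
-- exchanges the two pastings which define it. Both sides therefore evaluate to the same triangle.
-- Equations in `B` enter only through the rule for `twComp`, by which every factorisation of a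
-- 2-cell `υ` leads to the triangle of `υ` itself.

universe w₅ v₅ u₅

namespace FibredBicat

/-! ### Calculus of triangles: action of 2-cells, pasting and whiskering. -/

section Triangles

variable {X : Type u₁} [Bicategory.{w₁, v₁} X] {E : Type u₂} [Bicategory.{w₂, v₂} E]
  (J : X ⥤ᵖ E)

/-- The action of a 2-cell `θ : s ⟶ t` on a triangle `τ : J t ≫ C ⟶ D`. -/
def act {x y : X} {s t : x ⟶ y} (θ : s ⟶ t) {e : E} {C : J.obj y ⟶ e} {D : J.obj x ⟶ e}
    (τ : J.map t ≫ C ⟶ D) : J.map s ≫ C ⟶ D :=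
  J.map₂ θ ▷ C ≫ τ

/-- The pasting of two composable triangles. -/
def star {x y z : X} {u : x ⟶ y} {t : y ⟶ z} {e : E} {C' : J.obj z ⟶ e} {C : J.obj y ⟶ e}
    {D : J.obj x ⟶ e} (υ : J.map u ≫ C ⟶ D) (τ : J.map t ≫ C' ⟶ C) :
    J.map (u ≫ t) ≫ C' ⟶ D :=
  (J.mapComp u t).hom ▷ C' ≫ (α_ _ _ _).hom ≫ J.map u ◁ τ ≫ υ

/-- The identity triangle. -/
def unitTri {x : X} {e : E} (C : J.obj x ⟶ e) : J.map (𝟙 x) ≫ C ⟶ C :=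
  (J.mapId x).hom ▷ C ≫ (λ_ C).hom

/-- The whiskering of a triangle with a 1-cell. -/
def whisk {x y : X} {t : x ⟶ y} {e e' : E} {C : J.obj y ⟶ e} {D : J.obj x ⟶ e}
    (τ : J.map t ≫ C ⟶ D) (Z : e ⟶ e') : J.map t ≫ (C ≫ Z) ⟶ D ≫ Z :=
  (α_ _ _ _).inv ≫ τ ▷ Z

/-- The precomposition of a triangle with a 2-cell. -/
def pre {x y : X} {t : x ⟶ y} {e : E} {C C' : J.obj y ⟶ e} {D : J.obj x ⟶ e}
    (δ : C ⟶ C') (τ : J.map t ≫ C' ⟶ D) : J.map t ≫ C ⟶ D :=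
  J.map t ◁ δ ≫ τ

variable {J}
variable {x y z w : X} {e e' : E}

lemma act_id {t : x ⟶ y} {C : J.obj y ⟶ e} {D : J.obj x ⟶ e} (τ : J.map t ≫ C ⟶ D) :
    act J (𝟙 t) τ = τ := by
  simp [act]

lemma act_comp {s t r : x ⟶ y} (θ : s ⟶ t) (θ' : t ⟶ r) {C : J.obj y ⟶ e} {D : J.obj x ⟶ e}
    (τ : J.map r ≫ C ⟶ D) : act J (θ ≫ θ') τ = act J θ (act J θ' τ) := by
  simp [act]

lemma act_inv_hom {s t : x ⟶ y} (θ : s ≅ t) {C : J.obj y ⟶ e} {D : J.obj x ⟶ e}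
    (τ : J.map t ≫ C ⟶ D) : act J θ.inv (act J θ.hom τ) = τ := by
  rw [← act_comp, Iso.inv_hom_id, act_id]

lemma act_inv_eq {s t : x ⟶ y} (θ : s ≅ t) {C : J.obj y ⟶ e} {D : J.obj x ⟶ e}
    {τ : J.map t ≫ C ⟶ D} {υ : J.map s ≫ C ⟶ D} (h : act J θ.hom τ = υ) :
    act J θ.inv υ = τ := by
  rw [← h, act_inv_hom]

lemma act_whiskerLeft (u : x ⟶ y) {s t : y ⟶ z} (θ : s ⟶ t) {C' : J.obj z ⟶ e}
    {C : J.obj y ⟶ e} {D : J.obj x ⟶ e} (υ : J.map u ≫ C ⟶ D) (τ : J.map t ≫ C' ⟶ C) :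
    act J (u ◁ θ) (star J υ τ) = star J υ (act J θ τ) := by
  simp [act, star, J.map₂_whisker_left]

lemma act_whiskerRight {u v : x ⟶ y} (θ : u ⟶ v) (t : y ⟶ z) {C' : J.obj z ⟶ e}
    {C : J.obj y ⟶ e} {D : J.obj x ⟶ e} (υ : J.map v ≫ C ⟶ D) (τ : J.map t ≫ C' ⟶ C) :
    act J (θ ▷ t) (star J υ τ) = star J (act J θ υ) τ := by
  simp [act, star, J.map₂_whisker_right, whisker_exchange_assoc]

/-- Pasting is associative up to the action of the associator. Together with the unitor rules below,
this removes every coherence 2-cell from an evaluated equation by plain rewriting. -/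
lemma act_associator_hom {u : x ⟶ y} {v : y ⟶ z} {t : z ⟶ w} {C₀ : J.obj w ⟶ e}
    {C₁ : J.obj z ⟶ e} {C₂ : J.obj y ⟶ e} {C₃ : J.obj x ⟶ e} (υ : J.map u ≫ C₂ ⟶ C₃)
    (ν : J.map v ≫ C₁ ⟶ C₂) (τ : J.map t ≫ C₀ ⟶ C₁) :
    act J (α_ u v t).hom (star J υ (star J ν τ)) = star J (star J υ ν) τ := by
  simp [act, star, J.map₂_associator, whisker_exchange_assoc]

lemma act_associator_inv {u : x ⟶ y} {v : y ⟶ z} {t : z ⟶ w} {C₀ : J.obj w ⟶ e}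
    {C₁ : J.obj z ⟶ e} {C₂ : J.obj y ⟶ e} {C₃ : J.obj x ⟶ e} (υ : J.map u ≫ C₂ ⟶ C₃)
    (ν : J.map v ≫ C₁ ⟶ C₂) (τ : J.map t ≫ C₀ ⟶ C₁) :
    act J (α_ u v t).inv (star J (star J υ ν) τ) = star J υ (star J ν τ) :=
  act_inv_eq _ (act_associator_hom υ ν τ)

lemma act_leftUnitor_hom {t : x ⟶ y} {C : J.obj y ⟶ e} {D : J.obj x ⟶ e}
    (τ : J.map t ≫ C ⟶ D) : act J (λ_ t).hom τ = star J (unitTri J D) τ := by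
  simp [act, star, unitTri, J.map₂_left_unitor, whisker_exchange_assoc]

lemma act_leftUnitor_inv {t : x ⟶ y} {C : J.obj y ⟶ e} {D : J.obj x ⟶ e}
    (τ : J.map t ≫ C ⟶ D) : act J (λ_ t).inv (star J (unitTri J D) τ) = τ :=
  act_inv_eq _ (act_leftUnitor_hom τ)

lemma act_rightUnitor_hom {t : x ⟶ y} {C : J.obj y ⟶ e} {D : J.obj x ⟶ e}
    (τ : J.map t ≫ C ⟶ D) : act J (ρ_ t).hom τ = star J τ (unitTri J C) := by
  simp [act, star, unitTri, J.map₂_right_unitor]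

lemma act_rightUnitor_inv {t : x ⟶ y} {C : J.obj y ⟶ e} {D : J.obj x ⟶ e}
    (τ : J.map t ≫ C ⟶ D) : act J (ρ_ t).inv (star J τ (unitTri J C)) = τ :=
  act_inv_eq _ (act_rightUnitor_hom τ)

/-- The coherence isomorphism hidden in `⊗≫` is exposed, so that its associators and unitors can act
by the preceding rules. -/
lemma act_bicategoricalComp {s t t' r : x ⟶ y} [BicategoricalCoherence t t'] (θ : s ⟶ t)
    (θ' : t' ⟶ r) {C : J.obj y ⟶ e} {D : J.obj x ⟶ e} (τ : J.map r ≫ C ⟶ D) :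
    act J (θ ⊗≫ θ') τ =
      act J θ (act J (BicategoricalCoherence.iso (f := t) (g := t')).hom (act J θ' τ)) := by
  simp [act, bicategoricalComp]

lemma act_whisk {s t : x ⟶ y} (θ : s ⟶ t) {C : J.obj y ⟶ e} {D : J.obj x ⟶ e}
    (τ : J.map t ≫ C ⟶ D) (Z : e ⟶ e') :
    act J θ (whisk J τ Z) = whisk J (act J θ τ) Z := by
  simp [act, whisk]

lemma star_whisk {u : x ⟶ y} {t : y ⟶ z} {C' : J.obj z ⟶ e} {C : J.obj y ⟶ e}
    {D : J.obj x ⟶ e} (υ : J.map u ≫ C ⟶ D) (τ : J.map t ≫ C' ⟶ C) (Z : e ⟶ e') :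
    star J (whisk J υ Z) (whisk J τ Z) = whisk J (star J υ τ) Z := by
  simp [star, whisk]

lemma unitTri_whisk {C : J.obj x ⟶ e} (Z : e ⟶ e') :
    whisk J (unitTri J C) Z = unitTri J (C ≫ Z) := by
  simp [unitTri, whisk]

lemma whisk_comp {t : x ⟶ y} {C : J.obj y ⟶ e} {D D' : J.obj x ⟶ e}
    (τ : J.map t ≫ C ⟶ D) (δ : D ⟶ D') (Z : e ⟶ e') :
    whisk J (τ ≫ δ) Z = whisk J τ Z ≫ δ ▷ Z := by
  simp [whisk]

lemma whisk_exchange {t : x ⟶ y} {C : J.obj y ⟶ e} {D : J.obj x ⟶ e}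
    (τ : J.map t ≫ C ⟶ D) {Z Z' : e ⟶ e'} (δ : Z ⟶ Z') :
    whisk J τ Z ≫ D ◁ δ = pre J (C ◁ δ) (whisk J τ Z') := by
  simp [whisk, pre, ← whisker_exchange]

lemma whisk_whisk {e'' : E} {t : x ⟶ y} {C : J.obj y ⟶ e} {D : J.obj x ⟶ e}
    (τ : J.map t ≫ C ⟶ D) (Z : e ⟶ e') (W : e' ⟶ e'') :
    whisk J (whisk J τ Z) W ≫ (α_ D Z W).hom = pre J (α_ C Z W).hom (whisk J τ (Z ≫ W)) := by
  simp [whisk, pre]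

lemma act_comp_right {s t : x ⟶ y} (θ : s ⟶ t) {C : J.obj y ⟶ e} {D D' : J.obj x ⟶ e}
    (τ : J.map t ≫ C ⟶ D) (δ : D ⟶ D') : act J θ (τ ≫ δ) = act J θ τ ≫ δ := by
  simp [act]

lemma pre_comp_right {t : x ⟶ y} {C C' : J.obj y ⟶ e} {D D' : J.obj x ⟶ e}
    (δ : C ⟶ C') (τ : J.map t ≫ C' ⟶ D) (δ' : D ⟶ D') :
    pre J δ (τ ≫ δ') = pre J δ τ ≫ δ' := by
  simp [pre]

lemma pre_pre {t : x ⟶ y} {C C' C'' : J.obj y ⟶ e} {D : J.obj x ⟶ e}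
    (δ : C ⟶ C') (δ' : C' ⟶ C'') (τ : J.map t ≫ C'' ⟶ D) :
    pre J δ (pre J δ' τ) = pre J (δ ≫ δ') τ := by
  simp [pre]

lemma pre_id {t : x ⟶ y} {C : J.obj y ⟶ e} {D : J.obj x ⟶ e} (τ : J.map t ≫ C ⟶ D) :
    pre J (𝟙 C) τ = τ := by
  simp [pre]

lemma star_comp_left {u : x ⟶ y} {t : y ⟶ z} {C' : J.obj z ⟶ e} {C : J.obj y ⟶ e}
    {D D' : J.obj x ⟶ e} (υ : J.map u ≫ C ⟶ D) (δ : D ⟶ D') (τ : J.map t ≫ C' ⟶ C) :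
    star J (υ ≫ δ) τ = star J υ τ ≫ δ := by
  simp [star]

/-- A 2-cell at the edge shared by two triangles may be counted with either of them. Associators
between composite legs are cancelled by shifting them across this edge. -/
lemma star_comp_right {u : x ⟶ y} {t : y ⟶ z} {C' : J.obj z ⟶ e} {C C'' : J.obj y ⟶ e}
    {D : J.obj x ⟶ e} (υ : J.map u ≫ C'' ⟶ D) (τ : J.map t ≫ C' ⟶ C) (δ : C ⟶ C'') :
    star J υ (τ ≫ δ) = star J (pre J δ υ) τ := by
  simp [star, pre]

lemma star_pre {u : x ⟶ y} {t : y ⟶ z} {C' C'' : J.obj z ⟶ e} {C : J.obj y ⟶ e}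
    {D : J.obj x ⟶ e} (υ : J.map u ≫ C ⟶ D) (δ : C' ⟶ C'') (τ : J.map t ≫ C'' ⟶ C) :
    star J υ (pre J δ τ) = pre J δ (star J υ τ) := by
  simp [star, pre, whisker_exchange_assoc]

end Triangles

/-! ### Transport of triangles along a transformation. -/

section Transformations

variable {X : Type u₁} [Bicategory.{w₁, v₁} X] {Y : Type u₂} [Bicategory.{w₂, v₂} Y]
  {E : Type u₃} [Bicategory.{w₃, v₃} E] {J : X ⥤ᵖ E} {K : Y ⥤ᵖ E} {G H : Y ⥤ᵖ X}

section PushTri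

variable {x y z : Y} {x' y' z' : X} {C₁ : J.obj x' ⟶ K.obj x} {C₂ : J.obj y' ⟶ K.obj y}
  {C₃ : J.obj z' ⟶ K.obj z} {e e' : E}

/-- The pasting of a square `n` with a triangle `τ`. -/
def pushTri {t : x ⟶ y} {t' : x' ⟶ y'} (n : J.map t' ≫ C₂ ⟶ C₁ ≫ K.map t) {C : K.obj y ⟶ e}
    {D : K.obj x ⟶ e} (τ : K.map t ≫ C ⟶ D) : J.map t' ≫ (C₂ ≫ C) ⟶ C₁ ≫ D :=
  whisk J n C ≫ (α_ _ _ _).hom ≫ C₁ ◁ τ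

/-- The hypothesis concerns the squares alone, while the conclusion covers every triangle pasted to
them. No transformation is presupposed, so this rule and the next two serve both in the construction
of `f^*`, before its naturality squares form a transformation, and for transformations already
given. -/
lemma act_pushTri {u v : x ⟶ y} {u' v' : x' ⟶ y'} {θ : u ⟶ v} {θ' : u' ⟶ v'}
    {n : J.map u' ≫ C₂ ⟶ C₁ ≫ K.map u} {m : J.map v' ≫ C₂ ⟶ C₁ ≫ K.map v}
    (h : act J θ' m = n ≫ C₁ ◁ K.map₂ θ) {C : K.obj y ⟶ e} {D : K.obj x ⟶ e}
    (τ : K.map v ≫ C ⟶ D) : act J θ' (pushTri m τ) = pushTri n (act K θ τ) := by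
  rw [pushTri, act_comp_right, act_whisk, h, pushTri, whisk_comp]
  simp [act]

lemma act_unitTri_pushTri {v : x' ⟶ x'} {θ : v ⟶ 𝟙 x'} {n : J.map v ≫ C₁ ⟶ C₁ ≫ K.map (𝟙 x)}
    (h : act J θ (unitTri J C₁) = n ≫ C₁ ◁ (K.mapId x).hom ≫ (ρ_ _).hom) (C : K.obj x ⟶ e) :
    act J θ (unitTri J (C₁ ≫ C)) = pushTri n (unitTri K C) := by
  rw [← unitTri_whisk, act_whisk, h, pushTri, whisk_comp]
  simp [unitTri]

/-- By interchange the two squares can be pasted before the two triangles; the hypothesis then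
replaces the pasted squares by the square of the composite. -/
lemma act_star_pushTri {u : x ⟶ y} {v : y ⟶ z} {u' : x' ⟶ y'} {v' : y' ⟶ z'} {w : x' ⟶ z'}
    {θ : w ⟶ u' ≫ v'} {n : J.map u' ≫ C₂ ⟶ C₁ ≫ K.map u} {m : J.map v' ≫ C₃ ⟶ C₂ ≫ K.map v}
    {l : J.map w ≫ C₃ ⟶ C₁ ≫ K.map (u ≫ v)}
    (h : act J θ (star J (whisk J n (K.map v)) m) =
      l ≫ C₁ ◁ (K.mapComp u v).hom ≫ (α_ _ _ _).inv) {C : K.obj z ⟶ e}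
    {C' : K.obj y ⟶ e} {D : K.obj x ⟶ e} (υ : K.map u ≫ C' ⟶ D) (τ : K.map v ≫ C ⟶ C') :
    act J θ (star J (pushTri n υ) (pushTri m τ)) = pushTri l (star K υ τ) := by
  have h' : star J (pushTri n υ) (pushTri m τ) =
      whisk J (star J (whisk J n (K.map v)) m) C ≫
        (α_ _ _ _).hom ▷ C ≫ (α_ _ _ _).hom ≫ C₁ ◁ ((α_ _ _ _).hom ≫ K.map u ◁ τ ≫ υ) := by
    have h1 : J.map u' ◁ C₂ ◁ τ ≫ (α_ _ _ _).inv ≫ n ▷ C' =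
      (α_ _ _ _).inv ≫ n ▷ (K.map v ≫ C) ≫ (C₁ ≫ K.map u) ◁ τ := by
      rw [← whisker_exchange]
      simp
    simp [star, whisk, pushTri, reassoc_of% h1]
  rw [h', act_comp_right, act_whisk, h, pushTri, whisk_comp]
  simp [star]

lemma pushTri_comp {t : x ⟶ y} {t' : x' ⟶ y'} (n : J.map t' ≫ C₂ ⟶ C₁ ≫ K.map t)
    {C : K.obj y ⟶ e} {D D' : K.obj x ⟶ e} (τ : K.map t ≫ C ⟶ D) (δ : D ⟶ D') :
    pushTri n (τ ≫ δ) = pushTri n τ ≫ C₁ ◁ δ := by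
  simp [pushTri]

lemma pushTri_whisk {t : x ⟶ y} {t' : x' ⟶ y'} (n : J.map t' ≫ C₂ ⟶ C₁ ≫ K.map t)
    {C : K.obj y ⟶ e} {D : K.obj x ⟶ e} (τ : K.map t ≫ C ⟶ D) (Z : e ⟶ e') :
    whisk J (pushTri n τ) Z ≫ (α_ _ _ _).hom =
      pre J (α_ _ _ _).hom (pushTri n (whisk K τ Z)) := by
  simp [pushTri, whisk, pre]

lemma pushTri_rightUnitor {t : x ⟶ y} {t' : x' ⟶ y'} (n : J.map t' ≫ C₂ ⟶ C₁ ≫ K.map t) :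
    pushTri n (ρ_ (K.map t)).hom = pre J (ρ_ C₂).hom n := by
  simp [pushTri, whisk, pre]

lemma pushTri_pushTri_assoc {W : Type u₄} [Bicategory.{w₄, v₄} W] {L : W ⥤ᵖ E} {x'' y'' : W}
    {D₁ : L.obj x'' ⟶ J.obj x'} {D₂ : L.obj y'' ⟶ J.obj y'} {t : x ⟶ y} {t' : x' ⟶ y'}
    {t'' : x'' ⟶ y''} (n : J.map t' ≫ C₂ ⟶ C₁ ≫ K.map t) (m : L.map t'' ≫ D₂ ⟶ D₁ ≫ J.map t')
    {C : K.obj y ⟶ e} {D : K.obj x ⟶ e} (τ : K.map t ≫ C ⟶ D) :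
    pushTri (K := K) (pushTri m n ≫ (α_ _ _ _).inv) τ ≫ (α_ _ _ _).hom =
      pre L (α_ _ _ _).hom (pushTri m (pushTri n τ)) := by
  simp [pushTri, whisk, pre]

end PushTri

/-- The component of a transformation `G.comp J ⟶ K`. -/
def leg (p : G.comp J ⟶ K) (y : Y) : J.obj (G.obj y) ⟶ K.obj y :=
  p.app y

/-- The naturality 2-cell of a transformation `G.comp J ⟶ K`, as a triangle. -/
def natTri (p : G.comp J ⟶ K) {x y : Y} (u : x ⟶ y) :
    J.map (G.map u) ≫ leg p y ⟶ leg p x ≫ K.map u :=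
  (p.naturality u).hom

/-- The image under `G` of a triangle `τ`, through a transformation `p : G.comp J ⟶ K`. -/
def push (p : G.comp J ⟶ K) {x y : Y} {t : x ⟶ y} {e : E} {C : K.obj y ⟶ e}
    {D : K.obj x ⟶ e} (τ : K.map t ≫ C ⟶ D) :
    J.map (G.map t) ≫ (leg p y ≫ C) ⟶ leg p x ≫ D :=
  pushTri (natTri p t) τ

variable (p : G.comp J ⟶ K) {e e' : E}

/-- The three axioms of a strong transformation, here and in the two lemmas below, in the form
required as hypotheses by the `pushTri` rules. -/
lemma act_map₂_natTri {x y : Y} {u v : x ⟶ y} (θ : u ⟶ v) :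
    act J (G.map₂ θ) (natTri p v) = natTri p u ≫ leg p x ◁ K.map₂ θ :=
  p.naturality_naturality θ

lemma act_mapId_unitTri_leg (x : Y) :
    act J (G.mapId x).hom (unitTri J (leg p x)) =
      natTri p (𝟙 x) ≫ leg p x ◁ (K.mapId x).hom ≫ (ρ_ _).hom := by
  have h : natTri p (𝟙 x) ≫ leg p x ◁ (K.mapId x).hom =
    (J.map₂ (G.mapId x).hom ≫ (J.mapId (G.obj x)).hom) ▷ leg p x ≫ (λ_ (leg p x)).hom ≫
      (ρ_ (leg p x)).inv := p.naturality_id x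
  rw [← Category.assoc, h]
  simp [act, unitTri]

lemma act_mapComp_star_natTri {x y z : Y} (u : x ⟶ y) (v : y ⟶ z) :
    act J (G.mapComp u v).hom (star J (whisk J (natTri p u) (K.map v)) (natTri p v)) =
      natTri p (u ≫ v) ≫ leg p x ◁ (K.mapComp u v).hom ≫ (α_ _ _ _).inv := by
  have h : (natTri p (u ≫ v)) ≫ leg p x ◁ (K.mapComp u v).hom =
    (J.map₂ (G.mapComp u v).hom ≫ (J.mapComp (G.map u) (G.map v)).hom) ▷ leg p z ≫
      (α_ _ _ _).hom ≫ J.map (G.map u) ◁ natTri p v ≫ (α_ _ _ _).inv ≫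
        natTri p u ▷ K.map v ≫ (α_ _ _ _).hom := p.naturality_comp u v
  rw [← Category.assoc (natTri p (u ≫ v)), h]
  simp [act, star, whisk]

lemma act_map₂_push {x y : Y} {u v : x ⟶ y} (θ : u ⟶ v) {C : K.obj y ⟶ e} {D : K.obj x ⟶ e}
    (τ : K.map v ≫ C ⟶ D) : act J (G.map₂ θ) (push p τ) = push p (act K θ τ) :=
  act_pushTri (act_map₂_natTri p θ) τ

lemma act_mapId_push {x : Y} (C : K.obj x ⟶ e) :
    act J (G.mapId x).hom (unitTri J (leg p x ≫ C)) = push p (unitTri K C) :=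
  act_unitTri_pushTri (act_mapId_unitTri_leg p x) C

/-- Transport commutes with pasting: this is how the composition constraint of a homomorphism
between fibres is evaluated in all later calculations. -/
lemma act_mapComp_push {x y z : Y} {u : x ⟶ y} {v : y ⟶ z} {C : K.obj z ⟶ e}
    {C' : K.obj y ⟶ e} {D : K.obj x ⟶ e} (υ : K.map u ≫ C' ⟶ D) (τ : K.map v ≫ C ⟶ C') :
    act J (G.mapComp u v).hom (star J (push p υ) (push p τ)) = push p (star K υ τ) :=
  act_star_pushTri (act_mapComp_star_natTri p u v) υ τ

lemma act_mapComp_inv_push {x y z : Y} {u : x ⟶ y} {v : y ⟶ z} {C : K.obj z ⟶ e}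
    {C' : K.obj y ⟶ e} {D : K.obj x ⟶ e} (υ : K.map u ≫ C' ⟶ D) (τ : K.map v ≫ C ⟶ C') :
    act J (G.mapComp u v).inv (push p (star K υ τ)) = star J (push p υ) (push p τ) :=
  act_inv_eq _ (act_mapComp_push p υ τ)

lemma push_comp {x y : Y} {t : x ⟶ y} {C : K.obj y ⟶ e} {D D' : K.obj x ⟶ e}
    (τ : K.map t ≫ C ⟶ D) (δ : D ⟶ D') : push p (τ ≫ δ) = push p τ ≫ leg p x ◁ δ :=
  pushTri_comp _ τ δ

lemma push_whisk {x y : Y} {t : x ⟶ y} {C : K.obj y ⟶ e} {D : K.obj x ⟶ e}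
    (τ : K.map t ≫ C ⟶ D) (Z : e ⟶ e') :
    whisk J (push p τ) Z ≫ (α_ _ _ _).hom = pre J (α_ _ _ _).hom (push p (whisk K τ Z)) :=
  pushTri_whisk _ τ Z

end Transformations

end FibredBicat

namespace FibredBicat

/-! ### Closure properties of cartesian 1-cells and 2-cells. -/

section Cartesian

variable {E : Type u₁} [Bicategory.{w₁, v₁} E] {B : Type u₂} [Bicategory.{w₂, v₂} B]
  {P : E ⥤ᵖ B}

lemma IsCartesian₂.of_iso {x y : E} {f g : x ⟶ y} (α : f ≅ g) : IsCartesian₂ P α.hom :=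
  have : (P.mapFunctor x y).IsHomLift (P.map₂ α.hom) α.hom := .map _
  Functor.IsStronglyCartesian.of_iso (P.mapFunctor x y) (P.map₂ α.hom) α

lemma IsCartesian₂.comp {x y : E} {f g h : x ⟶ y} {α : f ⟶ g} {β : g ⟶ h}
    (hα : IsCartesian₂ P α) (hβ : IsCartesian₂ P β) : IsCartesian₂ P (α ≫ β) := by
  have h := @Functor.IsStronglyCartesian.comp _ _ _ _ (P.mapFunctor x y) _ _ _ _ _ _
    (P.map₂ α) (P.map₂ β) α β hα hβ
  rw [IsCartesian₂, P.map₂_comp]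
  exact h

lemma IsCartesian₂.existsUnique {x y : E} {f g k : x ⟶ y} {α : f ⟶ g} (hα : IsCartesian₂ P α)
    (β : k ⟶ g) (γ : P.map k ⟶ P.map f) (h : P.map₂ β = γ ≫ P.map₂ α) :
    ∃! δ : k ⟶ f, P.map₂ δ = γ ∧ δ ≫ α = β := by
  have hβ : (P.mapFunctor x y).IsHomLift (P.map₂ β) β := .map _
  obtain ⟨δ, ⟨h₁, h₂⟩, h₃⟩ := @Functor.IsStronglyCartesian.universal_property _ _ _ _
    (P.mapFunctor x y) _ _ _ _ (P.map₂ α) α hα _ _ γ (P.map₂ β) h β hβ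
  refine ⟨δ, ⟨?_, h₂⟩, ?_⟩
  · exact (@IsHomLift.eq_of_isHomLift _ _ _ _ (P.mapFunctor x y) _ _ γ δ h₁).symm
  · rintro δ' ⟨rfl, h₄⟩
    exact h₃ δ' ⟨.map _, h₄⟩

/-- Whiskering is horizontal composition with an identity, which is cartesian because it is
invertible. -/
lemma IsFibration.whiskerLeft_cartesian (hP : IsFibration P) {x y z : E} (f : x ⟶ y)
    {g g' : y ⟶ z} {β : g ⟶ g'} (hβ : IsCartesian₂ P β) : IsCartesian₂ P (f ◁ β) := by
  have h := hP.hor_cartesian (𝟙 f) β (.of_iso (Iso.refl f)) hβ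
  simpa [hor] using h

lemma IsFibration.whiskerRight_cartesian (hP : IsFibration P) {x y z : E} {f f' : x ⟶ y}
    {α : f ⟶ f'} (hα : IsCartesian₂ P α) (g : y ⟶ z) : IsCartesian₂ P (α ▷ g) := by
  have h := hP.hor_cartesian α (𝟙 g) hα (.of_iso (Iso.refl g))
  simpa [hor] using h

/-- 2-cells between composites with a cartesian 1-cell `f` come from unique 2-cells. -/
lemma IsCartesian₁.existsUnique {x y z : E} {f : x ⟶ y} (hf : IsCartesian₁ P f) {s t : z ⟶ x}
    (η : s ≫ f ⟶ t ≫ f) (δ : P.map s ⟶ P.map t)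
    (h : P.map₂ η = (P.mapComp s f).hom ≫ δ ▷ P.map f ≫ (P.mapComp t f).inv) :
    ∃! θ : s ⟶ t, P.map₂ θ = δ ∧ θ ▷ f = η := by
  -- Every `s` is tautologically a lift of its own image, with identity isomorphisms.
  let L (s : z ⟶ x) : CartLift P f (s ≫ f) (P.map s) (P.mapComp s f).symm :=
    ⟨s, Iso.refl _, Iso.refl _, by simp⟩
  obtain ⟨θ, ⟨h₁, h₂⟩, h₃⟩ := hf.existsUnique_lift η (L s) (L t) δ (by simp [h])
  simp only [L, Iso.refl_hom, Category.comp_id, Category.id_comp] at h₁ h₂ h₃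
  exact ⟨θ, ⟨h₂.symm, h₁⟩, fun θ' h' => h₃ θ' ⟨h'.2, h'.1.symm⟩⟩

/-- The second clause of the definition need only be tested on tautological lifts: arbitrary lifts
differ from these by the isomorphisms `top` and `base`, which can be absorbed into the two given
2-cells. -/
lemma IsCartesian₁.of_existsUnique {x y : E} {f : x ⟶ y}
    (h₁ : ∀ {z : E} (g : z ⟶ y) (h : P.obj z ⟶ P.obj x) (α : h ≫ P.map f ≅ P.map g),
      Nonempty (CartLift P f g h α))
    (h₂ : ∀ {z : E} {s t : z ⟶ x} (η : s ≫ f ⟶ t ≫ f) (δ : P.map s ⟶ P.map t),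
      P.map₂ η = (P.mapComp s f).hom ≫ δ ▷ P.map f ≫ (P.mapComp t f).inv →
        ∃! θ : s ⟶ t, P.map₂ θ = δ ∧ θ ▷ f = η) : IsCartesian₁ P f where
  exists_lift := h₁
  existsUnique_lift {z g g'} σ {h h' α α'} L L' δ w := by
    -- The given 2-cells conjugated by the isomorphisms of the lifts; the equations `comm` of both
    -- lifts turn the assumption on `σ` and `δ` into the one required here.
    obtain ⟨θ, ⟨h₃, h₄⟩, h₅⟩ := h₂ (L.top.hom ≫ σ ≫ L'.top.inv) (L.base.hom ≫ δ ≫ L'.base.inv) (by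
      have e₁ := L.comm
      have e₂ : P.map₂ L'.top.inv ≫ (P.mapComp L'.hat f).hom ≫ L'.base.hom ▷ P.map f =
          α'.inv := by
        rw [← cancel_mono α'.hom, Category.assoc, Category.assoc, L'.comm]
        simp [← P.map₂_comp]
      rw [← cancel_mono ((P.mapComp L'.hat f).hom ≫ L'.base.hom ▷ P.map f), P.map₂_comp,
        P.map₂_comp, Category.assoc, Category.assoc, e₂,
        ← cancel_epi (P.mapComp L.hat f).inv, ← reassoc_of% e₁, ← reassoc_of% w]
      simp)
    refine ⟨θ, ⟨by simp [h₄], by simp [h₃]⟩, ?_⟩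
    rintro θ' ⟨h₆, h₇⟩
    exact h₅ θ' ⟨by rw [reassoc_of% h₇, Iso.hom_inv_id, Category.comp_id],
      by rw [← reassoc_of% h₆, Iso.hom_inv_id, Category.comp_id]⟩

/-- Both clauses are obtained by lifting along `g` and then along `f`. The intermediate base 1-cell
is `h ≫ P.map f`, and the intermediate base 2-cell is `δ ▷ P.map f` conjugated by the constraint. -/
lemma IsCartesian₁.comp {x y z : E} {f : x ⟶ y} {g : y ⟶ z} (hf : IsCartesian₁ P f)
    (hg : IsCartesian₁ P g) : IsCartesian₁ P (f ≫ g) := by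
  apply IsCartesian₁.of_existsUnique
  · intro w k h α
    obtain ⟨L⟩ := hg.exists_lift k (h ≫ P.map f)
      (α_ _ _ _ ≪≫ whiskerLeftIso h (P.mapComp f g).symm ≪≫ α)
    obtain ⟨M⟩ := hf.exists_lift L.hat h L.base.symm
    refine ⟨⟨M.hat, (α_ _ _ _).symm ≪≫ whiskerRightIso M.top g ≪≫ L.top, M.base, ?_⟩⟩
    have e₁ := L.comm
    have e₂ : M.base.hom ▷ P.map f = (P.mapComp M.hat f).inv ≫ P.map₂ M.top.hom ≫ L.base.hom := by
      rw [← Category.assoc, ← M.comm]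
      simp
    simp only [Iso.trans_hom, whiskerLeftIso_hom, Iso.symm_hom] at e₁
    have e₃ : α.hom = h ◁ (P.mapComp f g).hom ≫ (α_ _ _ _).inv ≫ L.base.inv ▷ P.map g ≫
        (P.mapComp L.hat g).inv ≫ P.map₂ L.top.hom := by
      rw [← e₁]
      simp
    have e₄ : M.base.hom ▷ P.map (f ≫ g) ≫ h ◁ (P.mapComp f g).hom ≫ (α_ _ _ _).inv =
        P.map M.hat ◁ (P.mapComp f g).hom ≫ (α_ _ _ _).inv ≫
          ((P.mapComp M.hat f).inv ≫ P.map₂ M.top.hom ≫ L.base.hom) ▷ P.map g := by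
      rw [← e₂, ← associator_inv_naturality_left, whisker_exchange_assoc]
    rw [e₃, reassoc_of% e₄]
    simp [map₂_associator_inv]
  · intro w s t η δ h
    obtain ⟨θ, ⟨h₁, h₂⟩, h₃⟩ := hg.existsUnique ((α_ s f g).hom ≫ η ≫ (α_ t f g).inv)
      ((P.mapComp s f).hom ≫ δ ▷ P.map f ≫ (P.mapComp t f).inv) (by
        simp [h, P.map₂_associator, map₂_associator_inv, ← whisker_exchange_assoc])
    obtain ⟨θ', ⟨h₄, h₅⟩, h₆⟩ := hf.existsUnique θ δ h₁
    refine ⟨θ', ⟨h₄, by simp [h₅, h₂]⟩, ?_⟩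
    rintro θ'' ⟨rfl, rfl⟩
    refine h₆ θ'' ⟨rfl, h₃ _ ⟨by simp [P.map₂_whisker_right], by simp⟩⟩

lemma isCartesian₁_id (x : E) : IsCartesian₁ P (𝟙 x) := by
  apply IsCartesian₁.of_existsUnique
  · intro w k h α
    refine ⟨⟨k, ρ_ k, α.symm ≪≫ whiskerLeftIso h (P.mapId x) ≪≫ ρ_ h, ?_⟩⟩
    rw [P.map₂_right_unitor]
    -- Since `P.map (𝟙 x)` is isomorphic to an identity, whiskering with it is conjugate to doing
    -- nothing.
    have e {m m' : P.obj w ⟶ P.obj x} (θ : m ⟶ m') : θ ▷ P.map (𝟙 x) =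
        m ◁ (P.mapId x).hom ≫ (ρ_ m).hom ≫ θ ≫ (ρ_ m').inv ≫ m' ◁ (P.mapId x).inv := by
      rw [← rightUnitor_naturality_assoc, Iso.hom_inv_id_assoc, whisker_exchange_assoc,
        whiskerLeft_hom_inv, Category.comp_id]
    rw [e]
    simp
  · intro w s t η δ h
    refine ⟨(ρ_ s).inv ≫ η ≫ (ρ_ t).hom, ⟨?_, ?_⟩, ?_⟩
    · simp [h, P.map₂_right_unitor, map₂_rightUnitor_inv, ← whisker_exchange_assoc]
    · simp
    · rintro θ ⟨rfl, rfl⟩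
      simp

end Cartesian

end FibredBicat

namespace FibredBicat

/-! ### Triangles over 2-cells of the base. -/

section Over

variable {E : Type u₁} [Bicategory.{w₁, v₁} E] {B : Type u₂} [Bicategory.{w₂, v₂} B]
  {P : E ⥤ᵖ B} {κ : Cleavage P} {a b c : B}

/-- An identification of the image of the 1-cell `C` with `k`. -/
def Ov {y : Fibre κ a} {e : Fibre κ b} (C : (incl κ a).obj y ⟶ (incl κ b).obj e) (k : a ⟶ b) :
    Type w₂ :=
  (proj P y.pt e.pt).obj C ≅ k

namespace Ov

/-- A 1-cell with an identification of its image, as a `Cell`. -/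
def cell {y : Fibre κ a} {e : Fibre κ b} {C : (incl κ a).obj y ⟶ (incl κ b).obj e} {k : a ⟶ b}
    (i : Ov C k) : Cell y.pt e.pt k :=
  ⟨C, i⟩

/-- The identification of the image of a composite. -/
def comp {y : Fibre κ a} {e : Fibre κ b} {d : Fibre κ c}
    {C : (incl κ a).obj y ⟶ (incl κ b).obj e} {Z : (incl κ b).obj e ⟶ (incl κ c).obj d}
    {k : a ⟶ b} {l : b ⟶ c} (i : Ov C k) (j : Ov Z l) : Ov (C ≫ Z) (k ≫ l) :=
  (i.cell.comp j.cell).iso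

/-- The identification of the image of an identity. -/
def id (y : Fibre κ a) : Ov (𝟙 ((incl κ a).obj y)) (𝟙 a) :=
  projId P y.pt

/-- The identification of the image of a 1-cell of a fibre. -/
def hom {x y : Fibre κ a} (u : x ⟶ y) : Ov ((incl κ a).map u) (𝟙 a) :=
  (FibreHom.cell u).iso

end Ov

/-- The triangle `τ` lies over `σ`, modulo the given identifications. -/
def TriLies {z y : Fibre κ a} {e : Fibre κ b} {t : z ⟶ y}
    {C : (incl κ a).obj y ⟶ (incl κ b).obj e} {D : (incl κ a).obj z ⟶ (incl κ b).obj e}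
    {k k' : a ⟶ b} (i : Ov C k) (j : Ov D k') (τ : (incl κ a).map t ≫ C ⟶ D) (σ : k ⟶ k') :
    Prop :=
  Cell.Lies ((FibreHom.cell t).comp i.cell) j.cell τ ((λ_ k).hom ≫ σ)

namespace TriLies

/-- The 1-cells `u` and `t` lie over identities, so the base of the pasting is, up to unitors, just
a vertical composite. -/
lemma star {z y x : Fibre κ a} {e : Fibre κ b} {u : z ⟶ y} {t : y ⟶ x}
    {C' : (incl κ a).obj x ⟶ (incl κ b).obj e} {C : (incl κ a).obj y ⟶ (incl κ b).obj e}
    {D : (incl κ a).obj z ⟶ (incl κ b).obj e} {k k' k'' : a ⟶ b} {i : Ov C' k} {j : Ov C k'}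
    {l : Ov D k''} {υ : (incl κ a).map u ≫ C ⟶ D} {τ : (incl κ a).map t ≫ C' ⟶ C}
    {σ : k ⟶ k'} {σ' : k' ⟶ k''} (hυ : TriLies j l υ σ') (hτ : TriLies i j τ σ) :
    TriLies i l (star (incl κ a) υ τ) (σ ≫ σ') :=
  (((FibreHom.lies_compIso u t).whiskerRight i.cell).trans
    ((Cell.Lies.associator (FibreHom.cell u) (FibreHom.cell t) i.cell).trans
      ((Cell.Lies.whiskerLeft (FibreHom.cell u) hτ).trans hυ))).congr rfl (by simp)

lemma unitTri {y : Fibre κ a} {e : Fibre κ b} {C : (incl κ a).obj y ⟶ (incl κ b).obj e}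
    {k : a ⟶ b} (i : Ov C k) : TriLies i i (unitTri (incl κ a) C) (𝟙 k) :=
  (((FibreHom.lies_idIso y).whiskerRight i.cell).trans (Cell.Lies.leftUnitor i.cell)).congr
    rfl (by simp)

lemma whisk {z y : Fibre κ a} {e : Fibre κ b} {d : Fibre κ c} {t : z ⟶ y}
    {C : (incl κ a).obj y ⟶ (incl κ b).obj e} {D : (incl κ a).obj z ⟶ (incl κ b).obj e}
    {k k' : a ⟶ b} {i : Ov C k} {j : Ov D k'} {τ : (incl κ a).map t ≫ C ⟶ D} {σ : k ⟶ k'}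
    (h : TriLies i j τ σ) {Z : (incl κ b).obj e ⟶ (incl κ c).obj d} {m : b ⟶ c} (l : Ov Z m) :
    TriLies (i.comp l) (j.comp l) (whisk (incl κ a) τ Z) (σ ▷ m) :=
  ((Cell.Lies.symm (σ := (α_ _ _ _))
    (Cell.Lies.associator (FibreHom.cell t) i.cell l.cell)).trans
      (Cell.Lies.whiskerRight h l.cell)).congr rfl (by simp)

lemma comp_right {z y : Fibre κ a} {e : Fibre κ b} {t : z ⟶ y}
    {C : (incl κ a).obj y ⟶ (incl κ b).obj e} {D D' : (incl κ a).obj z ⟶ (incl κ b).obj e}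
    {k k' k'' : a ⟶ b} {i : Ov C k} {j : Ov D k'} {j' : Ov D' k''}
    {τ : (incl κ a).map t ≫ C ⟶ D} {σ : k ⟶ k'} (h : TriLies i j τ σ) {δ : D ⟶ D'} {σ' : k' ⟶ k''}
    (h' : Cell.Lies j.cell j'.cell δ σ') : TriLies i j' (τ ≫ δ) (σ ≫ σ') :=
  (Cell.Lies.trans h h').congr rfl (by simp)

lemma congr {z y : Fibre κ a} {e : Fibre κ b} {t : z ⟶ y}
    {C : (incl κ a).obj y ⟶ (incl κ b).obj e} {D : (incl κ a).obj z ⟶ (incl κ b).obj e}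
    {k k' : a ⟶ b} {i : Ov C k} {j : Ov D k'} {τ : (incl κ a).map t ≫ C ⟶ D} {σ σ' : k ⟶ k'}
    (h : TriLies i j τ σ) (w : σ = σ') : TriLies i j τ σ' := by
  subst w; exact h

end TriLies

/-! ### The correspondence between 2-cells of a fibre and triangles. -/

section Lifting

/-- Transport of the universal property of a cartesian 1-cell to cells. -/
lemma Cell.existsUnique_hom₂ {z : FibreObj P c} {y : FibreObj P a} {e : FibreObj P b} {k : a ⟶ b}
    (C : Cell y e k) (hC : IsCartesian₁ P C.hom) {j j' : c ⟶ a} (s : Cell z y j) (t : Cell z y j')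
    (η : s.hom ≫ C.hom ⟶ t.hom ≫ C.hom) (δ : j ⟶ j')
    (h : Lies (s.comp C) (t.comp C) η (δ ▷ k)) :
    ∃! θ : s.hom ⟶ t.hom, Lies s t θ δ ∧ θ ▷ C.hom = η := by
  -- Once the base objects are literally images under `P`, `proj` and `projComp` reduce to `P` and
  -- its constraint.
  obtain ⟨z, rfl⟩ := z
  obtain ⟨y, rfl⟩ := y
  obtain ⟨e, rfl⟩ := e
  obtain ⟨s, i⟩ := s
  obtain ⟨t, i'⟩ := t
  obtain ⟨C, l⟩ := C
  change P.map s ≅ j at i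
  change P.map t ≅ j' at i'
  change P.map C ≅ k at l
  change P.map₂ η ≫ (P.mapComp t C).hom ≫ i'.hom ▷ P.map C ≫ j' ◁ l.hom =
    ((P.mapComp s C).hom ≫ i.hom ▷ P.map C ≫ j ◁ l.hom) ≫ δ ▷ k at h
  obtain ⟨θ, ⟨h₁, h₂⟩, h₃⟩ := IsCartesian₁.existsUnique hC η (i.hom ≫ δ ≫ i'.inv) (by
    rw [← cancel_mono ((P.mapComp t C).hom ≫ i'.hom ▷ P.map C ≫ j' ◁ l.hom), h]
    simp [whisker_exchange])
  refine ⟨θ, ⟨?_, h₂⟩, ?_⟩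
  · change P.map₂ θ ≫ i'.hom = i.hom ≫ δ
    simp [h₁]
  · rintro θ' ⟨h₄, h₅⟩
    change P.map₂ θ' ≫ i'.hom = i.hom ≫ δ at h₄
    exact h₃ θ' ⟨by rw [← reassoc_of% h₄]; simp, h₅⟩

/-- Transport of the universal property of a cartesian 2-cell to cells. -/
lemma Cell.existsUnique_comp {x : FibreObj P a} {y : FibreObj P b} {f g h : a ⟶ b} (u : Cell x y f)
    (v : Cell x y g) (w : Cell x y h) {α : u.hom ⟶ v.hom} (hα : IsCartesian₂ P α) {σ : f ⟶ g}
    (hσ : Lies u v α σ) (β : w.hom ⟶ v.hom) (γ : h ⟶ f) (hβ : Lies w v β (γ ≫ σ)) :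
    ∃! δ : w.hom ⟶ u.hom, Lies w u δ γ ∧ δ ≫ α = β := by
  obtain ⟨x, rfl⟩ := x
  obtain ⟨y, rfl⟩ := y
  obtain ⟨u, i⟩ := u
  obtain ⟨v, i'⟩ := v
  obtain ⟨w, i''⟩ := w
  change P.map u ≅ f at i
  change P.map v ≅ g at i'
  change P.map w ≅ h at i''
  change P.map₂ α ≫ i'.hom = i.hom ≫ σ at hσ
  change P.map₂ β ≫ i'.hom = i''.hom ≫ γ ≫ σ at hβ
  obtain ⟨δ, ⟨h₁, h₂⟩, h₃⟩ := hα.existsUnique β (i''.hom ≫ γ ≫ i.inv) (by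
    rw [← cancel_mono i'.hom, hβ]
    simp [hσ])
  refine ⟨δ, ⟨?_, h₂⟩, ?_⟩
  · change P.map₂ δ ≫ i.hom = i''.hom ≫ γ
    simp [h₁]
  · rintro δ' ⟨h₄, h₅⟩
    change P.map₂ δ' ≫ i.hom = i''.hom ≫ γ at h₄
    exact h₃ δ' ⟨by rw [← reassoc_of% h₄]; simp, h₅⟩

lemma Cell.exists_lift {z : FibreObj P c} {y : FibreObj P a} {e : FibreObj P b} {k : a ⟶ b}
    (C : Cell y e k) (hC : IsCartesian₁ P C.hom) {j : c ⟶ a} {m : c ⟶ b} (D : Cell z e m)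
    (μ : j ≫ k ≅ m) :
    ∃ (s : Cell z y j) (η : s.hom ≫ C.hom ≅ D.hom), Lies (s.comp C) D η.hom μ.hom := by
  obtain ⟨z, rfl⟩ := z
  obtain ⟨y, rfl⟩ := y
  obtain ⟨e, rfl⟩ := e
  obtain ⟨C, l⟩ := C
  obtain ⟨D, l'⟩ := D
  change P.map C ≅ k at l
  change P.map D ≅ m at l'
  obtain ⟨L⟩ := IsCartesian₁.exists_lift hC D j (whiskerLeftIso j l ≪≫ μ ≪≫ l'.symm)
  refine ⟨⟨L.hat, L.base⟩, L.top, ?_⟩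
  change P.map₂ L.top.hom ≫ l'.hom =
    ((P.mapComp L.hat C).hom ≫ L.base.hom ▷ P.map C ≫ j ◁ l.hom) ≫ μ.hom
  have h := L.comm
  rw [← cancel_epi (P.mapComp L.hat C).inv, ← reassoc_of% h]
  simp

/-- Cartesian 1-cells provide lifts whose image is only isomorphic to the prescribed 1-cell, while
1-cells of a fibre lie strictly over an identity. The chosen cartesian lift of the isomorphism
corrects this; it is cartesian over an invertible 2-cell and hence invertible. -/
lemma Cell.exists_strict (κ : Cleavage P) {x : FibreObj P a} {y : FibreObj P b} {f : a ⟶ b}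
    (s : Cell x y f) :
    ∃ (u : x.obj ⟶ y.obj) (w : (proj P x y).obj u = f) (η : u ≅ s.hom),
      Lies ⟨u, eqToIso w⟩ s η.hom (𝟙 f) := by
  have h := κ.cart₂_over x y s.hom s.iso.inv
  have : IsIso (κ.cart₂ x y s.hom s.iso.inv) := by
    refine (κ.cart₂_cartesian _ _ _ _).isIso ?_
    rw [h]
    infer_instance
  refine ⟨κ.pull₂ x y s.hom s.iso.inv, κ.pull₂_over x y s.hom s.iso.inv,
    asIso (κ.cart₂ x y s.hom s.iso.inv), ?_⟩
  simp [Lies, h]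

variable {x y z : Fibre κ a} {e : Fibre κ b} {C : (incl κ a).obj y ⟶ (incl κ b).obj e}
  {D : (incl κ a).obj z ⟶ (incl κ b).obj e} {k k' : a ⟶ b}

/-- Every 1-cell over `k'` factors through a given cartesian 1-cell over `k ≅ k'`. -/
lemma Ov.exists_lift (i : Ov C k) (hC : IsCartesian₁ P C) (j : Ov D k') (μ : k ≅ k') :
    ∃ (s : z ⟶ y) (η : (incl κ a).map s ≫ C ≅ D), TriLies i j η.hom μ.hom := by
  -- The prescribed base 1-cell of the lift is `𝟙 a`, which makes the strictified lift a 1-cell of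
  -- the fibre.
  obtain ⟨s, η, h⟩ := Cell.exists_lift i.cell hC j.cell (λ_ k ≪≫ μ)
  obtain ⟨u, w, θ, h'⟩ := Cell.exists_strict κ s
  let u' : FibreHom z y := ⟨u, w⟩
  exact ⟨u', whiskerRightIso θ C ≪≫ η,
    (Cell.Lies.trans (Cell.Lies.whiskerRight (u := FibreHom.cell u') h' i.cell) h).congr rfl
      (by simp)⟩

/-- 2-cells of the fibre are determined by their action on a cartesian triangle. -/
lemma hom₂_ext_of_cartesian (hC : IsCartesian₁ P C) {s t : z ⟶ y}
    {p : (incl κ a).map t ≫ C ⟶ D} (hp : IsCartesian₂ P p) {θ θ' : s ⟶ t}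
    (h : act (incl κ a) θ p = act (incl κ a) θ' p) : θ = θ' := by
  apply FibreHom.hom₂_ext
  -- Uniqueness does not depend on which 1-cells `C` and `D` are said to lie over, so the
  -- tautological identifications suffice.
  let i : Ov C ((proj P y.pt e.pt).obj C) := Iso.refl _
  let j : Ov D ((proj P z.pt e.pt).obj D) := Iso.refl _
  have hσ : Cell.Lies ((FibreHom.cell t).comp i.cell) j.cell p
      (((FibreHom.cell t).comp i.cell).iso.inv ≫ (proj P z.pt e.pt).map p) := by
    simp only [Cell.Lies, Iso.hom_inv_id_assoc]
    exact Category.comp_id _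
  have h₁ (θ : s ⟶ t) := Cell.Lies.whiskerRight (FibreHom₂.isOver θ) i.cell
  have h₂ := Cell.existsUnique_comp ((FibreHom.cell t).comp i.cell) j.cell
    ((FibreHom.cell s).comp i.cell) hp hσ (act (incl κ a) θ p) _
    (Cell.Lies.trans (h₁ θ) hσ)
  -- Cartesianness of `p` gives `θ ▷ C = θ' ▷ C` in `E`; cartesianness of `C` then removes the
  -- whiskering.
  have h₂ := h₂.unique ⟨h₁ θ, rfl⟩ ⟨h₁ θ', h.symm⟩
  exact (Cell.existsUnique_hom₂ i.cell hC _ _ _ (𝟙 _) (h₁ θ)).unique ⟨FibreHom₂.isOver θ, rfl⟩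
    ⟨FibreHom₂.isOver θ', h₂.symm⟩

/-- Since `p` and `q` lie over the same `σ`, `q` factors through the cartesian `p` by a 2-cell `s ≫
C ⟶ t ≫ C` over an identity, and the cartesian `C` lifts that 2-cell to the fibre. Nothing is
required of `q` beyond its base. -/
lemma exists_act_eq {i : Ov C k} (hC : IsCartesian₁ P C) {s t : z ⟶ y}
    {p : (incl κ a).map t ≫ C ⟶ D} (hp : IsCartesian₂ P p) {j : Ov D k'} {σ : k ⟶ k'}
    (hσ : TriLies i j p σ) {q : (incl κ a).map s ≫ C ⟶ D} (hq : TriLies i j q σ) :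
    ∃ θ : s ⟶ t, act (incl κ a) θ p = q := by
  obtain ⟨η, ⟨h₁, h₂⟩, -⟩ := Cell.existsUnique_comp ((FibreHom.cell t).comp i.cell) j.cell
    ((FibreHom.cell s).comp i.cell) hp hσ q (𝟙 _ ▷ k) (Cell.Lies.congr hq rfl (by simp))
  obtain ⟨θ, ⟨h₃, h₄⟩, -⟩ := Cell.existsUnique_hom₂ i.cell hC _ _ _ (𝟙 _) h₁
  exact ⟨⟨θ, h₃⟩, (congrArg (· ≫ p) h₄).trans h₂⟩

/-- Two cartesian triangles over the same 2-cell are related by an invertible 2-cell. -/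
lemma exists_iso_act_eq {i : Ov C k} (hC : IsCartesian₁ P C) {s t : z ⟶ y}
    {p : (incl κ a).map t ≫ C ⟶ D} (hp : IsCartesian₂ P p) {j : Ov D k'} {σ : k ⟶ k'}
    (hσ : TriLies i j p σ) {q : (incl κ a).map s ≫ C ⟶ D} (hq : IsCartesian₂ P q)
    (hσ' : TriLies i j q σ) : ∃ θ : s ≅ t, act (incl κ a) θ.hom p = q := by
  obtain ⟨θ, h⟩ := exists_act_eq hC hp hσ hσ'
  obtain ⟨θ', h'⟩ := exists_act_eq hC hq hσ' hσ
  exact ⟨⟨θ, θ', hom₂_ext_of_cartesian hC hq (by rw [act_comp, h', h, act_id]),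
    hom₂_ext_of_cartesian hC hp (by rw [act_comp, h, h', act_id])⟩, h⟩

/-- The invertible 2-cell of the fibre relating two cartesian triangles over the same 2-cell. -/
noncomputable def liftIso {i : Ov C k} (hC : IsCartesian₁ P C) {s t : z ⟶ y}
    {p : (incl κ a).map t ≫ C ⟶ D} (hp : IsCartesian₂ P p) {j : Ov D k'} {σ : k ⟶ k'}
    (hσ : TriLies i j p σ) {q : (incl κ a).map s ≫ C ⟶ D} (hq : IsCartesian₂ P q)
    (hσ' : TriLies i j q σ) : s ≅ t :=
  (exists_iso_act_eq hC hp hσ hq hσ').choose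

lemma act_liftIso {i : Ov C k} (hC : IsCartesian₁ P C) {s t : z ⟶ y}
    {p : (incl κ a).map t ≫ C ⟶ D} (hp : IsCartesian₂ P p) {j : Ov D k'} {σ : k ⟶ k'}
    (hσ : TriLies i j p σ) {q : (incl κ a).map s ≫ C ⟶ D} (hq : IsCartesian₂ P q)
    (hσ' : TriLies i j q σ) :
    act (incl κ a) (liftIso hC hp hσ hq hσ').hom p = q :=
  (exists_iso_act_eq hC hp hσ hq hσ').choose_spec

end Lifting

section CartesianTriangles

variable {X : Type u₃} [Bicategory.{w₃, v₃} X] {J : X ⥤ᵖ E} {x y z : X} {e e' : E}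

lemma IsCartesian₂.of_isIso {x y : E} {f g : x ⟶ y} (α : f ⟶ g) [IsIso α] : IsCartesian₂ P α :=
  IsCartesian₂.of_iso (asIso α)

/-- The closure of cartesian 2-cells under horizontal composition enters through the whiskering of
`τ`; the coherence factors are invertible. -/
lemma IsFibration.star_cartesian (hP : IsFibration P) {u : x ⟶ y} {t : y ⟶ z} {C' : J.obj z ⟶ e}
    {C : J.obj y ⟶ e} {D : J.obj x ⟶ e} {υ : J.map u ≫ C ⟶ D} {τ : J.map t ≫ C' ⟶ C}
    (hυ : IsCartesian₂ P υ) (hτ : IsCartesian₂ P τ) : IsCartesian₂ P (star J υ τ) :=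
  (IsCartesian₂.of_isIso _).comp ((IsCartesian₂.of_isIso _).comp
    ((hP.whiskerLeft_cartesian _ hτ).comp hυ))

lemma isCartesian₂_unitTri (C : J.obj x ⟶ e) : IsCartesian₂ P (unitTri J C) :=
  (IsCartesian₂.of_isIso _).comp (IsCartesian₂.of_isIso _)

lemma IsFibration.whisk_cartesian (hP : IsFibration P) {t : x ⟶ y} {C : J.obj y ⟶ e}
    {D : J.obj x ⟶ e} {τ : J.map t ≫ C ⟶ D} (hτ : IsCartesian₂ P τ) (Z : e ⟶ e') :
    IsCartesian₂ P (whisk J τ Z) :=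
  (IsCartesian₂.of_isIso _).comp (hP.whiskerRight_cartesian hτ Z)

lemma IsFibration.pushTri_cartesian (hP : IsFibration P) {Y : Type u₄} [Bicategory.{w₄, v₄} Y]
    {K : Y ⥤ᵖ E} {x' y' : Y} {C₁ : J.obj x ⟶ K.obj x'} {C₂ : J.obj y ⟶ K.obj y'} {t : x' ⟶ y'}
    {t' : x ⟶ y} {n : J.map t' ≫ C₂ ⟶ C₁ ≫ K.map t} (hn : IsCartesian₂ P n) {C : K.obj y' ⟶ e}
    {D : K.obj x' ⟶ e} {τ : K.map t ≫ C ⟶ D} (hτ : IsCartesian₂ P τ) :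
    IsCartesian₂ P (pushTri n τ) :=
  (hP.whisk_cartesian hn C).comp ((IsCartesian₂.of_isIso _).comp (hP.whiskerLeft_cartesian _ hτ))

end CartesianTriangles

end Over

end FibredBicat

namespace FibredBicat

/-! ### The reindexing homomorphism `f^*`. -/

section Pullback

variable {E : Type u₁} [Bicategory.{w₁, v₁} E] {B : Type u₂} [Bicategory.{w₂, v₂} B]
  {P : E ⥤ᵖ B} {κ : Cleavage P} {a b c : B}

lemma Ov.lies_map₂ {x y : Fibre κ a} {u v : x ⟶ y} (θ : u ⟶ v) :
    Cell.Lies (Ov.hom u).cell (Ov.hom v).cell ((incl κ a).map₂ θ) (𝟙 (𝟙 a)) :=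
  FibreHom₂.isOver θ

lemma Ov.lies_mapComp {x y z : Fibre κ a} (u : x ⟶ y) (v : y ⟶ z) :
    Cell.Lies (Ov.hom (u ≫ v)).cell ((Ov.hom u).comp (Ov.hom v)).cell
      ((incl κ a).mapComp u v).hom (λ_ (𝟙 a)).inv :=
  FibreHom.lies_compIso u v

lemma Ov.lies_mapId (x : Fibre κ a) :
    Cell.Lies (Ov.hom (𝟙 x)).cell (Ov.id x).cell ((incl κ a).mapId x).hom (𝟙 (𝟙 a)) :=
  FibreHom.lies_idIso x

namespace Ov

variable {d : B} {x : Fibre κ a} {y : Fibre κ b} {z : Fibre κ c} {w : Fibre κ d}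
  {C C' : (incl κ a).obj x ⟶ (incl κ b).obj y} {D D' : (incl κ b).obj y ⟶ (incl κ c).obj z}
  {Z : (incl κ c).obj z ⟶ (incl κ d).obj w} {k k' : a ⟶ b} {l l' : b ⟶ c} {m : c ⟶ d}

lemma lies_whiskerLeft (i : Ov C k) {j : Ov D l} {j' : Ov D' l'} {δ : D ⟶ D'} {σ : l ⟶ l'}
    (h : Cell.Lies j.cell j'.cell δ σ) :
    Cell.Lies (i.comp j).cell (i.comp j').cell (C ◁ δ) (k ◁ σ) :=
  Cell.Lies.whiskerLeft i.cell h

lemma lies_associator (i : Ov C k) (j : Ov D l) (n : Ov Z m) :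
    Cell.Lies ((i.comp j).comp n).cell (i.comp (j.comp n)).cell (α_ C D Z).hom (α_ k l m).hom :=
  Cell.Lies.associator i.cell j.cell n.cell

lemma lies_associator_inv (i : Ov C k) (j : Ov D l) (n : Ov Z m) :
    Cell.Lies (i.comp (j.comp n)).cell ((i.comp j).comp n).cell (α_ C D Z).inv (α_ k l m).inv :=
  Cell.Lies.symm (Cell.Lies.associator i.cell j.cell n.cell)

lemma lies_leftUnitor (i : Ov C k) :
    Cell.Lies ((Ov.id x).comp i).cell i.cell (λ_ C).hom (λ_ k).hom :=
  Cell.Lies.leftUnitor i.cell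

lemma lies_rightUnitor (i : Ov C k) :
    Cell.Lies (i.comp (Ov.id y)).cell i.cell (ρ_ C).hom (ρ_ k).hom :=
  Cell.Lies.rightUnitor i.cell

lemma lies_leftUnitor_inv (i : Ov C k) :
    Cell.Lies i.cell ((Ov.id x).comp i).cell (λ_ C).inv (λ_ k).inv :=
  Cell.Lies.symm (Cell.Lies.leftUnitor i.cell)

lemma lies_rightUnitor_inv (i : Ov C k) :
    Cell.Lies i.cell (i.comp (Ov.id y)).cell (ρ_ C).inv (ρ_ k).inv :=
  Cell.Lies.symm (Cell.Lies.rightUnitor i.cell)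

end Ov

variable (κ) (f : a ⟶ b)

/-- The object `f^* x`. -/
def pb (x : Fibre κ b) : Fibre κ a := κ.pull f x.pt

/-- The cartesian 1-cell `f^* x ⟶ x`. -/
def pbLeg (x : Fibre κ b) : (incl κ a).obj (pb κ f x) ⟶ (incl κ b).obj x := κ.cart f x.pt

lemma pbLeg_cartesian (x : Fibre κ b) : IsCartesian₁ P (pbLeg κ f x) := κ.cart_cartesian f x.pt

/-- The 1-cell `f^* x ⟶ x` lies over `f`. -/
def pbOv (x : Fibre κ b) : Ov (pbLeg κ f x) f := eqToIso (κ.cart_over f x.pt)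

variable {x y z : Fibre κ b}

/-- The composite `f^* x ⟶ x ⟶ y` lies over `f ≫ 𝟙 b`, hence over `f` up to the right unitor, and so
factors through the cartesian 1-cell `f^* y ⟶ y`. -/
lemma exists_pbMap (u : x ⟶ y) :
    ∃ (s : pb κ f x ⟶ pb κ f y)
      (η : (incl κ a).map s ≫ pbLeg κ f y ≅ pbLeg κ f x ≫ (incl κ b).map u),
      TriLies (pbOv κ f y) ((pbOv κ f x).comp (Ov.hom u)) η.hom (ρ_ f).inv :=
  Ov.exists_lift (pbOv κ f y) (pbLeg_cartesian κ f y) ((pbOv κ f x).comp (Ov.hom u)) (ρ_ f).symm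

/-- The 1-cell `f^* u`. -/
noncomputable def pbMap (u : x ⟶ y) : pb κ f x ⟶ pb κ f y :=
  (exists_pbMap κ f u).choose

/-- The square relating `f^* u` to `u`. -/
noncomputable def pbNat (u : x ⟶ y) :
    (incl κ a).map (pbMap κ f u) ≫ pbLeg κ f y ≅ pbLeg κ f x ≫ (incl κ b).map u :=
  (exists_pbMap κ f u).choose_spec.choose

lemma pbNat_lies (u : x ⟶ y) : TriLies (pbOv κ f y) ((pbOv κ f x).comp (Ov.hom u))
    (pbNat κ f u).hom (ρ_ f).inv :=
  (exists_pbMap κ f u).choose_spec.choose_spec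

lemma exists_pbMap₂ {u v : x ⟶ y} (θ : u ⟶ v) :
    ∃ θ' : pbMap κ f u ⟶ pbMap κ f v, act (incl κ a) θ' (pbNat κ f v).hom =
      (pbNat κ f u).hom ≫ pbLeg κ f x ◁ (incl κ b).map₂ θ :=
  exists_act_eq (pbLeg_cartesian κ f y) (.of_iso _) (pbNat_lies κ f v)
    (((pbNat_lies κ f u).comp_right (Ov.lies_whiskerLeft (pbOv κ f x) (Ov.lies_map₂ θ))).congr
      (by simp))

/-- The 2-cell `f^* θ`. -/
noncomputable def pbMap₂ {u v : x ⟶ y} (θ : u ⟶ v) : pbMap κ f u ⟶ pbMap κ f v :=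
  (exists_pbMap₂ κ f θ).choose

lemma act_pbMap₂ {u v : x ⟶ y} (θ : u ⟶ v) {e : E} {C : (incl κ b).obj y ⟶ e}
    {D : (incl κ b).obj x ⟶ e} (τ : (incl κ b).map v ≫ C ⟶ D) :
    act (incl κ a) (pbMap₂ κ f θ) (pushTri (pbNat κ f v).hom τ) =
      pushTri (pbNat κ f u).hom (act (incl κ b) θ τ) :=
  act_pushTri (exists_pbMap₂ κ f θ).choose_spec τ

lemma exists_pbMapId (x : Fibre κ b) :
    ∃ θ : pbMap κ f (𝟙 x) ≅ 𝟙 (pb κ f x),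
      act (incl κ a) θ.hom (unitTri (incl κ a) (pbLeg κ f x)) =
        (pbNat κ f (𝟙 x)).hom ≫ pbLeg κ f x ◁ ((incl κ b).mapId x).hom ≫ (ρ_ _).hom :=
  exists_iso_act_eq (pbLeg_cartesian κ f x) (isCartesian₂_unitTri _)
    (TriLies.unitTri (pbOv κ f x)) (.of_isIso _)
    (((pbNat_lies κ f (𝟙 x)).comp_right
      ((Ov.lies_whiskerLeft (pbOv κ f x) (Ov.lies_mapId x)).trans
        (Ov.lies_rightUnitor (pbOv κ f x)))).congr (by simp))

/-- The constraint of `f^*` on identities. -/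
noncomputable def pbMapId (x : Fibre κ b) : pbMap κ f (𝟙 x) ≅ 𝟙 (pb κ f x) :=
  (exists_pbMapId κ f x).choose

lemma act_pbMapId {e : E} (C : (incl κ b).obj x ⟶ e) :
    act (incl κ a) (pbMapId κ f x).hom (unitTri (incl κ a) (pbLeg κ f x ≫ C)) =
      pushTri (pbNat κ f (𝟙 x)).hom (unitTri (incl κ b) C) :=
  act_unitTri_pushTri (exists_pbMapId κ f x).choose_spec C

variable {κ} (hP : IsFibration P)
include hP

lemma exists_pbMapComp (u : x ⟶ y) (v : y ⟶ z) :
    ∃ θ : pbMap κ f (u ≫ v) ≅ pbMap κ f u ≫ pbMap κ f v,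
      act (incl κ a) θ.hom
        (star (incl κ a) (whisk (incl κ a) (pbNat κ f u).hom ((incl κ b).map v))
          (pbNat κ f v).hom) =
        (pbNat κ f (u ≫ v)).hom ≫ pbLeg κ f x ◁ ((incl κ b).mapComp u v).hom ≫ (α_ _ _ _).inv :=
  exists_iso_act_eq (pbLeg_cartesian κ f z)
    (hP.star_cartesian (hP.whisk_cartesian (.of_iso _) _) (.of_iso _))
    (TriLies.star ((pbNat_lies κ f u).whisk (Ov.hom v)) (pbNat_lies κ f v)) (.of_isIso _)
    (((pbNat_lies κ f (u ≫ v)).comp_right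
      ((Ov.lies_whiskerLeft (pbOv κ f x) (Ov.lies_mapComp u v)).trans
        (Ov.lies_associator_inv (pbOv κ f x) (Ov.hom u) (Ov.hom v)))).congr (by
          simp))

/-- The constraint of `f^*` on composites. -/
noncomputable def pbMapComp (u : x ⟶ y) (v : y ⟶ z) :
    pbMap κ f (u ≫ v) ≅ pbMap κ f u ≫ pbMap κ f v :=
  (exists_pbMapComp f hP u v).choose

lemma act_pbMapComp (u : x ⟶ y) (v : y ⟶ z) {e : E} {C : (incl κ b).obj z ⟶ e}
    {C' : (incl κ b).obj y ⟶ e} {D : (incl κ b).obj x ⟶ e} (υ : (incl κ b).map u ≫ C' ⟶ D)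
    (τ : (incl κ b).map v ≫ C ⟶ C') :
    act (incl κ a) (pbMapComp f hP u v).hom
      (star (incl κ a) (pushTri (pbNat κ f u).hom υ) (pushTri (pbNat κ f v).hom τ)) =
      pushTri (pbNat κ f (u ≫ v)).hom (star (incl κ b) υ τ) :=
  act_star_pushTri (exists_pbMapComp f hP u v).choose_spec υ τ

lemma act_pbMapComp_inv (u : x ⟶ y) (v : y ⟶ z) {e : E} {C : (incl κ b).obj z ⟶ e}
    {C' : (incl κ b).obj y ⟶ e} {D : (incl κ b).obj x ⟶ e} (υ : (incl κ b).map u ≫ C' ⟶ D)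
    (τ : (incl κ b).map v ≫ C ⟶ C') :
    act (incl κ a) (pbMapComp f hP u v).inv
      (pushTri (pbNat κ f (u ≫ v)).hom (star (incl κ b) υ τ)) =
      star (incl κ a) (pushTri (pbNat κ f u).hom υ) (pushTri (pbNat κ f v).hom τ) :=
  act_inv_eq _ (act_pbMapComp f hP u v υ τ)

omit hP in
lemma pbHom₂_ext {w : Fibre κ a} {s t : w ⟶ pb κ f y} {e : Fibre κ c}
    {C : (incl κ b).obj y ⟶ (incl κ c).obj e} (hC : IsCartesian₁ P C)
    {D : (incl κ a).obj w ⟶ (incl κ c).obj e} {p : (incl κ a).map t ≫ pbLeg κ f y ≫ C ⟶ D}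
    (hp : IsCartesian₂ P p) {θ θ' : s ⟶ t} (h : act (incl κ a) θ p = act (incl κ a) θ' p) :
    θ = θ' :=
  hom₂_ext_of_cartesian ((pbLeg_cartesian κ f y).comp hC) hp h

/-- The test triangle is pushed along the square of `w`, with `τ` left free, so that `τ` can be
chosen in the shape to which the evaluation rules apply. The identity 1-cell at the end of `τ` gives
its edge the shape `leg ≫ C` used by those rules. -/
lemma pbMap_hom₂_ext {w : x ⟶ y} {s : pb κ f x ⟶ pb κ f y} {θ θ' : s ⟶ pbMap κ f w}
    {D : (incl κ b).obj x ⟶ (incl κ b).obj y} (τ : (incl κ b).map w ≫ 𝟙 _ ⟶ D)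
    (hτ : IsCartesian₂ P τ) (h : act (incl κ a) θ (pushTri (pbNat κ f w).hom τ) =
      act (incl κ a) θ' (pushTri (pbNat κ f w).hom τ)) : θ = θ' :=
  pbHom₂_ext f (isCartesian₁_id _) (hP.pushTri_cartesian (.of_iso _) hτ) h

/-- The reindexing homomorphism `f^*`. -/
noncomputable def pbFunctor : Fibre κ b ⥤ᵖ Fibre κ a where
  obj := pb κ f
  map u := pbMap κ f u
  map₂ θ := pbMap₂ κ f θ
  mapId x := pbMapId κ f x
  mapComp u v := pbMapComp f hP u v
  map₂_id u := pbMap_hom₂_ext f hP (ρ_ _).hom (.of_iso _) (by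
    simp only [act_pbMap₂, act_id])
  map₂_comp θ θ' := pbMap_hom₂_ext f hP (ρ_ _).hom (.of_iso _) (by
    simp only [act_pbMap₂, act_comp])
  -- The target is the image of a composite, so the test triangle is itself a pasting: only then do
  -- the rules for `pbMapComp` and for whiskering apply.
  map₂_whisker_left u v w θ := pbMap_hom₂_ext f hP (star _ (𝟙 _) (ρ_ _).hom)
    (hP.star_cartesian (.of_isIso _) (.of_isIso _)) (by
      simp only [act_pbMap₂, act_comp, act_whiskerLeft, act_pbMapComp, act_pbMapComp_inv])
  map₂_whisker_right θ w := pbMap_hom₂_ext f hP (star _ (𝟙 _) (ρ_ _).hom)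
    (hP.star_cartesian (.of_isIso _) (.of_isIso _)) (by
      simp only [act_pbMap₂, act_comp, act_whiskerRight, act_pbMapComp, act_pbMapComp_inv])
  map₂_associator u v w := pbMap_hom₂_ext f hP (star _ (𝟙 _) (star _ (𝟙 _) (ρ_ _).hom))
    (hP.star_cartesian (.of_isIso _) (hP.star_cartesian (.of_isIso _) (.of_isIso _))) (by
      simp only [act_pbMap₂, act_comp, act_whiskerRight, act_whiskerLeft, act_pbMapComp,
        act_pbMapComp_inv, act_associator_hom])
  map₂_left_unitor u := pbMap_hom₂_ext f hP (ρ_ _).hom (.of_iso _) (by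
      simp only [act_pbMap₂, act_comp, act_whiskerRight, act_pbMapComp, act_leftUnitor_hom,
        act_pbMapId])
  map₂_right_unitor u := pbMap_hom₂_ext f hP (ρ_ _).hom (.of_iso _) (by
      simp only [act_pbMap₂, act_comp, act_whiskerLeft, act_pbMapComp, act_rightUnitor_hom,
        act_pbMapId])

end Pullback

end FibredBicat

namespace FibredBicat

/-! ### Pasting of transformations, and transformations equipped with triangles. -/

section Tri

variable {X : Type u₁} [Bicategory.{w₁, v₁} X] {Y : Type u₂} [Bicategory.{w₂, v₂} Y]
  {E : Type u₃} [Bicategory.{w₃, v₃} E] {Z : Type u₄} [Bicategory.{w₄, v₄} Z]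
  {J : X ⥤ᵖ E} {K : Y ⥤ᵖ E} {L : Z ⥤ᵖ E}

/-- A transformation `G.comp J ⟶ K` from its components, with the axioms expressed by the action
on triangles. -/
def mkTrans (G : Y ⥤ᵖ X) (l : ∀ y, J.obj (G.obj y) ⟶ K.obj y)
    (n : ∀ {x y : Y} (u : x ⟶ y), J.map (G.map u) ≫ l y ≅ l x ≫ K.map u)
    (h₁ : ∀ {x y : Y} {u v : x ⟶ y} (θ : u ⟶ v),
      act J (G.map₂ θ) (n v).hom = (n u).hom ≫ l x ◁ K.map₂ θ)
    (h₂ : ∀ x : Y, act J (G.mapId x).hom (unitTri J (l x)) =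
      (n (𝟙 x)).hom ≫ l x ◁ (K.mapId x).hom ≫ (ρ_ _).hom)
    (h₃ : ∀ {x y z : Y} (u : x ⟶ y) (v : y ⟶ z), act J (G.mapComp u v).hom
      (star J (whisk J (n u).hom (K.map v)) (n v).hom) =
        (n (u ≫ v)).hom ≫ l x ◁ (K.mapComp u v).hom ≫ (α_ _ _ _).inv) :
    G.comp J ⟶ K where
  app := l
  naturality u := n u
  naturality_naturality θ := h₁ θ
  naturality_id x := by
    change (n (𝟙 x)).hom ≫ l x ◁ (K.mapId x).hom =
      (J.map₂ (G.mapId x).hom ≫ (J.mapId (G.obj x)).hom) ▷ l x ≫ (λ_ (l x)).hom ≫ (ρ_ (l x)).inv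
    have h := h₂ x
    rw [← cancel_mono (ρ_ (l x)).hom, Category.assoc, ← h]
    simp [act, unitTri]
  naturality_comp {x y z} u v := by
    change (n (u ≫ v)).hom ≫ l x ◁ (K.mapComp u v).hom =
      (J.map₂ (G.mapComp u v).hom ≫ (J.mapComp (G.map u) (G.map v)).hom) ▷ l z ≫
        (α_ _ _ _).hom ≫ J.map (G.map u) ◁ (n v).hom ≫ (α_ _ _ _).inv ≫
          (n u).hom ▷ K.map v ≫ (α_ _ _ _).hom
    have h := h₃ u v
    rw [← cancel_mono (α_ _ _ _).inv, Category.assoc, ← h]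
    simp [act, star, whisk]

section

variable {G : Y ⥤ᵖ X} {H : Z ⥤ᵖ Y} (p : G.comp J ⟶ K) (q : H.comp K ⟶ L)

lemma whisk_push {x y : Y} {t : x ⟶ y} {e e' : E} {C : K.obj y ⟶ e} {D : K.obj x ⟶ e}
    (τ : K.map t ≫ C ⟶ D) (W : e ⟶ e') :
    whisk J (push p τ) W = pre J (α_ _ _ _).hom (push p (whisk K τ W)) ≫ (α_ _ _ _).inv := by
  rw [← push_whisk]
  simp

/-- The naturality 2-cell of the pasting of `p : G.comp J ⟶ K` and `q : H.comp K ⟶ L`. -/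
def compNat {x y : Z} (u : x ⟶ y) :
    J.map (G.map (H.map u)) ≫ leg p (H.obj y) ≫ leg q y ≅
      (leg p (H.obj x) ≫ leg q x) ≫ L.map u :=
  (α_ _ _ _).symm ≪≫ whiskerRightIso (p.naturality (H.map u)) (leg q y) ≪≫
    α_ (leg p (H.obj x)) (K.map (H.map u)) (leg q y) ≪≫
    whiskerLeftIso (leg p (H.obj x)) (q.naturality u) ≪≫ (α_ _ _ _).symm

lemma compNat_hom {x y : Z} (u : x ⟶ y) :
    (compNat p q u).hom = push p (natTri q u) ≫ (α_ _ _ _).inv := by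
  change (α_ _ _ _).inv ≫ natTri p (H.map u) ▷ leg q y ≫ (α_ _ _ _).hom ≫
    leg p (H.obj x) ◁ natTri q u ≫ (α_ _ _ _).inv = _
  simp [push, pushTri, whisk]

lemma act_map₂_compNat {x y : Z} {u v : x ⟶ y} (θ : u ⟶ v) :
    act J (G.map₂ (H.map₂ θ)) (compNat p q v).hom =
      (compNat p q u).hom ≫ (leg p (H.obj x) ≫ leg q x) ◁ L.map₂ θ := by
  rw [compNat_hom, compNat_hom, act_comp_right, act_map₂_push, act_map₂_natTri, push_comp]
  simp

lemma act_mapId_compNat (x : Z) :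
    act J (G.map₂ (H.mapId x).hom ≫ (G.mapId (H.obj x)).hom)
      (unitTri J (leg p (H.obj x) ≫ leg q x)) =
      (compNat p q (𝟙 x)).hom ≫ (leg p (H.obj x) ≫ leg q x) ◁ (L.mapId x).hom ≫ (ρ_ _).hom := by
  rw [compNat_hom, act_comp, act_mapId_push, act_map₂_push, act_mapId_unitTri_leg, push_comp]
  simp

lemma act_mapComp_compNat {x y z : Z} (u : x ⟶ y) (v : y ⟶ z) :
    act J (G.map₂ (H.mapComp u v).hom ≫ (G.mapComp (H.map u) (H.map v)).hom)
      (star J (whisk J (compNat p q u).hom (L.map v)) (compNat p q v).hom) =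
      (compNat p q (u ≫ v)).hom ≫
        (leg p (H.obj x) ≫ leg q x) ◁ (L.mapComp u v).hom ≫ (α_ _ _ _).inv := by
  rw [compNat_hom, compNat_hom, compNat_hom, star_comp_right, whisk_comp, whisk_push,
    pre_comp_right, pre_comp_right, pre_pre, Iso.inv_hom_id, pre_id, Category.assoc,
    star_comp_left, act_comp_right, act_comp, act_mapComp_push, act_map₂_push,
    act_mapComp_star_natTri, push_comp]
  simp

/-- The pasting of `p : G.comp J ⟶ K` and `q : H.comp K ⟶ L`. -/
def compTrans : (H.comp G).comp J ⟶ L :=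
  mkTrans (H.comp G) (fun z => leg p (H.obj z) ≫ leg q z) (compNat p q) (act_map₂_compNat p q)
    (act_mapId_compNat p q) (act_mapComp_compNat p q)

lemma natTri_compTrans {x y : Z} (u : x ⟶ y) :
    natTri (compTrans p q) u = push p (natTri q u) ≫ (α_ _ _ _).inv :=
  compNat_hom p q u

/-- Transport along a pasting is iterated transport, up to the associator that rebrackets the two
legs. -/
lemma push_compTrans {x y : Z} {u : x ⟶ y} {e : E} {C : L.obj y ⟶ e} {D : L.obj x ⟶ e}
    (τ : L.map u ≫ C ⟶ D) :
    push (compTrans p q) τ =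
      pre J (α_ _ _ _).hom (push p (push q τ)) ≫ (α_ _ _ _).inv := by
  have h : pushTri (push p (natTri q u) ≫ (α_ _ _ _).inv) τ =
      pre J (α_ _ _ _).hom (push p (push q τ)) ≫ (α_ _ _ _).inv := by
    rw [Iso.eq_comp_inv]
    exact pushTri_pushTri_assoc (natTri q u) (natTri p (H.map u)) τ
  rw [← h]
  exact congrArg (fun n => pushTri n τ) (natTri_compTrans p q u)

end

/-- Naturality with respect to the bare squares implies naturality with respect to every triangle
`τ`: interchange moves `τ` behind `m`, where it no longer meets the 2-cell `n`. -/
lemma act_star_whisk_push {G H : Y ⥤ᵖ X} {p : G.comp J ⟶ K} {q : H.comp J ⟶ K} {x y : Y}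
    {u : x ⟶ y} {s : G.obj x ⟶ H.obj x} {s' : G.obj y ⟶ H.obj y} {n : G.map u ≫ s' ⟶ s ≫ H.map u}
    {m : J.map s ≫ leg q x ⟶ leg p x} {m' : J.map s' ≫ leg q y ⟶ leg p y}
    (h : act J n (star J (whisk J m (K.map u)) (natTri q u)) = star J (natTri p u) m') {e : E}
    {C : K.obj y ⟶ e} {D : K.obj x ⟶ e} (τ : K.map u ≫ C ⟶ D) :
    act J n (star J (whisk J m D) (push q τ)) = star J (push p τ) (whisk J m' C) := by
  have h' : star J (whisk J m D) (push q τ) =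
      whisk J (star J (whisk J m (K.map u)) (natTri q u)) C ≫ (α_ _ _ _).hom ≫ leg p x ◁ τ := by
    rw [push, pushTri, star_comp_right, ← pre_pre, ← whisk_exchange, pre_comp_right,
      ← whisk_whisk, star_comp_left, star_comp_left, star_whisk, Category.assoc]
  rw [h', act_comp_right, act_whisk, h, ← star_whisk, push, pushTri, star_comp_left]

/-- A transformation between homomorphisms over `K`, with triangles over the identity of `K`. -/
structure Tri {G H : Y ⥤ᵖ X} (p : G.comp J ⟶ K) (q : H.comp J ⟶ K) where
  trans : G ⟶ H
  tri (y : Y) : J.map (trans.app y) ≫ leg q y ⟶ leg p y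
  naturality {x y : Y} (u : x ⟶ y) : act J (trans.naturality u).hom
    (star J (whisk J (tri x) (K.map u)) (natTri q u)) = star J (natTri p u) (tri y)

namespace Tri

variable {G H I : Y ⥤ᵖ X} {p : G.comp J ⟶ K} {q : H.comp J ⟶ K} {r : I.comp J ⟶ K}

lemma naturality_push (S : Tri p q) {x y : Y} {u : x ⟶ y} {e : E} {C : K.obj y ⟶ e}
    {D : K.obj x ⟶ e} (τ : K.map u ≫ C ⟶ D) :
    act J (S.trans.naturality u).hom (star J (whisk J (S.tri x) D) (push q τ)) =
      star J (push p τ) (whisk J (S.tri y) C) :=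
  act_star_whisk_push (S.naturality u) τ

/-- The vertical composite of two triangles. -/
def comp (S : Tri p q) (T : Tri q r) : Tri p r where
  trans := S.trans ≫ T.trans
  tri y := star J (S.tri y) (T.tri y)
  naturality {x y} u := by
    have h : act J ((α_ (G.map u) (S.trans.app y) (T.trans.app y)).inv ≫
      (S.trans.naturality u).hom ▷ T.trans.app y ≫
        (α_ (S.trans.app x) (H.map u) (T.trans.app y)).hom ≫
        S.trans.app x ◁ (T.trans.naturality u).hom ≫
          (α_ (S.trans.app x) (T.trans.app x) (I.map u)).inv)
        (star J (whisk J (star J (S.tri x) (T.tri x)) (K.map u)) (natTri r u)) =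
        star J (natTri p u) (star J (S.tri y) (T.tri y)) := by
      simp only [← star_whisk, act_comp, act_associator_inv, act_associator_hom, act_whiskerLeft,
        act_whiskerRight, Tri.naturality]
    exact h

/-- The identity triangle. -/
def id (p : G.comp J ⟶ K) : Tri p p where
  trans := 𝟙 G
  tri y := unitTri J (leg p y)
  naturality {x y} u := by
    have h : act J ((ρ_ (G.map u)).hom ≫ (λ_ (G.map u)).inv)
        (star J (whisk J (unitTri J (leg p x)) (K.map u)) (natTri p u)) =
        star J (natTri p u) (unitTri J (leg p y)) := by
      simp only [unitTri_whisk, act_comp, act_leftUnitor_inv, act_rightUnitor_hom]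
    exact h

/-- The whiskering of a triangle on the source side. -/
def preW {F : Z ⥤ᵖ Y} (r : F.comp K ⟶ L) (S : Tri p q) :
    Tri (compTrans p r) (compTrans q r) where
  trans := preWhisker F S.trans
  tri z := whisk J (S.tri (F.obj z)) (leg r z)
  naturality {x y} u := by
    have h : act J (S.trans.naturality (F.map u)).hom
        (star J (whisk J (whisk J (S.tri (F.obj x)) (leg r x)) (L.map u))
          (push q (natTri r u) ≫ (α_ _ _ _).inv)) =
        star J (push p (natTri r u) ≫ (α_ _ _ _).inv) (whisk J (S.tri (F.obj y)) (leg r y)) := by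
      have e : whisk J (whisk J (S.tri (F.obj x)) (leg r x)) (L.map u) =
        pre J (α_ _ _ _).hom (whisk J (S.tri (F.obj x)) (leg r x ≫ L.map u)) ≫ (α_ _ _ _).inv := by
        rw [← whisk_whisk]
        simp
      rw [star_comp_right, e, pre_comp_right, pre_pre, Iso.inv_hom_id, pre_id, star_comp_left,
        act_comp_right, S.naturality_push, star_comp_left]
    simp only [natTri_compTrans]
    exact h

/-- The whiskering of a triangle on the target side. -/
def postW {F F' : Z ⥤ᵖ Y} {r : F.comp K ⟶ L} {r' : F'.comp K ⟶ L} (p : G.comp J ⟶ K)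
    (S : Tri r r') : Tri (compTrans p r) (compTrans p r') where
  trans := postWhisker S.trans G
  tri z := push p (S.tri z)
  naturality {x y} u := by
    have h : act J ((G.mapComp (F.map u) (S.trans.app y)).inv ≫
          G.map₂ (S.trans.naturality u).hom ≫ (G.mapComp (S.trans.app x) (F'.map u)).hom)
        (star J (whisk J (push p (S.tri x)) (L.map u))
          (push p (natTri r' u) ≫ (α_ _ _ _).inv)) =
        star J (push p (natTri r u) ≫ (α_ _ _ _).inv) (push p (S.tri y)) := by
      rw [star_comp_right, whisk_push, pre_comp_right, pre_pre, Iso.inv_hom_id, pre_id,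
        star_comp_left, act_comp_right, act_comp, act_comp, act_mapComp_push, act_map₂_push,
        S.naturality, act_mapComp_inv_push, star_comp_left]
    simp only [natTri_compTrans]
    exact h

end Tri

end Tri

end FibredBicat

namespace FibredBicat

/-! ### Triangles as modifications; associativity and unit triangles. -/

section Tri

variable {X : Type u₁} [Bicategory.{w₁, v₁} X] {Y : Type u₂} [Bicategory.{w₂, v₂} Y]
  {E : Type u₃} [Bicategory.{w₃, v₃} E] {J : X ⥤ᵖ E} {K : Y ⥤ᵖ E}

/-- The common core of the associativity and unit triangles below. Their transformations have
identity components, so naturality reduces to compatibility of the coherence isomorphisms `δ`, `δ'`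
between the legs with the squares. -/
lemma act_star_unitTri_of_comm {x y : X} {u : x ⟶ y} {e e' : E} {C C' : J.obj y ⟶ e}
    {D D' : J.obj x ⟶ e'} {Z : e' ⟶ e} (δ : D ⟶ D') (δ' : C ⟶ C') (n : J.map u ≫ C ⟶ D ≫ Z)
    (n' : J.map u ≫ C' ⟶ D' ≫ Z) (h : n ≫ δ ▷ Z = pre J δ' n') :
    act J ((ρ_ u).hom ≫ (λ_ u).inv) (star J (whisk J (unitTri J D ≫ δ) Z) n) =
      star J n' (unitTri J C ≫ δ') := by
  rw [whisk_comp, unitTri_whisk, star_comp_left, act_comp, act_comp_right, act_leftUnitor_inv, h,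
    act_rightUnitor_hom, star_comp_right]

namespace Tri

/-- The naturality condition of `Tri` is the modification axiom with the invertible constraint
`mapComp` moved to the other side. -/
lemma modification_iff {G H : Y ⥤ᵖ X} {p : G.comp J ⟶ K} {q : H.comp J ⟶ K} (s : G ⟶ H) {x y : Y}
    (u : x ⟶ y) (m : J.map (s.app x) ≫ leg q x ⟶ leg p x)
    (m' : J.map (s.app y) ≫ leg q y ⟶ leg p y) :
    J.map (G.map u) ◁ m' ≫ natTri p u =
        ((α_ _ _ _).inv ≫ ((J.mapComp (G.map u) (s.app y)).inv ≫ J.map₂ (s.naturality u).hom ≫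
          (J.mapComp (s.app x) (H.map u)).hom) ▷ leg q y ≫ (α_ _ _ _).hom ≫
            J.map (s.app x) ◁ natTri q u ≫ (α_ _ _ _).inv) ≫ m ▷ K.map u ↔
      act J (s.naturality u).hom (star J (whisk J m (K.map u)) (natTri q u)) =
        star J (natTri p u) m' := by
  rw [← cancel_epi ((J.mapComp (G.map u) (s.app y)).hom ▷ leg q y ≫ (α_ _ _ _).hom), eq_comm]
  simp [act, star, whisk]

variable {G H I : Y ⥤ᵖ X} {p : G.comp J ⟶ K} {q : H.comp J ⟶ K}

/-- The modification given by a triangle. -/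
def toHom (S : Tri p q) : postWhisker S.trans J ≫ q ⟶ p where
  as := { app := S.tri, naturality := fun u => (modification_iff S.trans u _ _).2 (S.naturality u) }

/-- The triangle given by a modification. -/
def ofHom (s : G ⟶ H) (Γ : postWhisker s J ≫ q ⟶ p) : Tri p q where
  trans := s
  tri x := Γ.as.app x
  naturality u := (modification_iff s u _ _).1 (Γ.as.naturality u)

section

variable {Z : Type u₄} [Bicategory.{w₄, v₄} Z] {W : Type u₅} [Bicategory.{w₅, v₅} W]
  {L : Z ⥤ᵖ E} {M : W ⥤ᵖ E} {F : Z ⥤ᵖ Y} {F' : W ⥤ᵖ Z}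

/-- The associativity triangle. -/
def assoc (p : G.comp J ⟶ K) (q : F.comp K ⟶ L) (r : F'.comp L ⟶ M) :
    Tri (compTrans p (compTrans q r)) (compTrans (compTrans p q) r) where
  trans := assocTrans F' F G
  tri w := unitTri J _ ≫ (α_ (leg p _) (leg q _) (leg r _)).hom
  naturality {x y} u := by
    have h := act_star_unitTri_of_comm
      (J := J) (Z := M.map u) (α_ (leg p _) (leg q _) (leg r x)).hom
      (α_ (leg p _) (leg q _) (leg r y)).hom
      ((pre J (α_ _ _ _).hom (push p (push q (natTri r u))) ≫ (α_ _ _ _).inv) ≫ (α_ _ _ _).inv)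
      (push p (push q (natTri r u) ≫ (α_ _ _ _).inv) ≫ (α_ _ _ _).inv) (by
        rw [push_comp, pre_comp_right, pre_comp_right]
        simp)
    simp only [natTri_compTrans, push_compTrans]
    exact h

/-- The triangle for the composite with an identity on the source side. -/
def leftUnit (p : G.comp J ⟶ K) : Tri (compTrans p (leftUnitTrans K)) p where
  trans := leftUnitTrans G
  tri w := unitTri J _ ≫ (ρ_ (leg p w)).inv
  naturality {x y} u := by
    have h := act_star_unitTri_of_comm (J := J) (Z := K.map u) (ρ_ (leg p x)).inv
      (ρ_ (leg p y)).inv (natTri p u)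
      (push p ((ρ_ (K.map u)).hom ≫ (λ_ (K.map u)).inv) ≫ (α_ _ _ _).inv) (by
        rw [push_comp, push, pushTri_rightUnitor, pre_comp_right, pre_comp_right, pre_pre,
          Iso.inv_hom_id, pre_id]
        simp)
    simp only [natTri_compTrans]
    exact h

/-- The triangle for the composite with an identity on the target side. -/
def rightUnit (p : G.comp J ⟶ K) : Tri p (compTrans (leftUnitTrans J) p) where
  trans := rightUnitTrans G
  tri w := unitTri J _ ≫ (λ_ (leg p w)).hom
  naturality {x y} u := by
    have h := act_star_unitTri_of_comm (J := J) (Z := K.map u) (λ_ (leg p x)).hom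
      (λ_ (leg p y)).hom
      (pushTri (C₁ := 𝟙 _) ((ρ_ (J.map (G.map u))).hom ≫ (λ_ _).inv) (natTri p u) ≫ (α_ _ _ _).inv)
      (natTri p u) (by
        simp [pushTri, whisk, pre])
    simp only [natTri_compTrans]
    exact h

end

end Tri

end Tri

/-! ### Comparison of pasting with composition of transformations. -/

section CompIso

variable {X : Type u₁} [Bicategory.{w₁, v₁} X] {Y : Type u₂} [Bicategory.{w₂, v₂} Y]
  {E : Type u₃} [Bicategory.{w₃, v₃} E] {Z : Type u₄} [Bicategory.{w₄, v₄} Z]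
  {J : X ⥤ᵖ E} {K : Y ⥤ᵖ E} {L : Z ⥤ᵖ E} {G : Y ⥤ᵖ X} {H : Z ⥤ᵖ Y}

/-- The pasting of transformations agrees with their composite as transformations. -/
def compTransIso (p : G.comp J ⟶ K) (q : H.comp K ⟶ L) :
    compTrans p q ≅ assocTrans H G J ≫ preWhisker H p ≫ q :=
  -- The two sides differ by the identity component of `assocTrans`, whence the unitor.
  Pseudofunctor.StrongTrans.isoMk (fun z => (λ_ (leg p (H.obj z) ≫ leg q z)).symm) (by
    intro x y u
    change J.map (G.map (H.map u)) ◁ (λ_ (leg p (H.obj y) ≫ leg q y)).inv ≫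
      ((α_ _ _ _).inv ≫ ((ρ_ (J.map (G.map (H.map u)))).hom ≫ (λ_ _).inv) ▷
          (leg p (H.obj y) ≫ leg q y) ≫ (α_ _ _ _).hom ≫
        𝟙 (J.obj (G.obj (H.obj x))) ◁ ((α_ _ _ _).inv ≫ natTri p (H.map u) ▷ leg q y ≫
          (α_ _ _ _).hom ≫ leg p (H.obj x) ◁ natTri q u ≫ (α_ _ _ _).inv) ≫ (α_ _ _ _).inv) =
      natTri (compTrans p q) u ≫ (λ_ (leg p (H.obj x) ≫ leg q x)).inv ▷ L.map u
    have h : J.map (G.map (H.map u)) ◁ (λ_ (leg p (H.obj y) ≫ leg q y)).inv ≫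
      ((α_ _ _ _).inv ≫ ((ρ_ (J.map (G.map (H.map u)))).hom ≫ (λ_ _).inv) ▷
          (leg p (H.obj y) ≫ leg q y) ≫ (α_ _ _ _).hom ≫
        𝟙 (J.obj (G.obj (H.obj x))) ◁ ((α_ _ _ _).inv ≫ natTri p (H.map u) ▷ leg q y ≫
          (α_ _ _ _).hom ≫ leg p (H.obj x) ◁ natTri q u ≫ (α_ _ _ _).inv) ≫ (α_ _ _ _).inv) =
      (push p (natTri q u) ≫ (α_ _ _ _).inv) ≫ (λ_ (leg p (H.obj x) ≫ leg q x)).inv ▷ L.map u := by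
      simp [push, pushTri, whisk]
    rw [natTri_compTrans]
    exact h)

end CompIso

end FibredBicat

namespace FibredBicat

/-! ### Cones of cartesian 1-cells and their morphisms. -/

section Cones

variable {E : Type u₁} [Bicategory.{w₁, v₁} E] {B : Type u₂} [Bicategory.{w₂, v₂} B]
  {P : E ⥤ᵖ B}

/-- In the base, the inverse right unitor of `f` coming from the square cancels, by the triangle
identity, the left unitor of `k` included in `TriLies`. -/
lemma TriLies.push {κ : Cleavage P} {a b c : B} {G : Fibre κ b ⥤ᵖ Fibre κ a}
    {p : G.comp (incl κ a) ⟶ incl κ b} {f : a ⟶ b} (i : ∀ x, Ov (leg p x) f)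
    (hp : ∀ {x y : Fibre κ b} (u : x ⟶ y),
      TriLies (i y) ((i x).comp (Ov.hom u)) (natTri p u) (ρ_ f).inv)
    {x y : Fibre κ b} {e : Fibre κ c} {t : x ⟶ y} {C : (incl κ b).obj y ⟶ (incl κ c).obj e}
    {D : (incl κ b).obj x ⟶ (incl κ c).obj e} {k k' : b ⟶ c} {j : Ov C k} {j' : Ov D k'}
    {τ : (incl κ b).map t ≫ C ⟶ D} {σ : k ⟶ k'} (h : TriLies j j' τ σ) :
    TriLies ((i y).comp j) ((i x).comp j') (push p τ) (f ◁ σ) := by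
  have h₁ : Cell.Lies (((i x).comp (Ov.hom t)).comp j).cell ((i x).comp j').cell
      ((α_ _ _ _).hom ≫ leg p x ◁ τ) ((α_ _ _ _).hom ≫ f ◁ ((λ_ k).hom ≫ σ)) :=
    (Ov.lies_associator (i x) (Ov.hom t) j).trans
      (Ov.lies_whiskerLeft (i x) (j := (Ov.hom t).comp j) h)
  exact (((hp t).whisk j).comp_right h₁).congr (by simp)

/-- A homomorphism between fibres with a pseudonatural family of cartesian 1-cells over `f`. -/
structure Cone (κ : Cleavage P) {a b : B} (f : a ⟶ b) where
  functor : Fibre κ b ⥤ᵖ Fibre κ a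
  trans : functor.comp (incl κ a) ⟶ incl κ b
  ov (x : Fibre κ b) : Ov (leg trans x) f
  lies {x y : Fibre κ b} (u : x ⟶ y) :
    TriLies (ov y) ((ov x).comp (Ov.hom u)) (natTri trans u) (ρ_ f).inv
  cartesian (x : Fibre κ b) : IsCartesian₁ P (leg trans x)

variable {κ : Cleavage P} {a b c d : B}

namespace Cone

lemma natTri_cartesian {f : a ⟶ b} (A : Cone κ f) {x y : Fibre κ b} (u : x ⟶ y) :
    IsCartesian₂ P (natTri A.trans u) :=
  .of_iso (A.trans.naturality u)

lemma push_cartesian (hP : IsFibration P) {f : a ⟶ b} (A : Cone κ f) {x y : Fibre κ b} {t : x ⟶ y}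
    {e : E} {C : (incl κ b).obj y ⟶ e} {D : (incl κ b).obj x ⟶ e} {τ : (incl κ b).map t ≫ C ⟶ D}
    (h : IsCartesian₂ P τ) : IsCartesian₂ P (push A.trans τ) :=
  hP.pushTri_cartesian (A.natTri_cartesian t) h

variable (κ) in
/-- The chosen cartesian 1-cells over `f`. -/
noncomputable def pb (hP : IsFibration P) (f : a ⟶ b) : Cone κ f where
  functor := pbFunctor f hP
  trans := mkTrans (pbFunctor f hP) (pbLeg κ f) (pbNat κ f)
    (fun θ => (exists_pbMap₂ κ f θ).choose_spec) (fun x => (exists_pbMapId κ f x).choose_spec)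
    (fun u v => (exists_pbMapComp f hP u v).choose_spec)
  ov := pbOv κ f
  lies u := pbNat_lies κ f u
  cartesian := pbLeg_cartesian κ f

/-- The composite of two cones. -/
noncomputable def comp {f : a ⟶ b} {g : b ⟶ c} (A : Cone κ f) (C : Cone κ g) : Cone κ (f ≫ g) where
  functor := C.functor.comp A.functor
  trans := compTrans A.trans C.trans
  ov x := (A.ov (C.functor.obj x)).comp (C.ov x)
  lies {x y} u := by
    have h : TriLies ((A.ov (C.functor.obj y)).comp (C.ov y))
        (((A.ov (C.functor.obj x)).comp (C.ov x)).comp (Ov.hom u))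
        (push A.trans (natTri C.trans u) ≫ (α_ _ _ _).inv) (ρ_ (f ≫ g)).inv :=
      ((TriLies.push A.ov A.lies (C.lies u)).comp_right
        (Ov.lies_associator_inv (A.ov _) (C.ov x) (Ov.hom u))).congr (by simp)
    rw [natTri_compTrans]
    exact h
  cartesian x := (A.cartesian (C.functor.obj x)).comp (C.cartesian x)

variable (κ a) in
/-- The identity cone. -/
noncomputable def id : Cone κ (𝟙 a) where
  functor := Pseudofunctor.id (Fibre κ a)
  trans := leftUnitTrans (incl κ a)
  ov x := Ov.id x
  lies {x y} u := ((Ov.lies_rightUnitor (Ov.hom u)).trans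
    (Ov.lies_leftUnitor_inv (Ov.hom u))).congr rfl (by simp [unitors_equal, unitors_inv_equal])
  cartesian x := isCartesian₁_id _

end Cone

/-- A transformation of the homomorphisms underlying two cones, with cartesian triangles. -/
structure ConeHom {f g : a ⟶ b} (A : Cone κ f) (C : Cone κ g) (σ : g ⟶ f) extends
    Tri A.trans C.trans where
  lies (x : Fibre κ b) : TriLies (C.ov x) (A.ov x) (tri x) σ
  cartesian (x : Fibre κ b) : IsCartesian₂ P (tri x)

namespace ConeHom

section Operations

variable {f f' f'' : a ⟶ b} {g g' : b ⟶ c} {h : c ⟶ d}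

/-- The composite of two morphisms of cones. -/
noncomputable def comp (hP : IsFibration P) {A : Cone κ f} {A' : Cone κ f'} {A'' : Cone κ f''} {σ :
    f' ⟶ f}
    {σ' : f'' ⟶ f'} (S : ConeHom A A' σ) (T : ConeHom A' A'' σ') : ConeHom A A'' (σ' ≫ σ) where
  toTri := S.toTri.comp T.toTri
  lies x := (S.lies x).star (T.lies x)
  cartesian x := hP.star_cartesian (S.cartesian x) (T.cartesian x)

/-- The identity morphism of a cone. -/
noncomputable def id (A : Cone κ f) : ConeHom A A (𝟙 f) where
  toTri := Tri.id A.trans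
  lies x := TriLies.unitTri (A.ov x)
  cartesian _ := isCartesian₂_unitTri _

/-- The whiskering of a morphism of cones on the source side. -/
noncomputable def preW (hP : IsFibration P) {A : Cone κ f} {A' : Cone κ f'} {σ : f' ⟶ f} (C :
    Cone κ g)
    (S : ConeHom A A' σ) : ConeHom (A.comp C) (A'.comp C) (σ ▷ g) where
  toTri := Tri.preW C.trans S.toTri
  lies x := (S.lies (C.functor.obj x)).whisk (C.ov x)
  cartesian _ := hP.whisk_cartesian (S.cartesian _) _

/-- The whiskering of a morphism of cones on the target side. -/
noncomputable def postW (hP : IsFibration P) (A : Cone κ f) {C : Cone κ g} {C' : Cone κ g'} {σ :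
    g' ⟶ g}
    (S : ConeHom C C' σ) : ConeHom (A.comp C) (A.comp C') (f ◁ σ) where
  toTri := Tri.postW A.trans S.toTri
  lies x := TriLies.push A.ov A.lies (S.lies x)
  cartesian x := A.push_cartesian hP (S.cartesian x)

/-- The associativity morphism of cones. -/
noncomputable def assoc (A : Cone κ f) (C : Cone κ g) (D : Cone κ h) :
    ConeHom (A.comp (C.comp D)) ((A.comp C).comp D) (α_ f g h).hom where
  toTri := Tri.assoc A.trans C.trans D.trans
  lies x := ((TriLies.unitTri (((A.comp C).comp D).ov x)).comp_right
    (Ov.lies_associator (A.ov _) (C.ov _) (D.ov x))).congr (by simp)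
  cartesian x := (isCartesian₂_unitTri _).comp (.of_iso (α_ _ _ _))

/-- The morphism from the composite of a cone with an identity on the source side. -/
noncomputable def leftUnit (A : Cone κ f) : ConeHom (A.comp (Cone.id κ b)) A (ρ_ f).inv where
  toTri := Tri.leftUnit A.trans
  lies x := ((TriLies.unitTri (A.ov x)).comp_right
    (Ov.lies_rightUnitor_inv (A.ov x))).congr (by simp)
  cartesian x := (isCartesian₂_unitTri _).comp (.of_iso (ρ_ _).symm)

/-- The morphism to the composite of a cone with an identity on the target side. -/
noncomputable def rightUnit (A : Cone κ f) : ConeHom A ((Cone.id κ a).comp A) (λ_ f).hom where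
  toTri := Tri.rightUnit A.trans
  lies x := ((TriLies.unitTri (((Cone.id κ a).comp A).ov x)).comp_right
    (Ov.lies_leftUnitor (A.ov x))).congr (by simp)
  cartesian x := (isCartesian₂_unitTri _).comp (.of_iso (λ_ _))

end Operations

section Lift

variable {f g : a ⟶ b} {A : Cone κ f} {C : Cone κ g} {σ σ' : g ⟶ f}

lemma hom₂_ext (S : ConeHom A C σ) {x : Fibre κ b} {s : A.functor.obj x ⟶ C.functor.obj x}
    {θ θ' : s ⟶ S.trans.app x}
    (h : act (incl κ a) θ (S.tri x) = act (incl κ a) θ' (S.tri x)) : θ = θ' :=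
  hom₂_ext_of_cartesian (C.cartesian x) (S.cartesian x) h

/-- The components of the isomorphism between two morphisms of cones over the same 2-cell. -/
noncomputable def isoApp (S : ConeHom A C σ) (T : ConeHom A C σ') (w : σ = σ') (x : Fibre κ b) :
    S.trans.app x ≅ T.trans.app x :=
  liftIso (C.cartesian x) (T.cartesian x) (T.lies x) (S.cartesian x) ((S.lies x).congr w)

lemma act_isoApp (S : ConeHom A C σ) (T : ConeHom A C σ') (w : σ = σ') (x : Fibre κ b) :
    act (incl κ a) (S.isoApp T w x).hom (T.tri x) = S.tri x :=
  act_liftIso (C.cartesian x) (T.cartesian x) (T.lies x) (S.cartesian x) ((S.lies x).congr w)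

variable (hP : IsFibration P)

/-- The isomorphism between two morphisms of cones over the same 2-cell. -/
noncomputable def iso (S : ConeHom A C σ) (T : ConeHom A C σ') (w : σ = σ') :
    S.trans ≅ T.trans :=
  Pseudofunctor.StrongTrans.isoMk (S.isoApp T w) (by
    intro x y u
    -- The modification axiom is tested on the triangle occurring in the naturality of `T`; both
    -- sides evaluate to `S.tri y` pasted with the square of `A`.
    refine hom₂_ext_of_cartesian (C.cartesian y) (hP.star_cartesian (hP.whisk_cartesian
      (T.cartesian x) ((incl κ b).map u)) (C.natTri_cartesian u)) ?_
    rw [act_comp, T.naturality, act_whiskerLeft, act_isoApp, act_comp, act_whiskerRight, act_whisk,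
      act_isoApp, S.naturality])

lemma act_iso (S : ConeHom A C σ) (T : ConeHom A C σ') (w : σ = σ') (x : Fibre κ b) :
    act (incl κ a) (appIso (iso hP S T w) x).hom (T.tri x) = S.tri x :=
  act_isoApp S T w x

section OfComponents

variable (s : ∀ x, A.functor.obj x ⟶ C.functor.obj x)
  (m : ∀ x, (incl κ a).map (s x) ≫ leg C.trans x ⟶ leg A.trans x)
  (hm : ∀ x, TriLies (C.ov x) (A.ov x) (m x) σ) (hm' : ∀ x, IsCartesian₂ P (m x))

/-- The naturality 2-cells determined by triangles over `σ`. -/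
noncomputable def nat {x y : Fibre κ b} (u : x ⟶ y) :
    A.functor.map u ≫ s y ≅ s x ≫ C.functor.map u :=
  liftIso (C.cartesian y)
    (p := star (incl κ a) (whisk (incl κ a) (m x) ((incl κ b).map u)) (natTri C.trans u))
    (q := star (incl κ a) (natTri A.trans u) (m y))
    (hP.star_cartesian (hP.whisk_cartesian (hm' x) _) (C.natTri_cartesian u))
    (((hm x).whisk (Ov.hom u)).star (C.lies u))
    (hP.star_cartesian (A.natTri_cartesian u) (hm' y))
    (((A.lies u).star (hm y)).congr (by simp))

lemma act_nat_natTri {x y : Fibre κ b} (u : x ⟶ y) :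
    act (incl κ a) (nat hP s m hm hm' u).hom
      (star (incl κ a) (whisk (incl κ a) (m x) ((incl κ b).map u)) (natTri C.trans u)) =
      star (incl κ a) (natTri A.trans u) (m y) :=
  act_liftIso (C.cartesian y) _ _ _ _

lemma act_nat {x y : Fibre κ b} (u : x ⟶ y) {e : E} {D : (incl κ b).obj y ⟶ e}
    {D' : (incl κ b).obj x ⟶ e} (τ : (incl κ b).map u ≫ D ⟶ D') :
    act (incl κ a) (nat hP s m hm hm' u).hom
      (star (incl κ a) (whisk (incl κ a) (m x) D') (push C.trans τ)) =
      star (incl κ a) (push A.trans τ) (whisk (incl κ a) (m y) D) :=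
  act_star_whisk_push (act_nat_natTri hP s m hm hm' u) τ

include hP hm' in
-- As for `pbMap_hom₂_ext`, the triangle `τ` is left free so that the test triangle can be adapted
-- to the axiom under consideration.
lemma ofComponents_ext {x y : Fibre κ b} {u : x ⟶ y} {t : A.functor.obj x ⟶ C.functor.obj y}
    {D : (incl κ b).obj x ⟶ (incl κ b).obj y} (τ : (incl κ b).map u ≫ 𝟙 _ ⟶ D)
    (hτ : IsCartesian₂ P τ) {θ θ' : t ⟶ s x ≫ C.functor.map u}
    (h : act (incl κ a) θ (star (incl κ a) (whisk (incl κ a) (m x) D) (push C.trans τ)) =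
      act (incl κ a) θ' (star (incl κ a) (whisk (incl κ a) (m x) D) (push C.trans τ))) :
    θ = θ' :=
  hom₂_ext_of_cartesian ((C.cartesian y).comp (isCartesian₁_id _))
    (hP.star_cartesian (hP.whisk_cartesian (hm' x) D) (C.push_cartesian hP hτ)) h

/-- A morphism of cones from its triangles. -/
noncomputable def ofComponents : ConeHom A C σ where
  trans :=
    { app := s
      naturality := nat hP s m hm hm'
      naturality_naturality := fun θ => ofComponents_ext hP s m hm' (ρ_ _).hom (.of_iso _) (by
        simp only [act_comp, act_nat, act_whiskerLeft, act_whiskerRight, act_map₂_push])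
      naturality_id := fun x => hom₂_ext_of_cartesian
        ((C.cartesian x).comp (isCartesian₁_id _))
        (hP.star_cartesian (hP.whisk_cartesian (hm' x) (𝟙 _)) (isCartesian₂_unitTri _)) (by
          simp only [act_comp, act_nat, act_whiskerLeft, act_whiskerRight, act_mapId_push,
            act_leftUnitor_hom, act_rightUnitor_inv])
      -- The test triangle follows the bracketing of the target `s x ≫ (C.functor.map u ≫
      -- C.functor.map v)`: one triangle for each of the three factors.
      naturality_comp := fun {x y z} u v => hom₂_ext_of_cartesian
        ((C.cartesian z).comp (isCartesian₁_id _))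
        (hP.star_cartesian (hP.whisk_cartesian (hm' x) _)
          (hP.star_cartesian (C.push_cartesian hP (.of_isIso (𝟙 _)))
            (C.push_cartesian hP (.of_iso (ρ_ ((incl κ b).map v)))))) (by
          simp only [act_comp, act_nat, act_whiskerLeft, act_whiskerRight, act_mapComp_push,
            act_associator_hom, act_associator_inv]) }
  tri := m
  naturality u := act_nat_natTri hP s m hm hm' u
  lies := hm
  cartesian := hm'

end OfComponents

/-- The chosen cartesian lift `φ` of `σ` at the leg of `A` has a domain `v` over `g`, and `v`
factors through the cartesian leg of `C`. The factor is `s`, and `m` is the factorisation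
isomorphism followed by `φ`. -/
lemma exists_component (f g : a ⟶ b) (A : Cone κ f) (C : Cone κ g) (σ : g ⟶ f) (x : Fibre κ b) :
    ∃ (s : A.functor.obj x ⟶ C.functor.obj x)
      (m : (incl κ a).map s ≫ leg C.trans x ⟶ leg A.trans x),
      TriLies (C.ov x) (A.ov x) m σ ∧ IsCartesian₂ P m := by
  let j : (proj P (A.functor.obj x).pt x.pt).obj (leg A.trans x) ≅ f := A.ov x
  let v : (incl κ a).obj (A.functor.obj x) ⟶ (incl κ b).obj x :=
    -- The leg of `A` is only identified with `f` up to the isomorphism `j`, so `σ` is corrected by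
    -- its inverse before lifting.
    κ.pull₂ (A.functor.obj x).pt x.pt (leg A.trans x) (σ ≫ j.inv)
  let i : Ov v g := eqToIso (κ.pull₂_over (A.functor.obj x).pt x.pt (leg A.trans x)
    (σ ≫ j.inv))
  let φ : v ⟶ leg A.trans x :=
    κ.cart₂ (A.functor.obj x).pt x.pt (leg A.trans x) (σ ≫ j.inv)
  have hφ : Cell.Lies i.cell (A.ov x).cell φ σ := by
    have h := κ.cart₂_over (A.functor.obj x).pt x.pt (leg A.trans x) (σ ≫ j.inv)
    have h' : (proj P (A.functor.obj x).pt x.pt).map φ ≫ j.hom = Iso.hom i ≫ σ := by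
      simp [φ, i, h]
    exact h'
  obtain ⟨s, η, hη⟩ := Ov.exists_lift (C.ov x) (C.cartesian x) i (Iso.refl g)
  exact ⟨s, η.hom ≫ φ, (hη.comp_right hφ).congr (by simp),
    (IsCartesian₂.of_iso η).comp (κ.cart₂_cartesian _ _ _ _)⟩

end Lift

/-- A morphism between two given cones over a given 2-cell. -/
noncomputable def mk' (hP : IsFibration P) {f g : a ⟶ b} (A : Cone κ f) (C : Cone κ g)
    (σ : g ⟶ f) : ConeHom A C σ :=
  ofComponents hP (fun x => (exists_component f g A C σ x).choose)
    (fun x => (exists_component f g A C σ x).choose_spec.choose)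
    (fun x => (exists_component f g A C σ x).choose_spec.choose_spec.1)
    (fun x => (exists_component f g A C σ x).choose_spec.choose_spec.2)

end ConeHom

end Cones

end FibredBicat

namespace FibredBicat

/-! ### Construction of the trihomomorphism data. -/

section Reindexing

variable {E : Type u₁} [Bicategory.{w₁, v₁} E] {B : Type u₂} [Bicategory.{w₂, v₂} B]
  {P : E ⥤ᵖ B} {κ : Cleavage P} {a b c d : B}

namespace ConeHom

section Compat

variable {f f' f'' : a ⟶ b} {A : Cone κ f} {A' : Cone κ f'} {A'' : Cone κ f''}

/-- The modification `Γ` is compatible with the triangles of `S` and `T`. -/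
def Compat {p p' : f' ⟶ f} (S : ConeHom A A' p) (T : ConeHom A A' p') (Γ : S.trans ⟶ T.trans) :
    Prop :=
  ∀ x, act (incl κ a) (Γ.as.app x) (T.tri x) = S.tri x

variable {p p' p'' : f' ⟶ f} {S : ConeHom A A' p} {T : ConeHom A A' p'} {U : ConeHom A A' p''}

/-- The triangles of `T` are cartesian, so compatibility determines every component. Equations
between modifications thereby reduce to the compatibility of each side. -/
lemma Compat.ext {Γ Γ' : S.trans ⟶ T.trans} (h : Compat S T Γ) (h' : Compat S T Γ') : Γ = Γ' :=
  Pseudofunctor.StrongTrans.homCategory.ext fun x => T.hom₂_ext ((h x).trans (h' x).symm)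

lemma Compat.trans {Γ : S.trans ⟶ T.trans} {Γ' : T.trans ⟶ U.trans} (h : Compat S T Γ)
    (h' : Compat T U Γ') : Compat S U (Γ ≫ Γ') := fun x => by
  have e : act (incl κ a) (Γ.as.app x ≫ Γ'.as.app x) (U.tri x) = S.tri x := by
    rw [act_comp, h', h]
  exact e

lemma Compat.iso (hP : IsFibration P) (S : ConeHom A A' p) (T : ConeHom A A' p') (w : p = p') :
    Compat S T (ConeHom.iso hP S T w).hom :=
  act_iso hP S T w

lemma Compat.iso_inv (hP : IsFibration P) (S : ConeHom A A' p) (T : ConeHom A A' p') (w : p = p') :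
    Compat T S (ConeHom.iso hP S T w).inv :=
  fun x => act_inv_eq (appIso (ConeHom.iso hP S T w) x) (act_iso hP S T w x)

/-- The coherence 2-cells of a locally discrete bicategory are equalities. Indexing the morphisms of
cones by a family makes it possible to substitute an equality of indices. -/
lemma Compat.eqToHom {ι : Type*} (p : ι → (f' ⟶ f)) (S : ∀ i, ConeHom A A' (p i)) {i j : ι}
    (h : i = j) (w : (S i).trans = (S j).trans) : Compat (S i) (S j)
        (CategoryTheory.eqToHom w) := by
  subst h
  intro x
  have e : act (incl κ a) (𝟙 ((S i).trans.app x)) ((S i).tri x) = (S i).tri x := act_id _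
  exact e

lemma Compat.whiskerLeft (hP : IsFibration P) {q q' : f'' ⟶ f'} (S : ConeHom A A' p)
    {T : ConeHom A' A'' q} {U : ConeHom A' A'' q'} {Γ : T.trans ⟶ U.trans} (h : Compat T U Γ) :
    Compat (S.comp hP T) (S.comp hP U) (S.trans ◁ Γ) := fun x => by
  have e : act (incl κ a) (S.trans.app x ◁ Γ.as.app x) (star (incl κ a) (S.tri x) (U.tri x)) =
      star (incl κ a) (S.tri x) (T.tri x) := by
    rw [act_whiskerLeft, h]
  exact e

lemma Compat.whiskerRight (hP : IsFibration P) {q : f'' ⟶ f'} {Γ : S.trans ⟶ T.trans}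
    (h : Compat S T Γ) (U : ConeHom A' A'' q) :
    Compat (S.comp hP U) (T.comp hP U) (Γ ▷ U.trans) := fun x => by
  have e : act (incl κ a) (Γ.as.app x ▷ U.trans.app x) (star (incl κ a) (T.tri x) (U.tri x)) =
      star (incl κ a) (S.tri x) (U.tri x) := by
    rw [act_whiskerRight, h]
  exact e

lemma Compat.associator (hP : IsFibration P) {f₃ : a ⟶ b} {A₃ : Cone κ f₃} {q : f'' ⟶ f'}
    {r : f₃ ⟶ f''} (S : ConeHom A A' p) (T : ConeHom A' A'' q) (U : ConeHom A'' A₃ r) :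
    Compat ((S.comp hP T).comp hP U) (S.comp hP (T.comp hP U))
      (α_ S.trans T.trans U.trans).hom :=
  fun x => act_associator_hom (S.tri x) (T.tri x) (U.tri x)

lemma Compat.leftUnitor (hP : IsFibration P) (S : ConeHom A A' p) :
    Compat ((ConeHom.id A).comp hP S) S (λ_ S.trans).hom :=
  fun x => act_leftUnitor_hom (S.tri x)

lemma Compat.rightUnitor (hP : IsFibration P) (S : ConeHom A A' p) :
    Compat (S.comp hP (ConeHom.id A')) S (ρ_ S.trans).hom :=
  fun x => act_rightUnitor_hom (S.tri x)

end Compat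

/-- The equivalence between homomorphisms underlying cones over isomorphic 1-cells. -/
noncomputable def equivalence (hP : IsFibration P) {f f' : a ⟶ b} {A : Cone κ f} {A' : Cone κ f'}
    {p : f' ⟶ f} {q : f ⟶ f'} (S : ConeHom A A' p) (S' : ConeHom A' A q) (w : q ≫ p = 𝟙 f)
    (w' : p ≫ q = 𝟙 f') : Bicategory.Equivalence A.functor A'.functor :=
  -- Each of the two composites lies over an identity 2-cell, as does the identity morphism of the
  -- cone, so the two are isomorphic; adjointification corrects the counit.
  Bicategory.Equivalence.mkOfAdjointifyCounit (f := S.trans) (g := S'.trans)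
    (iso hP (ConeHom.id A) (S.comp hP S') w.symm) (iso hP (S'.comp hP S) (ConeHom.id A') w')

end ConeHom

variable (κ) (hP : IsFibration P)

/-- The transformation `σ^*`, with the cartesian 2-cells over `σ`. -/
noncomputable def twHom {f g : a ⟶ b} (σ : f ⟶ g) : ConeHom (Cone.pb κ hP g) (Cone.pb κ hP f) σ :=
  .mk' hP _ _ σ

/-- The transformation `f^* g^* ⟶ (f ≫ g)^*`. -/
noncomputable def chiHom (f : a ⟶ b) (g : b ⟶ c) :
    ConeHom ((Cone.pb κ hP f).comp (Cone.pb κ hP g)) (Cone.pb κ hP (f ≫ g)) (𝟙 (f ≫ g)) :=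
  .mk' hP _ _ _

/-- The transformation `1 ⟶ (𝟙 a)^*`. -/
noncomputable def iotaHom (a : B) :
    ConeHom (Cone.id κ a) (Cone.pb κ hP (𝟙 a)) (𝟙 (𝟙 a)) :=
  .mk' hP _ _ _

/-- The homomorphism from `(a ⟶ b)ᵒᵖ` given by reindexing. -/
noncomputable def pbLoc (a b : B) :
    Pseudofunctor (LocallyDiscrete (a ⟶ b)ᵒᵖ) (Fibre κ b ⥤ᵖ Fibre κ a) :=
  pseudofunctorOfIsLocallyDiscrete
    (obj := fun f => (Cone.pb κ hP f.as.unop).functor)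
    (map := fun σ => (twHom κ hP σ.as.unop).trans)
    (mapId := fun f => ConeHom.iso hP (twHom κ hP (𝟙 f.as.unop)) (.id _) rfl)
    (mapComp := fun σ τ => ConeHom.iso hP (twHom κ hP (τ.as.unop ≫ σ.as.unop))
      ((twHom κ hP σ.as.unop).comp hP (twHom κ hP τ.as.unop)) rfl)
    -- Each axiom equates a pasting of constraints with an `eqToHom`, and both are compatible with
    -- the triangles. The unit axioms follow the same pattern.
    (map₂_associator := fun {f₀ _ _ f₃} _ _ _ => ConeHom.Compat.ext
      (.trans (.iso hP _ _ _) (.trans (.whiskerRight hP (.iso hP _ _ _) _)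
        (.trans (.associator hP _ _ _) (.trans (.whiskerLeft hP _ (.iso_inv hP _ _ _))
          (.iso_inv hP _ _ _)))))
      (.eqToHom (fun σ : f₀ ⟶ f₃ => σ.as.unop) (fun σ => twHom κ hP σ.as.unop)
        (Category.assoc _ _ _) _))
    (map₂_left_unitor := fun {f₀ f₁} _ => ConeHom.Compat.ext
      (.trans (.iso hP _ _ _) (.trans (.whiskerRight hP (.iso hP _ _ _) _) (.leftUnitor hP _)))
      (.eqToHom (fun σ : f₀ ⟶ f₁ => σ.as.unop) (fun σ => twHom κ hP σ.as.unop)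
        (Category.id_comp _) _))
    (map₂_right_unitor := fun {f₀ f₁} _ => ConeHom.Compat.ext
      (.trans (.iso hP _ _ _) (.trans (.whiskerLeft hP _ (.iso hP _ _ _)) (.rightUnitor hP _)))
      (.eqToHom (fun σ : f₀ ⟶ f₁ => σ.as.unop) (fun σ => twHom κ hP σ.as.unop)
        (Category.comp_id _) _))

/-- The data of the trihomomorphism given by reindexing. -/
noncomputable def pbData : TrihomData B (fun b => Fibre κ b) where
  loc := pbLoc κ hP
  χ f g := (chiHom κ hP f g).equivalence hP (.mk' hP _ _ (𝟙 _)) (by simp) (by simp)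
  χ₂ {a b c f f' g g'} α β := ConeHom.iso hP
    ((((twHom κ hP α).preW hP (Cone.pb κ hP g')).comp hP
      ((twHom κ hP β).postW hP (Cone.pb κ hP f))).comp hP (chiHom κ hP f g))
    -- The first morphism lies over `f ◁ β ≫ α ▷ g'`, the second over `hor α β`; these agree by
    -- interchange.
    ((chiHom κ hP f' g').comp hP (twHom κ hP (hor α β))) (by simp [hor, whisker_exchange])
  ι a := (iotaHom κ hP a).equivalence hP (.mk' hP _ _ (𝟙 _)) (by simp) (by simp)
  ω f g h := ConeHom.iso hP
    (((chiHom κ hP g h).postW hP (Cone.pb κ hP f)).comp hP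
      ((chiHom κ hP f (g ≫ h)).comp hP (twHom κ hP (α_ f g h).hom)))
    ((ConeHom.assoc (Cone.pb κ hP f) (Cone.pb κ hP g) (Cone.pb κ hP h)).comp hP
      (((chiHom κ hP f g).preW hP (Cone.pb κ hP h)).comp hP (chiHom κ hP (f ≫ g) h))) (by simp)
  γ {a b} f := ConeHom.iso hP
    (((iotaHom κ hP b).postW hP (Cone.pb κ hP f)).comp hP
      ((chiHom κ hP f (𝟙 b)).comp hP (twHom κ hP (ρ_ f).inv)))
    (ConeHom.leftUnit (Cone.pb κ hP f)) (by simp)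
  δ {a b} f := ConeHom.iso hP (twHom κ hP (λ_ f).hom)
    ((ConeHom.rightUnit (Cone.pb κ hP f)).comp hP
      (((iotaHom κ hP a).preW hP (Cone.pb κ hP f)).comp hP (chiHom κ hP (𝟙 a) f))) (by simp)

end Reindexing

end FibredBicat

namespace FibredBicat

/-- The definitions of `omega` and `delta` append a left unitor to discard the identity component of
`assocTrans` or `rightUnitTrans`. This rule accounts for that unitor on triangles. -/
lemma act_comp_leftUnitor_hom {X : Type u₁} [Bicategory.{w₁, v₁} X] {E : Type u₂}
    [Bicategory.{w₂, v₂} E] {J : X ⥤ᵖ E} {x y : X} {s t : x ⟶ y} (θ : s ⟶ 𝟙 x ≫ t) {e : E}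
    {C : J.obj y ⟶ e} {D D' : J.obj x ⟶ e} (τ : J.map t ≫ C ⟶ D) (δ : D ⟶ D') :
    act J (θ ≫ (λ_ t).hom) (τ ≫ δ) = act J θ (star J (unitTri J D ≫ δ) τ) := by
  rw [act_comp, act_comp_right, act_leftUnitor_hom, star_comp_left]

/-! ### The constructed data is induced by its triangles. -/

section ReindexingData

variable {E : Type u₁} [Bicategory.{w₁, v₁} E] {B : Type u₂} [Bicategory.{w₂, v₂} B]
  {P : E ⥤ᵖ B} {κ : Cleavage P} {a b c d : B}

namespace ReindexingData

variable {T : TrihomData B (fun b => Fibre κ b)} (R : ReindexingData κ T)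

/-- The 2-cell `R.psi σ e`, as a triangle. -/
noncomputable def psiTri {f g : a ⟶ b} (σ : f ⟶ g) (e : Fibre κ b) :
    (incl κ a).map (T.tw σ e) ≫ leg (R.c f) e ⟶ leg (R.c g) e :=
  (R.ψ σ).as.app e

/-- The 2-cell `R.xi f g e`, as a triangle. -/
noncomputable def xiTri (f : a ⟶ b) (g : b ⟶ c) (e : Fibre κ c) :
    (incl κ a).map (T.chi f g e) ≫ leg (R.c (f ≫ g)) e ⟶
      leg (R.c f) ((T.map₁ g).obj e) ≫ leg (R.c g) e :=
  (R.xi f g e).hom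

/-- The 2-cell `R.ii a e`, as a triangle. -/
noncomputable def iiTri (a : B) (e : Fibre κ a) :
    (incl κ a).map (T.iota a e) ≫ leg (R.c (𝟙 a)) e ⟶ 𝟙 ((incl κ a).obj e) :=
  (R.ii a e).hom

/-- The constraints of `T` are the 2-cells induced by the triangles of `R`. -/
structure IsInduced : Prop where
  act_twComp {a b : B} {f g h : a ⟶ b} (σ : f ⟶ g) (τ : g ⟶ h) (e : Fibre κ b) :
    act (incl κ a) (T.twComp σ τ _ rfl e).hom
      (star (incl κ a) (R.psiTri τ e) (R.psiTri σ e)) = R.psiTri (σ ≫ τ) e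
  act_twId {a b : B} (f : a ⟶ b) (e : Fibre κ b) :
    act (incl κ a) (T.twId (𝟙 f) rfl e).hom (unitTri (incl κ a) (leg (R.c f) e)) = R.psiTri (𝟙 f) e
  act_chi₂ {a b c : B} {f f' : a ⟶ b} {g g' : b ⟶ c} (α : f ⟶ f') (β : g ⟶ g') (e : Fibre κ c) :
    act (incl κ a) (T.chi₂ α β e).hom
      (star (incl κ a) (R.xiTri f' g' e) (R.psiTri (hor α β) e)) =
      star (incl κ a) (star (incl κ a) (whisk (incl κ a) (R.psiTri α ((T.map₁ g').obj e))
        (leg (R.c g') e)) (push (R.c f) (R.psiTri β e))) (R.xiTri f g e)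
  act_omega {a b c d : B} (f : a ⟶ b) (g : b ⟶ c) (h : c ⟶ d) (e : Fibre κ d) :
    act (incl κ a) (T.omega f g h e).hom (star (incl κ a) (whisk (incl κ a)
      (R.xiTri f g ((T.map₁ h).obj e)) (leg (R.c h) e)) (R.xiTri (f ≫ g) h e) ≫ (α_ _ _ _).hom) =
      star (incl κ a) (push (R.c f) (R.xiTri g h e))
        (star (incl κ a) (R.xiTri f (g ≫ h) e) (R.psiTri (α_ f g h).hom e))
  act_gamma {a b : B} (f : a ⟶ b) (e : Fibre κ b) :
    act (incl κ a) (T.gamma f e).hom (unitTri (incl κ a) (leg (R.c f) e) ≫ (ρ_ _).inv) =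
      star (incl κ a) (push (R.c f) (R.iiTri b e))
        (star (incl κ a) (R.xiTri f (𝟙 b) e) (R.psiTri (ρ_ f).inv e))
  act_delta {a b : B} (f : a ⟶ b) (e : Fibre κ b) :
    act (incl κ a) (T.delta f e).hom (star (incl κ a) (whisk (incl κ a)
      (R.iiTri a ((T.map₁ f).obj e)) (leg (R.c f) e)) (R.xiTri (𝟙 a) f e) ≫ (λ_ _).hom) =
      R.psiTri (λ_ f).hom e

end ReindexingData

lemma Cell.Lies.isIso_map {x : FibreObj P a} {y : FibreObj P b} {f g : a ⟶ b} {u : Cell x y f}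
    {v : Cell x y g} {η : u.hom ⟶ v.hom} {σ : f ⟶ g} [IsIso σ] (h : Cell.Lies u v η σ) :
    IsIso ((proj P x y).map η) := by
  have h' : (proj P x y).map η = u.iso.hom ≫ σ ≫ v.iso.inv := by
    rw [← Category.assoc, ← h, Category.assoc, Iso.hom_inv_id, Category.comp_id]
  rw [h']
  infer_instance

/-- A cartesian 2-cell over an invertible one is invertible. Applied to `chiHom` and `iotaHom`,
which lie over identities, this makes the modifications `X` and `I` invertible. -/
lemma ConeHom.isIso_tri {f g : a ⟶ b} {A : Cone κ f} {C : Cone κ g} {σ : g ⟶ f} [IsIso σ]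
    (S : ConeHom A C σ) (x : Fibre κ b) : IsIso (S.tri x) :=
  (S.cartesian x).isIso (Cell.Lies.isIso_map (S.lies x))

/-- The invertible modification given by a morphism of cones over an invertible 2-cell. -/
noncomputable def ConeHom.toIso {f g : a ⟶ b} {A : Cone κ f} {C : Cone κ g} {σ : g ⟶ f} [IsIso σ]
    (S : ConeHom A C σ) : postWhisker S.trans (incl κ a) ≫ C.trans ≅ A.trans :=
  Pseudofunctor.StrongTrans.isoMk (fun x => @asIso _ _ _ _ (S.tri x)
      (S.isIso_tri x)) S.toTri.toHom.as.naturality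

variable (κ) (hP : IsFibration P)

/-- The homomorphisms of `pbData` are the reindexing homomorphisms. -/
noncomputable def pbReindexing : ReindexingData κ (pbData κ hP) where
  c f := (Cone.pb κ hP f).trans
  c_app _ _ := rfl
  ψ σ := (twHom κ hP σ).toTri.toHom
  X f g := (chiHom κ hP f g).toIso ≪≫ compTransIso (Cone.pb κ hP f).trans (Cone.pb κ hP g).trans
  I a := (iotaHom κ hP a).toIso

/-- The unitor in the definition of `xi` cancels the inverse unitor contributed by `compTransIso`.
-/
lemma pbReindexing_xiTri (f : a ⟶ b) (g : b ⟶ c) (e : Fibre κ c) :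
    (pbReindexing κ hP).xiTri f g e = (chiHom κ hP f g).tri e := by
  have h : ∀ {x y : E} {u v : x ⟶ y} (τ : u ⟶ v), (τ ≫ (λ_ v).inv) ≫ (λ_ v).hom = τ := by
    simp
  exact h _

/-- Every constraint was defined as a `ConeHom.iso`, and `act_iso` is exactly the equation demanded
of it. -/
lemma pbReindexing_isInduced : (pbReindexing κ hP).IsInduced where
  act_twComp σ τ e := by
    have h : (pbData κ hP).twComp σ τ _ rfl e =
        appIso ((pbLoc κ hP _ _).mapComp τ.op.toLoc σ.op.toLoc) e :=
      congrArg (appIso · e) (Pseudofunctor.mapComp'_eq_mapComp _ _ _)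
    rw [h]
    exact ConeHom.act_iso hP (twHom κ hP (σ ≫ τ)) ((twHom κ hP τ).comp hP (twHom κ hP σ)) rfl e
  act_twId f e := by
    have h : (pbData κ hP).twId (𝟙 f) rfl e = appIso ((pbLoc κ hP _ _).mapId ⟨Opposite.op f⟩) e :=
      congrArg (appIso · e) (Pseudofunctor.mapId'_eq_mapId _ _)
    rw [h]
    exact ConeHom.act_iso hP (twHom κ hP (𝟙 f)) (.id _) rfl e
  act_chi₂ α β e := by
    rw [pbReindexing_xiTri, pbReindexing_xiTri]
    exact ConeHom.act_iso hP _ ((chiHom κ hP _ _).comp hP (twHom κ hP (hor α β))) _ e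
  act_omega f g h e := by
    simp only [pbReindexing_xiTri]
    refine (act_comp_leftUnitor_hom _ _ _).trans ?_
    exact ConeHom.act_iso hP _ ((ConeHom.assoc (Cone.pb κ hP f) (Cone.pb κ hP g)
      (Cone.pb κ hP h)).comp hP (((chiHom κ hP f g).preW hP (Cone.pb κ hP h)).comp hP
        (chiHom κ hP (f ≫ g) h))) _ e
  act_gamma f e := by
    rw [pbReindexing_xiTri]
    exact ConeHom.act_iso hP _ (ConeHom.leftUnit (Cone.pb κ hP f)) _ e
  act_delta {a b} f e := by
    simp only [pbReindexing_xiTri]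
    refine (act_comp_leftUnitor_hom _ _ _).trans ?_
    exact ConeHom.act_iso hP (twHom κ hP (λ_ f).hom) ((ConeHom.rightUnit (Cone.pb κ hP f)).comp hP
      (((iotaHom κ hP a).preW hP (Cone.pb κ hP f)).comp hP (chiHom κ hP (𝟙 a) f))) _ e

end ReindexingData

end FibredBicat

namespace FibredBicat

/-! ### Translation of the triangle calculus into pasting diagrams with coherence. -/

section Pastings

variable {X : Type u₁} [Bicategory.{w₁, v₁} X] {Y : Type u₂} [Bicategory.{w₂, v₂} Y]
  {E : Type u₃} [Bicategory.{w₃, v₃} E] {J : X ⥤ᵖ E} {K : Y ⥤ᵖ E}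

/-- This and the following lemmas express the two sides of the equations of `IsInduced` as the `⊗≫`
pastings used in `IsReindexing`. -/
lemma act_star_eq {x y z : X} {s : x ⟶ z} {u : x ⟶ y} {t : y ⟶ z} (θ : s ⟶ u ≫ t) {e : E}
    {C' : J.obj z ⟶ e} {C : J.obj y ⟶ e} {D : J.obj x ⟶ e} (υ : J.map u ≫ C ⟶ D)
    (τ : J.map t ≫ C' ⟶ C) : act J θ (star J υ τ) =
      J.map₂ θ ▷ C' ⊗≫ (J.mapComp u t).hom ▷ C' ⊗≫ J.map u ◁ τ ⊗≫ υ := by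
  simp [act, star, bicategoricalComp]

lemma act_unitTri_eq {x : X} {s : x ⟶ x} (θ : s ⟶ 𝟙 x) {e : E} (C : J.obj x ⟶ e) :
    act J θ (unitTri J C) = J.map₂ θ ▷ C ⊗≫ (J.mapId x).hom ▷ C ⊗≫ 𝟙 C := by
  simp [act, unitTri, bicategoricalComp]

lemma star_star_pushTri_eq {x y z w : X} {y' z' : Y} {u : x ⟶ y} {v : y ⟶ z} {t : z ⟶ w}
    {v' : y' ⟶ z'} {C₀ : J.obj x ⟶ K.obj y'} {C₁ : J.obj y ⟶ K.obj y'}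
    {C₂ : J.obj z ⟶ K.obj z'} (n : J.map v ≫ C₂ ⟶ C₁ ≫ K.map v') {e : E} {D : K.obj y' ⟶ e}
    {D' : K.obj z' ⟶ e} {C : J.obj w ⟶ e} (ψ : J.map u ≫ C₁ ⟶ C₀) (ψ' : K.map v' ≫ D' ⟶ D)
    (ξ : J.map t ≫ C ⟶ C₂ ≫ D') :
    star J (star J (whisk J ψ D) (pushTri n ψ')) ξ =
      (J.mapComp (u ≫ v) t).hom ▷ C ⊗≫ (J.mapComp u v).hom ▷ J.map t ▷ C ⊗≫
        J.map u ◁ J.map v ◁ ξ ⊗≫ J.map u ◁ n ▷ D' ⊗≫ ψ ▷ K.map v' ▷ D' ⊗≫ C₀ ◁ ψ' := by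
  -- The two sides perform independent 2-cells in different orders: interchange is needed for `ψ`
  -- and `ψ'` here, and for `ξ` and the constraint `mapComp` in `h'`.
  have h : J.map u ◁ C₁ ◁ ψ' ≫ (α_ _ _ _).inv ≫ ψ ▷ D =
      (α_ _ _ _).inv ≫ ψ ▷ (K.map v' ≫ D') ≫ C₀ ◁ ψ' := by
    rw [← whisker_exchange]
    simp
  have h' : J.map (u ≫ v) ◁ ξ ≫ (α_ _ C₂ D').inv ≫ (J.mapComp u v).hom ▷ C₂ ▷ D' =
      (α_ _ _ _).inv ≫ (J.mapComp u v).hom ▷ J.map t ▷ C ≫ (α_ _ _ _).hom ≫ (α_ _ _ _).hom ≫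
        J.map u ◁ J.map v ◁ ξ ≫ (α_ _ _ _).inv ≫ (α_ _ _ _).inv := by
    rw [← associator_inv_naturality_left, whisker_exchange_assoc]
    simp
  simp [star, whisk, pushTri, bicategoricalComp, h, reassoc_of% h']

lemma act_star_whisk_eq {x y z : X} {s : x ⟶ z} {u : x ⟶ y} {t : y ⟶ z} (θ : s ⟶ u ≫ t) {e e' : E}
    {C : J.obj z ⟶ e'} {C₁ : J.obj y ⟶ e} {Z : e ⟶ e'} {m : E} {D' : J.obj x ⟶ m}
    {D'' : m ⟶ e} (ξ : J.map u ≫ C₁ ⟶ D' ≫ D'') (ξ' : J.map t ≫ C ⟶ C₁ ≫ Z) :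
    act J θ (star J (whisk J ξ Z) ξ' ≫ (α_ _ _ _).hom) =
      J.map₂ θ ▷ C ⊗≫ (J.mapComp u t).hom ▷ C ⊗≫ J.map u ◁ ξ' ⊗≫ ξ ▷ Z ⊗≫
        𝟙 (D' ≫ D'' ≫ Z) := by
  simp [act, star, whisk, bicategoricalComp]

lemma act_star_whisk_leftUnitor_eq {x y z : X} {s : x ⟶ z} {u : x ⟶ y} {t : y ⟶ z}
    (θ : s ⟶ u ≫ t) {e : E} {C : J.obj z ⟶ e} {C₁ : J.obj y ⟶ J.obj x} {Z : J.obj x ⟶ e}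
    (ξ : J.map u ≫ C₁ ⟶ 𝟙 (J.obj x)) (ξ' : J.map t ≫ C ⟶ C₁ ≫ Z) :
    act J θ (star J (whisk J ξ Z) ξ' ≫ (λ_ _).hom) =
      J.map₂ θ ▷ C ⊗≫ (J.mapComp u t).hom ▷ C ⊗≫ J.map u ◁ ξ' ⊗≫ ξ ▷ Z ⊗≫ 𝟙 Z := by
  simp [act, star, whisk, bicategoricalComp]

lemma star_pushTri_star_eq {x y z w : X} {x' y' : Y} {u : x ⟶ y} {v : y ⟶ z} {t : z ⟶ w}
    {u' : x' ⟶ y'} {C₁ : J.obj x ⟶ K.obj x'} {C₂ : J.obj y ⟶ K.obj y'}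
    (n : J.map u ≫ C₂ ⟶ C₁ ≫ K.map u') {e : E} {D : K.obj y' ⟶ e} {D' : K.obj x' ⟶ e}
    {C : J.obj w ⟶ e} {C' : J.obj z ⟶ e} (ξ : K.map u' ≫ D ⟶ D') (ξ' : J.map v ≫ C' ⟶ C₂ ≫ D)
    (ψ : J.map t ≫ C ⟶ C') :
    star J (pushTri n ξ) (star J ξ' ψ) =
      (J.mapComp u (v ≫ t)).hom ▷ C ⊗≫ J.map u ◁ (J.mapComp v t).hom ▷ C ⊗≫
        J.map u ◁ J.map v ◁ ψ ⊗≫ J.map u ◁ ξ' ⊗≫ n ▷ D ⊗≫ C₁ ◁ ξ := by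
  simp [star, whisk, pushTri, bicategoricalComp]

lemma star_pushTri_star_rightUnitor_eq {x y z w : X} {x' : Y} {u : x ⟶ y} {v : y ⟶ z}
    {t : z ⟶ w} {y' : Y} {u' : x' ⟶ y'} {C₁ : J.obj x ⟶ K.obj x'} {C₂ : J.obj y ⟶ K.obj y'}
    (n : J.map u ≫ C₂ ⟶ C₁ ≫ K.map u') {D : K.obj y' ⟶ K.obj x'}
    {C : J.obj w ⟶ K.obj x'} {C' : J.obj z ⟶ K.obj x'} (ξ : K.map u' ≫ D ⟶ 𝟙 (K.obj x'))
    (ξ' : J.map v ≫ C' ⟶ C₂ ≫ D) (ψ : J.map t ≫ C ⟶ C') :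
    star J (pushTri n ξ) (star J ξ' ψ) ≫ (ρ_ _).hom =
      (J.mapComp u (v ≫ t)).hom ▷ C ⊗≫ J.map u ◁ (J.mapComp v t).hom ▷ C ⊗≫
        J.map u ◁ J.map v ◁ ψ ⊗≫ J.map u ◁ ξ' ⊗≫ n ▷ D ⊗≫ C₁ ◁ ξ ⊗≫ 𝟙 C₁ := by
  simp [star, whisk, pushTri, bicategoricalComp]

end Pastings

section ReindexingData

variable {E : Type u₁} [Bicategory.{w₁, v₁} E] {B : Type u₂} [Bicategory.{w₂, v₂} B]
  {P : E ⥤ᵖ B} {κ : Cleavage P} {a b c d : B}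

variable (κ) (hP : IsFibration P)

lemma pbReindexing_isReindexing : (pbReindexing κ hP).IsReindexing where
  ccNat_lies f x y u := pbNat_lies κ f u
  psi_lies σ e := (twHom κ hP σ).lies e
  psi_cartesian σ e := (twHom κ hP σ).cartesian e
  xi_lies f g e := by
    have h := pbReindexing_xiTri κ hP f g e
    have h' := ((chiHom κ hP f g).lies e)
    rw [← h] at h'
    exact Cell.Lies.congr h' rfl (by simp)
  ii_lies a e := Cell.Lies.congr ((iotaHom κ hP a).lies e) rfl (by simp)
  psi_comp σ τ e := ((pbReindexing_isInduced κ hP).act_twComp σ τ e).symm.trans (act_star_eq _ _ _)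
  psi_id f e := ((pbReindexing_isInduced κ hP).act_twId f e).symm.trans (act_unitTri_eq _ _)
  chi₂ α β e := (act_star_eq _ _ _).symm.trans
    (((pbReindexing_isInduced κ hP).act_chi₂ α β e).trans (star_star_pushTri_eq _ _ _ _))
  omega f g h e := (act_star_whisk_eq _ _ _).symm.trans
    (((pbReindexing_isInduced κ hP).act_omega f g h e).trans (star_pushTri_star_eq _ _ _ _))
  gamma f e := by
    have h := (pbReindexing_isInduced κ hP).act_gamma f e
    -- The right unitor is moved across the equation, where it removes the identity 1-cell that ends
    -- the pasting.
    rw [act_comp_right, Iso.comp_inv_eq] at h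
    exact (act_unitTri_eq _ _).symm.trans (h.trans (star_pushTri_star_rightUnitor_eq _ _ _ _))
  delta f e := (act_star_whisk_leftUnitor_eq _ _ _).symm.trans
    ((pbReindexing_isInduced κ hP).act_delta f e)

end ReindexingData

end FibredBicat

namespace FibredBicat

/-! ### Evaluation rules for the constraints of a trihomomorphism. -/

section Evaluation

variable {E : Type u₁} [Bicategory.{w₁, v₁} E] {B : Type u₂} [Bicategory.{w₂, v₂} B]
  {P : E ⥤ᵖ B} {κ : Cleavage P} {a b c d : B}

namespace ReindexingData

variable {T : TrihomData B (fun b => Fibre κ b)} (R : ReindexingData κ T) {w : E}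

lemma leg_cartesian (f : a ⟶ b) (e : Fibre κ b) : IsCartesian₁ P (leg (R.c f) e) := by
  -- The object and the 1-cell in `c_app` are equal only as a dependent pair, so both pairs are
  -- generalised before substitution.
  have h : ∀ s t : (x : FibreObj P a) × (x.obj ⟶ e.pt.obj), s = t →
      IsCartesian₁ P t.2 → IsCartesian₁ P s.2 := by
    rintro s _ rfl h
    exact h
  exact h _ _ (R.c_app f e) (κ.cart_cartesian f e.pt)

/-- The triangle of `ψ σ`, followed by a 1-cell. -/
noncomputable def psiC {f g : a ⟶ b} (σ : f ⟶ g) (e : Fibre κ b) (C : (incl κ b).obj e ⟶ w) :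
    (incl κ a).map (T.tw σ e) ≫ (leg (R.c f) e ≫ C) ⟶ leg (R.c g) e ≫ C :=
  whisk (incl κ a) (R.psiTri σ e) C

/-- The triangle of `X f g`, followed by a 1-cell. -/
noncomputable def xiC (f : a ⟶ b) (g : b ⟶ c) (e : Fibre κ c) (C : (incl κ c).obj e ⟶ w) :
    (incl κ a).map (T.chi f g e) ≫ (leg (R.c (f ≫ g)) e ≫ C) ⟶
      leg (R.c f) ((T.map₁ g).obj e) ≫ (leg (R.c g) e ≫ C) :=
  whisk (incl κ a) (R.xiTri f g e) C ≫ (α_ _ _ _).hom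

/-- The triangle of `I a`, followed by a 1-cell. -/
noncomputable def iiC (a : B) (e : Fibre κ a) (C : (incl κ a).obj e ⟶ w) :
    (incl κ a).map (T.iota a e) ≫ (leg (R.c (𝟙 a)) e ≫ C) ⟶ C :=
  whisk (incl κ a) (R.iiTri a e) C ≫ (λ_ _).hom

lemma push_leftUnitTrans {X : Type u₃} [Bicategory.{w₃, v₃} X] {J : X ⥤ᵖ E} {x y : X} {u : x ⟶ y}
    {C : J.obj y ⟶ w} {D : J.obj x ⟶ w} (τ : J.map u ≫ C ⟶ D) :
    push (leftUnitTrans J) τ = pre J (λ_ _).hom τ ≫ (λ_ _).inv := by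
  have h : pushTri (C₁ := 𝟙 _) (C₂ := 𝟙 _) ((ρ_ (J.map u)).hom ≫ (λ_ (J.map u)).inv) τ =
      pre J (λ_ _).hom τ ≫ (λ_ _).inv := by
    simp [pushTri, whisk, pre]
  exact h

section Naturality

/-- The triangle of `χ f g`. -/
noncomputable def chiTri (f : a ⟶ b) (g : b ⟶ c) :
    Tri (compTrans (R.c f) (R.c g)) (R.c (f ≫ g)) :=
  Tri.ofHom (T.χ f g).hom ((R.X f g).hom ≫ (compTransIso (R.c f) (R.c g)).inv)

variable {x y : Fibre κ b}

lemma act_twNat {f g : a ⟶ b} (σ : f ⟶ g) {u : x ⟶ y} {C : (incl κ b).obj y ⟶ w}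
    {D : (incl κ b).obj x ⟶ w} (τ : (incl κ b).map u ≫ C ⟶ D) :
    act (incl κ a) (T.twNat σ u).hom (star (incl κ a) (R.psiC σ x D) (push (R.c f) τ)) =
      star (incl κ a) (push (R.c g) τ) (R.psiC σ y C) :=
  Tri.naturality_push (Tri.ofHom (T.map₂ σ) (R.ψ σ)) τ

lemma act_twNat_inv {f g : a ⟶ b} (σ : f ⟶ g) {u : x ⟶ y} {C : (incl κ b).obj y ⟶ w}
    {D : (incl κ b).obj x ⟶ w} (τ : (incl κ b).map u ≫ C ⟶ D) :
    act (incl κ a) (T.twNat σ u).inv (star (incl κ a) (push (R.c g) τ) (R.psiC σ y C)) =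
      star (incl κ a) (R.psiC σ x D) (push (R.c f) τ) :=
  act_inv_eq _ (R.act_twNat σ τ)

/-- This is naturality of `chiTri`. Its source is a pasting of transformations, so the transport on
that side is iterated, and the associators hidden in `xiC` absorb the rebracketing of legs. -/
lemma act_chiNat {f : c ⟶ a} {g : a ⟶ b} {u : x ⟶ y} {C : (incl κ b).obj y ⟶ w}
    {D : (incl κ b).obj x ⟶ w} (τ : (incl κ b).map u ≫ C ⟶ D) :
    act (incl κ c) (T.chiNat f g u).hom (star (incl κ c) (R.xiC f g x D) (push (R.c (f ≫ g)) τ)) =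
      star (incl κ c) (push (R.c f) (push (R.c g) τ)) (R.xiC f g y C) := by
  have h : act (incl κ c) (T.chiNat f g u).hom
      (star (incl κ c) (whisk (incl κ c) (R.xiTri f g x) D) (push (R.c (f ≫ g)) τ)) =
      star (incl κ c) (pre (incl κ c) (α_ _ _ _).hom (push (R.c f) (push (R.c g) τ)) ≫
        (α_ _ _ _).inv) (whisk (incl κ c) (R.xiTri f g y) C) :=
    ((R.chiTri f g).naturality_push τ).trans (congrArg (star _ · _) (push_compTrans _ _ τ))
  rw [xiC, star_comp_left, act_comp_right, h, star_comp_left, Category.assoc, Iso.inv_hom_id,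
    Category.comp_id, ← star_comp_right, xiC]

lemma act_chiNat_inv {f : c ⟶ a} {g : a ⟶ b} {u : x ⟶ y} {C : (incl κ b).obj y ⟶ w}
    {D : (incl κ b).obj x ⟶ w} (τ : (incl κ b).map u ≫ C ⟶ D) :
    act (incl κ c) (T.chiNat f g u).inv
      (star (incl κ c) (push (R.c f) (push (R.c g) τ)) (R.xiC f g y C)) =
      star (incl κ c) (R.xiC f g x D) (push (R.c (f ≫ g)) τ) :=
  act_inv_eq _ (R.act_chiNat τ)

lemma act_iotaNat {u : x ⟶ y} {C : (incl κ b).obj y ⟶ w}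
    {D : (incl κ b).obj x ⟶ w} (τ : (incl κ b).map u ≫ C ⟶ D) :
    act (incl κ b) (T.iotaNat b u).hom (star (incl κ b) (R.iiC b x D) (push (R.c (𝟙 b)) τ)) =
      star (incl κ b) τ (R.iiC b y C) := by
  have h : act (incl κ b) (T.iotaNat b u).hom
      (star (incl κ b) (whisk (incl κ b) (R.iiTri b x) D) (push (R.c (𝟙 b)) τ)) =
      star (incl κ b) (pre (incl κ b) (λ_ _).hom τ ≫ (λ_ _).inv)
        (whisk (incl κ b) (R.iiTri b y) C) :=
    ((Tri.ofHom (T.ι b).hom (R.I b).hom).naturality_push τ).trans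
      (congrArg (star _ · _) (push_leftUnitTrans τ))
  rw [iiC, star_comp_left, act_comp_right, h, star_comp_left, Category.assoc, Iso.inv_hom_id,
    Category.comp_id, ← star_comp_right, iiC]

lemma act_iotaNat_inv {u : x ⟶ y} {C : (incl κ b).obj y ⟶ w}
    {D : (incl κ b).obj x ⟶ w} (τ : (incl κ b).map u ≫ C ⟶ D) :
    act (incl κ b) (T.iotaNat b u).inv (star (incl κ b) τ (R.iiC b y C)) =
      star (incl κ b) (R.iiC b x D) (push (R.c (𝟙 b)) τ) :=
  act_inv_eq _ (R.act_iotaNat τ)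

end Naturality

section Induced

variable {R} (h : R.IsInduced)
include h

/-- The equations of `IsInduced` are extended, here and below, by an arbitrary 1-cell `C` after the
legs. This lets the rules apply inside a larger pasting, and also under `push` when a constraint is
mapped by some `f^*`. The result depends only on `υ`, which is how equations between 2-cells of `B`
are used. -/
lemma act_twComp {f g g' : a ⟶ b} (σ : f ⟶ g) (τ : g ⟶ g') (υ : f ⟶ g') (hυ : σ ≫ τ = υ)
    (e : Fibre κ b) (C : (incl κ b).obj e ⟶ w) :
    act (incl κ a) (T.twComp σ τ υ hυ e).hom
      (star (incl κ a) (R.psiC τ e C) (R.psiC σ e C)) = R.psiC υ e C := by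
  subst hυ
  rw [psiC, psiC, star_whisk, act_whisk, h.act_twComp, psiC]

lemma act_twComp_inv {f g g' : a ⟶ b} (σ : f ⟶ g) (τ : g ⟶ g') (υ : f ⟶ g') (hυ : σ ≫ τ = υ)
    (e : Fibre κ b) (C : (incl κ b).obj e ⟶ w) :
    act (incl κ a) (T.twComp σ τ υ hυ e).inv (R.psiC υ e C) =
      star (incl κ a) (R.psiC τ e C) (R.psiC σ e C) :=
  act_inv_eq _ (act_twComp h σ τ υ hυ e C)

lemma act_twId {f : a ⟶ b} (σ : f ⟶ f) (hσ : σ = 𝟙 f) (e : Fibre κ b)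
    (C : (incl κ b).obj e ⟶ w) : act (incl κ a) (T.twId σ hσ e).hom
      (unitTri (incl κ a) (leg (R.c f) e ≫ C)) = R.psiC σ e C := by
  subst hσ
  rw [← unitTri_whisk, act_whisk, h.act_twId, psiC]

lemma act_twId_inv {f : a ⟶ b} (σ : f ⟶ f) (hσ : σ = 𝟙 f) (e : Fibre κ b)
    (C : (incl κ b).obj e ⟶ w) : act (incl κ a) (T.twId σ hσ e).inv (R.psiC σ e C) =
      unitTri (incl κ a) (leg (R.c f) e ≫ C) :=
  act_inv_eq _ (act_twId h σ hσ e C)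

lemma act_chi₂ {f f' : a ⟶ b} {g g' : b ⟶ c} (α : f ⟶ f') (β : g ⟶ g') (e : Fibre κ c)
    (C : (incl κ c).obj e ⟶ w) :
    act (incl κ a) (T.chi₂ α β e).hom
      (star (incl κ a) (R.xiC f' g' e C) (R.psiC (hor α β) e C)) =
      star (incl κ a) (star (incl κ a) (R.psiC α ((T.map₁ g').obj e) (leg (R.c g') e ≫ C))
        (push (R.c f) (R.psiC β e C))) (R.xiC f g e C) := by
  have e₁ : star (incl κ a) (R.xiC f' g' e C) (R.psiC (hor α β) e C) =
      whisk (incl κ a) (star (incl κ a) (R.xiTri f' g' e) (R.psiTri (hor α β) e)) C ≫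
        (α_ _ _ _).hom := by
    rw [xiC, psiC, star_comp_left, star_whisk]
  rw [e₁, act_comp_right, act_whisk, h.act_chi₂, ← star_whisk, ← star_comp_left, ← star_whisk,
    ← star_comp_left, whisk_whisk, ← star_comp_right, push_whisk, star_pre, ← star_comp_right]
  rfl

lemma act_chi₂_inv {f f' : a ⟶ b} {g g' : b ⟶ c} (α : f ⟶ f') (β : g ⟶ g') (e : Fibre κ c)
    (C : (incl κ c).obj e ⟶ w) :
    act (incl κ a) (T.chi₂ α β e).inv (star (incl κ a) (star (incl κ a)
      (R.psiC α ((T.map₁ g').obj e) (leg (R.c g') e ≫ C)) (push (R.c f) (R.psiC β e C)))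
      (R.xiC f g e C)) = star (incl κ a) (R.xiC f' g' e C) (R.psiC (hor α β) e C) :=
  act_inv_eq _ (act_chi₂ h α β e C)

lemma act_omega (f : a ⟶ b) (g : b ⟶ c) (k : c ⟶ d) (e : Fibre κ d)
    (C : (incl κ d).obj e ⟶ w) :
    act (incl κ a) (T.omega f g k e).hom (star (incl κ a)
      (R.xiC f g ((T.map₁ k).obj e) (leg (R.c k) e ≫ C)) (R.xiC (f ≫ g) k e C)) =
      star (incl κ a) (push (R.c f) (R.xiC g k e C))
        (star (incl κ a) (R.xiC f (g ≫ k) e C) (R.psiC (α_ f g k).hom e C)) := by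
  -- The pasting is rewritten as the triangle of `IsInduced` whiskered by `C`, followed by
  -- associators of the three legs and `C`.
  have e₁ : star (incl κ a) (R.xiC f g ((T.map₁ k).obj e) (leg (R.c k) e ≫ C))
      (R.xiC (f ≫ g) k e C) = whisk (incl κ a) (star (incl κ a) (whisk (incl κ a)
        (R.xiTri f g ((T.map₁ k).obj e)) (leg (R.c k) e)) (R.xiTri (f ≫ g) k e) ≫
          (α_ _ _ _).hom) C ≫ (α_ _ _ _).hom ≫ leg (R.c f) _ ◁ (α_ _ _ _).hom := by
    rw [xiC, xiC, star_comp_left, star_comp_right, ← whisk_whisk, star_comp_left, star_whisk,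
      whisk_comp]
    simp
  rw [e₁, act_comp_right, act_whisk, h.act_omega, ← star_whisk, ← star_whisk, ← star_comp_left,
    ← Category.assoc (whisk _ _ _), push_whisk, ← pre_comp_right, ← push_comp, ← star_comp_right,
    ← star_comp_left]
  rfl

lemma act_gamma (f : a ⟶ b) (e : Fibre κ b) (C : (incl κ b).obj e ⟶ w) :
    act (incl κ a) (T.gamma f e).hom (unitTri (incl κ a) (leg (R.c f) e ≫ C)) =
      star (incl κ a) (push (R.c f) (R.iiC b e C))
        (star (incl κ a) (R.xiC f (𝟙 b) e C) (R.psiC (ρ_ f).inv e C)) := by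
  have e₁ : unitTri (incl κ a) (leg (R.c f) e ≫ C) =
      whisk (incl κ a) (unitTri (incl κ a) (leg (R.c f) e) ≫ (ρ_ _).inv) C ≫
        (α_ _ _ _).hom ≫ leg (R.c f) _ ◁ (λ_ _).hom := by
    rw [whisk_comp, unitTri_whisk]
    simp
  rw [e₁, act_comp_right, act_whisk, h.act_gamma, ← star_whisk, ← star_whisk, ← star_comp_left,
    ← Category.assoc (whisk _ _ _), push_whisk, ← pre_comp_right, ← push_comp, ← star_comp_right,
    ← star_comp_left]
  rfl

lemma act_delta (f : a ⟶ b) (e : Fibre κ b) (C : (incl κ b).obj e ⟶ w) :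
    act (incl κ a) (T.delta f e).hom (star (incl κ a)
      (R.iiC a ((T.map₁ f).obj e) (leg (R.c f) e ≫ C)) (R.xiC (𝟙 a) f e C)) =
      R.psiC (λ_ f).hom e C := by
  have e₁ : star (incl κ a) (R.iiC a ((T.map₁ f).obj e) (leg (R.c f) e ≫ C))
      (R.xiC (𝟙 a) f e C) = whisk (incl κ a) (star (incl κ a) (whisk (incl κ a)
        (R.iiTri a ((T.map₁ f).obj e)) (leg (R.c f) e)) (R.xiTri (𝟙 a) f e) ≫ (λ_ _).hom) C := by
    rw [iiC, xiC, star_comp_left, star_comp_right, ← whisk_whisk, star_comp_left, star_whisk,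
      whisk_comp]
    simp
  rw [e₁, act_whisk, h.act_delta, psiC]

end Induced

end ReindexingData

end Evaluation

end FibredBicat

namespace FibredBicat

/-! ### Verification of the trihomomorphism axioms. -/

section Axioms

variable {E : Type u₁} [Bicategory.{w₁, v₁} E] {B : Type u₂} [Bicategory.{w₂, v₂} B]
  {P : E ⥤ᵖ B} {κ : Cleavage P} {a b c d : B}

namespace ReindexingData

variable {T : TrihomData B (fun b => Fibre κ b)} {R : ReindexingData κ T} {w : E}
  (hP : IsFibration P) (hR : R.IsReindexing) (h : R.IsInduced)

include hP in
lemma xiC_cartesian (f : a ⟶ b) (g : b ⟶ c) (e : Fibre κ c) (C : (incl κ c).obj e ⟶ w) :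
    IsCartesian₂ P (R.xiC f g e C) :=
  (hP.whisk_cartesian (.of_iso (R.xi f g e)) C).comp (.of_iso (α_ _ _ _))

include hP in
lemma iiC_cartesian (a : B) (e : Fibre κ a) (C : (incl κ a).obj e ⟶ w) :
    IsCartesian₂ P (R.iiC a e C) :=
  (hP.whisk_cartesian (.of_iso (R.ii a e)) C).comp (.of_iso (λ_ _))

include hP hR in
lemma psiC_cartesian {f g : a ⟶ b} (σ : f ⟶ g) (e : Fibre κ b) (C : (incl κ b).obj e ⟶ w) :
    IsCartesian₂ P (R.psiC σ e C) :=
  hP.whisk_cartesian (hR.psi_cartesian σ e) C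

include hP in
lemma push_cartesian {f : a ⟶ b} {x y : Fibre κ b} {u : x ⟶ y} {C : (incl κ b).obj y ⟶ w}
    {D : (incl κ b).obj x ⟶ w} {τ : (incl κ b).map u ≫ C ⟶ D} (hτ : IsCartesian₂ P τ) :
    IsCartesian₂ P (push (R.c f) τ) :=
  hP.pushTri_cartesian (.of_iso ((R.c f).naturality u)) hτ

/-- The identity after the leg gives the test triangle the shape to which the rules with a trailing
`C` apply; the edge remains cartesian as a composite of cartesian 1-cells. -/
lemma hom₂_ext {f : a ⟶ b} {e : Fibre κ b} {z : Fibre κ a} {s t : z ⟶ (T.map₁ f).obj e}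
    {D : (incl κ a).obj z ⟶ (incl κ b).obj e} (p : (incl κ a).map t ≫ leg (R.c f) e ≫ 𝟙 _ ⟶ D)
    (hp : IsCartesian₂ P p) {θ θ' : s ⟶ t} (h : act (incl κ a) θ p = act (incl κ a) θ' p) :
    θ = θ' :=
  hom₂_ext_of_cartesian ((R.leg_cartesian f e).comp (isCartesian₁_id _)) hp h

set_option linter.unusedSimpArgs false

include hP hR h in
/-- The constraints induced by cartesian triangles satisfy the axioms of a trihomomorphism. -/
theorem isTrihomomorphism : T.IsTrihomomorphism where
  χ₂_id f g x := by
    -- In every axiom the test triangle is read off from the common target of both sides, with one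
    -- triangle for each factor: `xiC` for `chi`, `psiC` for `tw`, `iiC` for `iota`, and `push` for
    -- images under some `f^*`. Its cartesianness is all that is needed of it.
    refine hom₂_ext (R.xiC f g x (𝟙 _))
      (xiC_cartesian hP _ _ _ _) ?_
    -- Both sides are evaluated from the last 2-cell to the first; each rule turns one pasted
    -- triangle into another, and the two evaluations end in the same triangle. The same rules
    -- settle all the axioms.
    simp only [act_bicategoricalComp, act_comp, act_id, act_whiskerLeft, act_whiskerRight,
      act_associator_hom, act_associator_inv, act_leftUnitor_hom, act_leftUnitor_inv,
      act_rightUnitor_hom, act_rightUnitor_inv, BicategoricalCoherence.iso, Iso.trans_hom,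
      Iso.symm_hom, Iso.refl_hom, whiskerRightIso_hom, whiskerLeftIso_hom, act_map₂_push,
      act_mapId_push, act_mapComp_push, act_mapComp_inv_push, act_twId h, act_twId_inv h,
      act_twComp h, act_twComp_inv h, act_twNat, act_twNat_inv, act_chiNat, act_chiNat_inv,
      act_iotaNat_inv, act_chi₂ h, act_chi₂_inv h, act_omega h, act_gamma h, act_delta h]
  χ₂_comp {a b c f f' f'' g g' g''} α α' β β' x := by
    refine hom₂_ext (star _ (R.xiC f'' g'' x (𝟙 _)) (star _ (R.psiC (hor α' β') x (𝟙 _))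
      (R.psiC (hor α β) x (𝟙 _))))
      (hP.star_cartesian (xiC_cartesian hP _ _ _ _) (hP.star_cartesian
        (psiC_cartesian hP hR _ _ _) (psiC_cartesian hP hR _ _ _))) ?_
    simp only [act_bicategoricalComp, act_comp, act_id, act_whiskerLeft, act_whiskerRight,
      act_associator_hom, act_associator_inv, act_leftUnitor_hom, act_leftUnitor_inv,
      act_rightUnitor_hom, act_rightUnitor_inv, BicategoricalCoherence.iso, Iso.trans_hom,
      Iso.symm_hom, Iso.refl_hom, whiskerRightIso_hom, whiskerLeftIso_hom, act_map₂_push,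
      act_mapId_push, act_mapComp_push, act_mapComp_inv_push, act_twId h, act_twId_inv h,
      act_twComp h, act_twComp_inv h, act_twNat, act_twNat_inv, act_chiNat, act_chiNat_inv,
      act_iotaNat_inv, act_chi₂ h, act_chi₂_inv h, act_omega h, act_gamma h, act_delta h]
  ω_naturality {a b c d f f' g g' h₁ h₁'} α β γ x := by
    -- The target has five factors. Each triangle carries as its trailing 1-cell the legs not yet
    -- consumed, so that consecutive edges match.
    refine hom₂_ext (star _ (R.psiC α _ (leg (R.c g') _ ≫ leg (R.c h₁') x ≫ 𝟙 _))
      (star _ (push (R.c f) (R.psiC β _ (leg (R.c h₁') x ≫ 𝟙 _)))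
        (star _ (push (R.c f) (push (R.c g) (R.psiC γ x (𝟙 _))))
          (star _ (R.xiC f g _ (leg (R.c h₁) x ≫ 𝟙 _)) (R.xiC (f ≫ g) h₁ x (𝟙 _))))))
      (hP.star_cartesian (psiC_cartesian hP hR _ _ _) (hP.star_cartesian
        (push_cartesian hP (psiC_cartesian hP hR _ _ _)) (hP.star_cartesian
          (push_cartesian hP (push_cartesian hP (psiC_cartesian hP hR _ _ _)))
          (hP.star_cartesian (xiC_cartesian hP _ _ _ _) (xiC_cartesian hP _ _ _ _))))) ?_
    simp only [act_bicategoricalComp, act_comp, act_id, act_whiskerLeft, act_whiskerRight,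
      act_associator_hom, act_associator_inv, act_leftUnitor_hom, act_leftUnitor_inv,
      act_rightUnitor_hom, act_rightUnitor_inv, BicategoricalCoherence.iso, Iso.trans_hom,
      Iso.symm_hom, Iso.refl_hom, whiskerRightIso_hom, whiskerLeftIso_hom, act_map₂_push,
      act_mapId_push, act_mapComp_push, act_mapComp_inv_push, act_twId h, act_twId_inv h,
      act_twComp h, act_twComp_inv h, act_twNat, act_twNat_inv, act_chiNat, act_chiNat_inv,
      act_iotaNat_inv, act_chi₂ h, act_chi₂_inv h, act_omega h, act_gamma h, act_delta h]
  γ_naturality σ x := by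
    refine hom₂_ext (R.psiC σ x (𝟙 _))
      (psiC_cartesian hP hR _ _ _) ?_
    simp only [act_bicategoricalComp, act_comp, act_id, act_whiskerLeft, act_whiskerRight,
      act_associator_hom, act_associator_inv, act_leftUnitor_hom, act_leftUnitor_inv,
      act_rightUnitor_hom, act_rightUnitor_inv, BicategoricalCoherence.iso, Iso.trans_hom,
      Iso.symm_hom, Iso.refl_hom, whiskerRightIso_hom, whiskerLeftIso_hom, act_map₂_push,
      act_mapId_push, act_mapComp_push, act_mapComp_inv_push, act_twId h, act_twId_inv h,
      act_twComp h, act_twComp_inv h, act_twNat, act_twNat_inv, act_chiNat, act_chiNat_inv,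
      act_iotaNat_inv, act_chi₂ h, act_chi₂_inv h, act_omega h, act_gamma h, act_delta h]
  δ_naturality {a b f f'} σ x := by
    refine hom₂_ext (star _ (R.psiC σ x (𝟙 _)) (star _ (R.iiC a _ (leg (R.c f) x ≫ 𝟙 _))
      (R.xiC (𝟙 a) f x (𝟙 _))))
      (hP.star_cartesian (psiC_cartesian hP hR _ _ _)
        (hP.star_cartesian (iiC_cartesian hP _ _ _) (xiC_cartesian hP _ _ _ _))) ?_
    simp only [act_bicategoricalComp, act_comp, act_id, act_whiskerLeft, act_whiskerRight,
      act_associator_hom, act_associator_inv, act_leftUnitor_hom, act_leftUnitor_inv,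
      act_rightUnitor_hom, act_rightUnitor_inv, BicategoricalCoherence.iso, Iso.trans_hom,
      Iso.symm_hom, Iso.refl_hom, whiskerRightIso_hom, whiskerLeftIso_hom, act_map₂_push,
      act_mapId_push, act_mapComp_push, act_mapComp_inv_push, act_twId h, act_twId_inv h,
      act_twComp h, act_twComp_inv h, act_twNat, act_twNat_inv, act_chiNat, act_chiNat_inv,
      act_iotaNat_inv, act_chi₂ h, act_chi₂_inv h, act_omega h, act_gamma h, act_delta h]
  assoc f g h₁ k x := by
    refine hom₂_ext (star _ (R.xiC f g _ (leg (R.c h₁) _ ≫ leg (R.c k) x ≫ 𝟙 _))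
      (star _ (R.xiC (f ≫ g) h₁ _ (leg (R.c k) x ≫ 𝟙 _)) (R.xiC ((f ≫ g) ≫ h₁) k x (𝟙 _))))
      (hP.star_cartesian (xiC_cartesian hP _ _ _ _) (hP.star_cartesian
        (xiC_cartesian hP _ _ _ _) (xiC_cartesian hP _ _ _ _))) ?_
    simp only [act_bicategoricalComp, act_comp, act_id, act_whiskerLeft, act_whiskerRight,
      act_associator_hom, act_associator_inv, act_leftUnitor_hom, act_leftUnitor_inv,
      act_rightUnitor_hom, act_rightUnitor_inv, BicategoricalCoherence.iso, Iso.trans_hom,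
      Iso.symm_hom, Iso.refl_hom, whiskerRightIso_hom, whiskerLeftIso_hom, act_map₂_push,
      act_mapId_push, act_mapComp_push, act_mapComp_inv_push, act_twId h, act_twId_inv h,
      act_twComp h, act_twComp_inv h, act_twNat, act_twNat_inv, act_chiNat, act_chiNat_inv,
      act_iotaNat_inv, act_chi₂ h, act_chi₂_inv h, act_omega h, act_gamma h, act_delta h]
  unit f g x := by
    refine hom₂_ext (R.xiC f g x (𝟙 _))
      (xiC_cartesian hP _ _ _ _) ?_
    simp only [act_bicategoricalComp, act_comp, act_id, act_whiskerLeft, act_whiskerRight,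
      act_associator_hom, act_associator_inv, act_leftUnitor_hom, act_leftUnitor_inv,
      act_rightUnitor_hom, act_rightUnitor_inv, BicategoricalCoherence.iso, Iso.trans_hom,
      Iso.symm_hom, Iso.refl_hom, whiskerRightIso_hom, whiskerLeftIso_hom, act_map₂_push,
      act_mapId_push, act_mapComp_push, act_mapComp_inv_push, act_twId h, act_twId_inv h,
      act_twComp h, act_twComp_inv h, act_twNat, act_twNat_inv, act_chiNat, act_chiNat_inv,
      act_iotaNat_inv, act_chi₂ h, act_chi₂_inv h, act_omega h, act_gamma h, act_delta h]

end ReindexingData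

end Axioms

end FibredBicat


theorem mainTheorem3 {E : Type u₁} [Bicategory.{w₁, v₁} E] {B : Type u₂} [Bicategory.{w₂, v₂} B]
    (P : E ⥤ᵖ B) (hP : IsFibration P) (κ : Cleavage P) :
    ∃ (T : Trihomomorphism B (fun b => Fibre κ b)) (R : ReindexingData κ T.toTrihomData),
      R.IsReindexing :=
  ⟨⟨pbData κ hP, ReindexingData.isTrihomomorphism hP
      (pbReindexing_isReindexing κ hP) (pbReindexing_isInduced κ hP)⟩,
    pbReindexing κ hP, pbReindexing_isReindexing κ hP⟩
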